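/- **Proposition 1.5.** Let $\Gamma$ be a countable group and let $\Lambda$ be a co-amenable subgroup of $\Gamma$, i.e. there is a sequence $f_n\in\ell^1(\Gamma/\Lambda)$ with $f_n\ge 0$, $\|f_n\|_1=1$ and $\|\pi(\gamma)f_n-f_n\|_1\to 0$ as $n\to\infty$ for every $\gamma\in\Gamma$, where $(\pi(\gamma)f)(x)=f(\gamma^{-1}x)$ for $x\in\Gamma/\Lambda$. Let $\Gamma\curvearrowright(X,\mu)$ be a measure preserving action on a probability space. Then $\Gamma\curvearrowright(X,\mu)$ has property (T) relative to the space if and only if the restricted action $\Lambda\curvearrowright(X,\mu)$ has property (T) relative to the space. Here a measure preserving action $G\curvearrowright(X,\mu)$ of a countable group on a probability space has *property (T) relative to the space* if the inclusion $L^\infty(X)\subset M:=L^\infty(X)\rtimes G$ has the relative property (T) of Popa. Explicitly, $M$ is the von Neumann algebra on $L^2(X,\mu)\otimes\ell^2(G)$ generated by the operators $f\otimes 1$ ($f\in L^\infty(X)$ acting by multiplication) and $u_g=\sigma_g\otimes\lambda_g$ ($g\in G$), where $(\sigma_g\xi)(x)=\xi(g^{-1}x)$ and $\lambda$ is the left regular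 representation; $\tau(x)=\langle x(1\otimes\delta_e),1\otimes\delta_e\rangle$ is its canonical trace, and $\|x\|_2=\tau(x^*x)^{1/2}$. The relative property (T) says: for every $\varepsilon>0$ there are a finite set $F\subset M$ and $\delta>0$ such that every normal completely positive linear map $\varphi:M\to M$ with $\varphi(1)\le 1$, $\tau\circ\varphi\le\tau$ on positive elements, and $\|\varphi(x)-x\|_2\le\delta$ for all $x\in F$, satisfies $\|\varphi(b)-b\|_2\le\varepsilon$ for all $b\in L^\infty(X)$ with $\|b\|_\infty\le 1$. -/

import Mathlib

open MeasureTheory Filter Topology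
open scoped ENNReal

noncomputable section

/-! ### Co-amenable subgroups -/

/-- `Λ` is co-amenable in `Γ` (Eymard): there are `f n ∈ ℓ¹(Γ/Λ)` with `f n ≥ 0`, `‖f n‖₁ = 1` and
`‖π(γ) (f n) - f n‖₁ → 0` for every `γ`, where `(π(γ) f)(x) = f (γ⁻¹ x)` on left cosets. -/
def Subgroup.IsCoamenable {Γ : Type*} [Group Γ] (Λ : Subgroup Γ) : Prop :=
  ∃ f : ℕ → Γ ⧸ Λ → ℝ,
    (∀ n x, 0 ≤ f n x) ∧
    (∀ n, HasSum (f n) 1) ∧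
    ∀ γ : Γ, Tendsto (fun n => ∑' x, |f n (γ⁻¹ • x) - f n x|) atTop (𝓝 0)

/-! ### Relative property (T) of an inclusion in a tracial von Neumann algebra

`M` is a von Neumann algebra on `H`, and `Ω` is a vector whose vector state
`τ x = ⟪Ω, x Ω⟫` is a faithful normal trace on `M`. -/

section RelativeT

variable {H : Type*} [NormedAddCommGroup H] [InnerProductSpace ℂ H] [CompleteSpace H]

/-- The von Neumann algebra generated by a set of operators: the double commutant of `S ∪ S*`. -/
def VonNeumannAlgebra.generatedBy (S : Set (H →L[ℂ] H)) : VonNeumannAlgebra H where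
  toStarSubalgebra :=
    StarSubalgebra.centralizer ℂ (StarSubalgebra.centralizer ℂ S : Set (H →L[ℂ] H))
  centralizer_centralizer' := by
    change Set.centralizer (Set.centralizer
      ((StarSubalgebra.centralizer ℂ
        (StarSubalgebra.centralizer ℂ S : Set (H →L[ℂ] H)) : Set (H →L[ℂ] H))))
      = (StarSubalgebra.centralizer ℂ
        (StarSubalgebra.centralizer ℂ S : Set (H →L[ℂ] H)) : Set (H →L[ℂ] H))
    rw [StarSubalgebra.coe_centralizer_centralizer, Set.centralizer_centralizer_centralizer]

/-- The vector functional `x ↦ ⟪Ω, x Ω⟫`. -/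
def vectorState (Ω : H) (x : H →L[ℂ] H) : ℂ := inner ℂ Ω (x Ω)

/-- The norm `‖x‖₂ = τ(x* x) ^ (1/2)` of the vector state `τ` given by `Ω`. -/
def traceNorm (Ω : H) (x : H →L[ℂ] H) : ℝ := Real.sqrt (vectorState Ω (star x * x)).re

/-- A matrix of operators on `H` is positive as an operator on `H ^ n`. -/
def IsPositiveOperatorMatrix {n : ℕ} (x : Fin n → Fin n → H →L[ℂ] H) : Prop :=
  ∀ ξ : Fin n → H, ∃ r : ℝ, 0 ≤ r ∧ ∑ i, ∑ j, inner ℂ (ξ i) (x i j (ξ j)) = (r : ℂ)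

variable {M : VonNeumannAlgebra H}

/-- `φ : M → M` is completely positive: every amplification `M_n(M) → M_n(M)` is positive. -/
def IsCompletelyPositiveOn (φ : M.toStarSubalgebra →ₗ[ℂ] M.toStarSubalgebra) : Prop :=
  ∀ (n : ℕ) (x : Fin n → Fin n → M.toStarSubalgebra),
    IsPositiveOperatorMatrix (fun i j => (x i j : H →L[ℂ] H)) →
      IsPositiveOperatorMatrix (fun i j => (φ (x i j) : H →L[ℂ] H))

/-- `φ : M → M` is normal: it is continuous for the weak operator topology on bounded sets (for
bounded linear `φ` this is the same as ultraweak continuity). -/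
def IsNormalOn (φ : M.toStarSubalgebra →ₗ[ℂ] M.toStarSubalgebra) : Prop :=
  ∀ (l : Filter M.toStarSubalgebra) (x : M.toStarSubalgebra) (C : ℝ),
    (∀ᶠ y : M.toStarSubalgebra in l, ‖(y : H →L[ℂ] H)‖ ≤ C) →
    (∀ ξ η : H, Tendsto (fun y : M.toStarSubalgebra => inner ℂ η ((y : H →L[ℂ] H) ξ)) l
      (𝓝 (inner ℂ η ((x : H →L[ℂ] H) ξ)))) →
    ∀ ξ η : H, Tendsto (fun y : M.toStarSubalgebra => inner ℂ η ((φ y : H →L[ℂ] H) ξ)) l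
      (𝓝 (inner ℂ η ((φ x : H →L[ℂ] H) ξ)))

/-- The inclusion `B ⊆ M` is rigid, that is, has the relative property (T) (Popa), with respect to
the trace `τ` of `Ω`: for every `ε > 0` there are a finite `F ⊆ M` and `δ > 0` such that every normal
completely positive `φ : M → M` with `φ(1) ≤ 1`, `τ ∘ φ ≤ τ` and `‖φ(x) - x‖₂ ≤ δ` for `x ∈ F`
satisfies `‖φ(b) - b‖₂ ≤ ε` for all `b` in the unit ball of `B`. -/
def HasRelativePropertyT (M : VonNeumannAlgebra H) (B : Set (H →L[ℂ] H)) (Ω : H) : Prop :=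
  ∀ ε : ℝ, 0 < ε → ∃ (F : Finset M.toStarSubalgebra) (δ : ℝ), 0 < δ ∧
    ∀ φ : M.toStarSubalgebra →ₗ[ℂ] M.toStarSubalgebra,
      IsCompletelyPositiveOn φ →
      IsNormalOn φ →
      (φ 1 : H →L[ℂ] H) ≤ 1 →
      (∀ x : M.toStarSubalgebra, (x : H →L[ℂ] H).IsPositive →
        (vectorState Ω (φ x)).re ≤ (vectorState Ω x).re) →
      (∀ x ∈ F, traceNorm Ω ((φ x : H →L[ℂ] H) - x) ≤ δ) →
      ∀ b : M.toStarSubalgebra, (b : H →L[ℂ] H) ∈ B → ‖(b : H →L[ℂ] H)‖ ≤ 1 →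
        traceNorm Ω ((φ b : H →L[ℂ] H) - b) ≤ ε

end RelativeT

/-! ### The group measure space construction -/

namespace GroupMeasureSpace

variable (Γ : Type*) [Group Γ] {X : Type*} [MeasurableSpace X] (μ : Measure X)

/-- The Hilbert space `ℓ²(Γ, L²(X, μ)) = L²(X, μ) ⊗ ℓ²(Γ)`. -/
abbrev Space : Type _ := lp (fun _ : Γ => Lp ℂ 2 μ) 2

/-- Multiplication by `f ∈ L^∞(X, μ)` on `L²(X, μ)`. -/
def mulL2 (f : Lp ℂ ∞ μ) : Lp ℂ 2 μ →L[ℂ] Lp ℂ 2 μ :=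
  (ContinuousLinearMap.mul ℂ ℂ).holderL μ ∞ 2 2 f

/-- The operator `f ⊗ 1`, for `f ∈ L^∞(X, μ)`. -/
def mulOp (f : Lp ℂ ∞ μ) : Space Γ μ →L[ℂ] Space Γ μ :=
  lp.mapCLM 2 (fun _ => mulL2 μ f) (norm_nonneg _) (fun _ => le_rfl)

/-- The copy of `L^∞(X, μ)` in the group measure space algebra. -/
def linftySet : Set (Space Γ μ →L[ℂ] Space Γ μ) := Set.range (mulOp Γ μ)

open scoped Classical in
/-- The vector `1 ⊗ δ_e`. Its vector state is the canonical trace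
`∑ a_γ u_γ ↦ ∫ a_e dμ` of the group measure space algebra. -/
def traceVector [IsProbabilityMeasure μ] : Space Γ μ :=
  lp.single 2 (1 : Γ) (Lp.const 2 μ (1 : ℂ))

variable {Γ} [MulAction Γ X] [MeasurableConstSMul Γ X] [SMulInvariantMeasure Γ X μ]

/-- The Koopman operator `(σ_γ ξ)(x) = ξ(γ⁻¹ x)` on `L²(X, μ)`. -/
def koopman (γ : Γ) : Lp ℂ 2 μ →ₗᵢ[ℂ] Lp ℂ 2 μ :=
  Lp.compMeasurePreservingₗᵢ ℂ (fun x : X => γ⁻¹ • x) (measurePreserving_smul γ⁻¹ μ)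

/-- The operator `u_γ = σ_γ ⊗ λ_γ`, that is `(u_γ ξ)(s) = σ_γ (ξ(γ⁻¹ s))`. -/
def groupOp (γ : Γ) : Space Γ μ →L[ℂ] Space Γ μ :=
  LinearIsometry.toContinuousLinearMap
    { toFun := fun ξ => ⟨fun s => koopman μ γ (ξ (γ⁻¹ * s)), by
        have h2 : 0 < (2 : ℝ≥0∞).toReal := by norm_num
        refine (memℓp_gen_iff h2).2 ?_
        simp only [LinearIsometry.norm_map]
        exact ((memℓp_gen_iff h2).1 (lp.memℓp ξ)).comp_injective (mul_right_injective γ⁻¹)⟩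
      map_add' := fun ξ η => by ext1; funext s; simp; rfl
      map_smul' := fun c ξ => by ext1; funext s; simp
      norm_map' := fun ξ => by
        have h2 : 0 < (2 : ℝ≥0∞).toReal := by norm_num
        refine (Real.rpow_left_inj (norm_nonneg _) (norm_nonneg _) h2.ne').1 ?_
        rw [lp.norm_rpow_eq_tsum h2, lp.norm_rpow_eq_tsum h2]
        change ∑' s, ‖koopman μ γ (ξ (γ⁻¹ * s))‖ ^ (2 : ℝ≥0∞).toReal = _
        simp only [LinearIsometry.norm_map]
        exact (Equiv.mulLeft γ⁻¹).tsum_eq (fun s => ‖ξ s‖ ^ (2 : ℝ≥0∞).toReal) }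

variable (Γ)

/-- The group measure space von Neumann algebra `L^∞(X) ⋊ Γ`. -/
def algebra : VonNeumannAlgebra (Space Γ μ) :=
  VonNeumannAlgebra.generatedBy (linftySet Γ μ ∪ Set.range (groupOp (Γ := Γ) μ))

end GroupMeasureSpace

/-- The probability measure preserving action `Γ ↷ (X, μ)` has property (T) relative to the space:
the inclusion `L^∞(X) ⊆ L^∞(X) ⋊ Γ` has the relative property (T). -/
def HasPropertyTRelativeToSpace (Γ : Type*) [Group Γ] {X : Type*} [MeasurableSpace X]
    (μ : Measure X) [IsProbabilityMeasure μ] [MulAction Γ X] [MeasurableConstSMul Γ X]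
    [SMulInvariantMeasure Γ X μ] : Prop :=
  HasRelativePropertyT (GroupMeasureSpace.algebra Γ μ) (GroupMeasureSpace.linftySet Γ μ)
    (GroupMeasureSpace.traceVector Γ μ)

end

noncomputable section

/-! ### Amplifications along a decomposition of a Hilbert space -/

open scoped InnerProduct

/-! Write `M_Γ`, `M_Λ` for the two crossed products, `E : M_Γ → M_Λ` for the conditional expectation
(`condExp`), `ι : M_Λ → M_Γ` for the embedding (`induce`) and `Ω` for the trace vector. Call a map
subtracial if it is of the kind tested in the relative property (T). By Kadison–Schwarz such a map
is a contraction for `‖·‖₂`, so `‖φ(b) - b‖₂² ≤ 2 (‖b‖₂² - Re τ(b* φ(b)))`; conversely the deficit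
on the right is at most `‖φ(b) - b‖₂` when `‖b‖₂ ≤ 1`. Hence closeness to the identity on `L^∞(X)`
is a matter of the form `τ(g* φ(f))`.

From `Λ` to `Γ`: if `φ` is subtracial on `M_Γ`, then `E ∘ φ ∘ ι` is subtracial on `M_Λ`, is at least
as close to the identity on a finite set as `φ` is on its image, and has the same form on `L^∞(X)`
as `φ` (`norm_apply_mulElt_sub_sq_le`).

From `Γ` to `Λ`, where co-amenability enters: let `u_c` be the unitary of a representative of the
coset `c`. For a finitely supported unit vector `w ≥ 0` in `ℓ²(Γ/Λ)`, a subtracial `φ` on `M_Λ`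
induces the subtracial map `Φ(x) = ∑ w_c w_d u_c φ(E(u_c* x u_d)) u_d*` on `M_Γ`. For `φ = id` this
is the Fourier multiplier by `s ↦ ⟨s w, w⟩`, which tends pointwise to `1` along square roots of
almost invariant `ℓ¹` functions. So one first fixes `w` for which the multiplier is near the
identity on the given finite set, and then asks that `φ` be near the identity on the finitely many
coefficients `E(u_c* x u_d)`. Property (T) of `Γ` makes `Φ` uniformly close to the identity on the
unit ball of `L^∞(X)`.

It remains to descend from `Φ` to `φ`. The form of a subtracial map behaves like a positive measure
on `X × X` with first marginal at most `μ`, and closeness to the identity means that almost all the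
mass lies on `⋃ A_k × A_k`, uniformly over finite partitions `(A_k)` (`le_diagonalMass` by averaging
over random signs, `norm_applyTrace_sub_le` for the converse). The form of `Φ` is the average of the
translates of that of `φ`, with weights `w_c²`. Applying the bound for `Φ` to the common refinement
of the translates of a partition makes each translate refine the original one, and refining only
decreases the diagonal mass; so `φ` has at least as much (`le_diagonalMass_of_inducedMap`). -/

theorem lp.norm_sq_eq_tsum {ι E : Type*} [NormedAddCommGroup E] (ξ : lp (fun _ : ι => E) 2) :
    ‖ξ‖ ^ 2 = ∑' i, ‖ξ i‖ ^ 2 := by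
  have h := lp.norm_rpow_eq_tsum (p := 2) (by norm_num) ξ
  simpa using h

theorem lp.hasSum_norm_sq {ι E : Type*} [NormedAddCommGroup E] (ξ : lp (fun _ : ι => E) 2) :
    HasSum (fun i => ‖ξ i‖ ^ 2) (‖ξ‖ ^ 2) := by
  have h := lp.hasSum_norm (p := 2) (by norm_num) ξ
  simpa using h

theorem memℓp_two_of_summable {ι E : Type*} [NormedAddCommGroup E] {ξ : ι → E}
    (h : Summable fun i => ‖ξ i‖ ^ 2) : Memℓp ξ 2 :=
  (memℓp_gen_iff (by norm_num)).2 (by simpa using h)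

section Amplification

variable {H K : Type*} [NormedAddCommGroup H] [InnerProductSpace ℂ H] [CompleteSpace H]
  [NormedAddCommGroup K] [InnerProductSpace ℂ K] [CompleteSpace K] {Q : Type*}

/-- A family of coisometries `T q : H → K` whose initial spaces decompose `H`
orthogonally. -/
structure IsCoisometricDecomposition (T : Q → H →L[ℂ] K) : Prop where
  hasSum_norm_sq : ∀ ξ, HasSum (fun q => ‖T q ξ‖ ^ 2) (‖ξ‖ ^ 2)
  apply_adjoint : ∀ q ζ, T q (((T q)†) ζ) = ζ

namespace IsCoisometricDecomposition

variable {T : Q → H →L[ℂ] K} (hT : IsCoisometricDecomposition T)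
include hT

theorem ext {ξ η : H} (h : ∀ q, T q ξ = T q η) : ξ = η := by
  have h1 := hT.hasSum_norm_sq (ξ - η)
  simp only [map_sub, h, sub_self, norm_zero, ne_eq, OfNat.ofNat_ne_zero, not_false_eq_true,
    zero_pow] at h1
  have h2 := h1.unique hasSum_zero
  exact sub_eq_zero.1 (norm_eq_zero.1 (pow_eq_zero_iff two_ne_zero |>.1 h2))

theorem norm_adjoint (q : Q) (ζ : K) : ‖((T q)†) ζ‖ ^ 2 = ‖ζ‖ ^ 2 := by
  have h : inner ℂ (((T q)†) ζ) (((T q)†) ζ) = inner ℂ ζ ζ := by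
    rw [ContinuousLinearMap.adjoint_inner_left, hT.apply_adjoint]
  rw [inner_self_eq_norm_sq_to_K, inner_self_eq_norm_sq_to_K] at h
  exact_mod_cast h

/-- The `q`-th slice of `(T q)† ζ` already carries its whole norm, so the other slices vanish. -/
theorem apply_adjoint_of_ne {p q : Q} (hpq : p ≠ q) (ζ : K) : T p (((T q)†) ζ) = 0 := by
  classical
  have h1 := hT.hasSum_norm_sq (((T q)†) ζ)
  have h2 := sum_le_hasSum {p, q} (fun _ _ => by positivity) h1
  rw [Finset.sum_pair hpq, hT.apply_adjoint, hT.norm_adjoint] at h2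
  have h3 : ‖T p (((T q)†) ζ)‖ ^ 2 = 0 := le_antisymm (by linarith) (by positivity)
  exact norm_eq_zero.1 (pow_eq_zero_iff two_ne_zero |>.1 h3)

/-- The isometry `ξ ↦ (T q ξ)_q`. -/
def analysis : H →ₗᵢ[ℂ] lp (fun _ : Q => K) 2 where
  toFun ξ := ⟨fun q => T q ξ, memℓp_two_of_summable (hT.hasSum_norm_sq ξ).summable⟩
  map_add' ξ η := by ext q; exact map_add (T q) ξ η
  map_smul' c ξ := by ext q; exact map_smul (T q) c ξ
  norm_map' ξ := by
    rw [← sq_eq_sq₀ (norm_nonneg _) (norm_nonneg _), lp.norm_sq_eq_tsum]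
    exact (hT.hasSum_norm_sq ξ).tsum_eq

@[simp]
theorem analysis_apply (ξ : H) (q : Q) : hT.analysis ξ q = T q ξ := rfl

/-- The adjoint of `analysis`. -/
def synthesis : lp (fun _ : Q => K) 2 →L[ℂ] H :=
  hT.analysis.toContinuousLinearMap†

theorem inner_synthesis (ξ : H) (η : lp (fun _ : Q => K) 2) :
    inner ℂ ξ (hT.synthesis η) = inner ℂ (hT.analysis ξ) η := by
  rw [synthesis, ContinuousLinearMap.adjoint_inner_right]; rfl

open scoped Classical in
theorem synthesis_single (q : Q) (ζ : K) : hT.synthesis (lp.single 2 q ζ) = ((T q)†) ζ := by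
  refine ext_inner_left ℂ fun ξ => ?_
  rw [inner_synthesis, lp.inner_single_right, ContinuousLinearMap.adjoint_inner_right]; rfl

/-- Checked on vectors supported at one index, where it is `T p (T q)† = δ_{pq}`. Hence `analysis`
is unitary. -/
theorem analysis_synthesis (η : lp (fun _ : Q => K) 2) : hT.analysis (hT.synthesis η) = η := by
  classical
  have h : hT.analysis.toContinuousLinearMap ∘L hT.synthesis = ContinuousLinearMap.id ℂ _ := by
    refine lp.ext_continuousLinearMap (by norm_num) fun q => ?_
    ext ζ p : 3
    change hT.analysis (hT.synthesis (lp.single 2 q ζ)) p = (lp.single 2 q ζ : lp (fun _ : Q => K) 2) p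
    rw [synthesis_single, analysis_apply]
    by_cases hpq : p = q
    · subst hpq; rw [hT.apply_adjoint, lp.single_apply_self]
    · rw [hT.apply_adjoint_of_ne hpq, lp.single_apply_ne _ _ _ hpq]
  exact congr($h η)

theorem synthesis_analysis (ξ : H) : hT.synthesis (hT.analysis ξ) = ξ :=
  hT.analysis.injective (hT.analysis_synthesis _)

theorem ext_clm {G : Type*} [NormedAddCommGroup G] [NormedSpace ℂ G] {A B : H →L[ℂ] G}
    (h : ∀ q ζ, A (((T q)†) ζ) = B (((T q)†) ζ)) : A = B := by
  classical
  have h1 : A ∘L hT.synthesis = B ∘L hT.synthesis := by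
    refine lp.ext_continuousLinearMap (by norm_num) fun q => ?_
    ext ζ
    change A (hT.synthesis (lp.single 2 q ζ)) = B (hT.synthesis (lp.single 2 q ζ))
    rw [synthesis_single, h]
  ext ξ
  rw [← hT.synthesis_analysis ξ]
  exact congr($h1 (hT.analysis ξ))

/-- The operator `∑ q, ((T q)†) x (T q)`. -/
def amplify (x : K →L[ℂ] K) : H →L[ℂ] H :=
  hT.synthesis ∘L lp.mapCLM 2 (fun _ : Q => x) (norm_nonneg x) (fun _ => le_rfl) ∘L
    hT.analysis.toContinuousLinearMap

@[simp]
theorem apply_amplify (x : K →L[ℂ] K) (q : Q) (ξ : H) : T q (hT.amplify x ξ) = x (T q ξ) := by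
  rw [← hT.analysis_apply, amplify]
  simp only [ContinuousLinearMap.comp_apply]
  rw [hT.analysis_synthesis]
  rfl

theorem hasSum_inner_amplify (x : K →L[ℂ] K) (ξ η : H) :
    HasSum (fun q => inner ℂ (T q ξ) (x (T q η))) (inner ℂ ξ (hT.amplify x η)) := by
  have h := lp.hasSum_inner (𝕜 := ℂ) (hT.analysis ξ) (hT.analysis (hT.amplify x η))
  rw [LinearIsometry.inner_map_map] at h
  simpa using h

theorem amplify_adjoint_apply (x : K →L[ℂ] K) (q : Q) (ζ : K) :
    hT.amplify x (((T q)†) ζ) = ((T q)†) (x ζ) := by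
  refine hT.ext fun p => ?_
  rw [hT.apply_amplify]
  by_cases hpq : p = q
  · subst hpq; rw [hT.apply_adjoint, hT.apply_adjoint]
  · rw [hT.apply_adjoint_of_ne hpq, hT.apply_adjoint_of_ne hpq, map_zero]

/-- The amplification, as a linear map. -/
def amplifyₗ : (K →L[ℂ] K) →ₗ[ℂ] (H →L[ℂ] H) where
  toFun := hT.amplify
  map_add' x y := by
    ext ξ; refine hT.ext fun q => ?_
    simp
  map_smul' c x := by
    ext ξ; refine hT.ext fun q => ?_
    simp

theorem amplify_one : hT.amplify 1 = 1 := by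
  ext ξ; refine hT.ext fun q => ?_
  simp

/-- `S` commutes with `amplify x` as soon as its matrix entries commute with `x`. -/
theorem amplify_comp_comm {x : K →L[ℂ] K} {S : H →L[ℂ] H}
    (h : ∀ p q ζ, x (T p (S (((T q)†) ζ))) = T p (S (((T q)†) (x ζ)))) :
    hT.amplify x * S = S * hT.amplify x := by
  refine hT.ext_clm fun q ζ => hT.ext fun p => ?_
  simp only [mul_apply_eq_comp, apply_amplify, amplify_adjoint_apply, h]

end IsCoisometricDecomposition

end Amplification

/-! ### Operators in the group measure space construction -/

theorem traceNorm_eq_norm {H : Type*} [NormedAddCommGroup H] [InnerProductSpace ℂ H]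
    [CompleteSpace H] (Ω : H) (x : H →L[ℂ] H) : traceNorm Ω x = ‖x Ω‖ := by
  rw [traceNorm, vectorState, mul_apply_eq_comp, ContinuousLinearMap.star_eq_adjoint,
    ContinuousLinearMap.adjoint_inner_right, inner_self_eq_norm_sq_to_K]
  norm_cast
  exact Real.sqrt_sq (norm_nonneg _)

namespace GroupMeasureSpace

section Multiplication

variable {X : Type*} [MeasurableSpace X] (μ : Measure X)

theorem coeFn_mulL2 (f : Lp ℂ ∞ μ) (ξ : Lp ℂ 2 μ) : mulL2 μ f ξ =ᵐ[μ] fun x => f x * ξ x :=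
  (ContinuousLinearMap.mul ℂ ℂ).coeFn_holder (r := 2) f ξ

theorem mulL2_comm (f g : Lp ℂ ∞ μ) (ξ : Lp ℂ 2 μ) :
    mulL2 μ f (mulL2 μ g ξ) = mulL2 μ g (mulL2 μ f ξ) := by
  refine Lp.ext ?_
  filter_upwards [coeFn_mulL2 μ f (mulL2 μ g ξ), coeFn_mulL2 μ g (mulL2 μ f ξ),
    coeFn_mulL2 μ f ξ, coeFn_mulL2 μ g ξ] with x h1 h2 h3 h4
  rw [h1, h2, h3, h4]; ring

theorem inner_mulL2_left (f : Lp ℂ ∞ μ) (ξ η : Lp ℂ 2 μ) :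
    inner ℂ (mulL2 μ f ξ) η = inner ℂ ξ (mulL2 μ (star f) η) := by
  rw [L2.inner_def, L2.inner_def]
  refine integral_congr_ae ?_
  filter_upwards [coeFn_mulL2 μ f ξ, coeFn_mulL2 μ (star f) η, Lp.coeFn_star f] with x h1 h2 h3
  rw [h1, h2, h3]
  simp only [RCLike.inner_apply, map_mul, Pi.star_apply, RCLike.star_def]
  ring

variable (Γ : Type*)

@[simp]
theorem mulOp_apply (f : Lp ℂ ∞ μ) (ξ : Space Γ μ) (s : Γ) :
    mulOp Γ μ f ξ s = mulL2 μ f (ξ s) := rfl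

theorem star_mulOp (f : Lp ℂ ∞ μ) : star (mulOp Γ μ f) = mulOp Γ μ (star f) := by
  rw [ContinuousLinearMap.star_eq_adjoint]
  refine ((ContinuousLinearMap.eq_adjoint_iff _ _).2 fun ξ η => ?_).symm
  rw [lp.inner_eq_tsum, lp.inner_eq_tsum]
  refine tsum_congr fun s => ?_
  rw [mulOp_apply, mulOp_apply, inner_mulL2_left, star_star]

theorem inner_mulOp_left (f : Lp ℂ ∞ μ) (ξ η : Space Γ μ) :
    inner ℂ (mulOp Γ μ f ξ) η = inner ℂ ξ (mulOp Γ μ (star f) η) := by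
  rw [← star_mulOp, ContinuousLinearMap.star_eq_adjoint, ContinuousLinearMap.adjoint_inner_right]

/-- `mulOp` as a linear map. -/
def mulOpₗ : Lp ℂ ∞ μ →ₗ[ℂ] (Space Γ μ →L[ℂ] Space Γ μ) where
  toFun := mulOp Γ μ
  map_add' f g := by
    ext1 ξ; ext1; funext s
    simp [mulL2]
  map_smul' c f := by
    ext1 ξ; ext1; funext s
    simp [mulL2]

theorem norm_mulOp_le (f : Lp ℂ ∞ μ) : ‖mulOp Γ μ f‖ ≤ ‖f‖ := by
  refine (lp.norm_mapCLM_le _ _ _ _).trans ?_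
  refine (((ContinuousLinearMap.mul ℂ ℂ).holderL μ ∞ 2 2).le_opNorm f).trans ?_
  have h := ((ContinuousLinearMap.mul ℂ ℂ).norm_holderL_le (μ := μ) (p := ∞) (q := 2) (r := 2))
  calc _ ≤ 1 * ‖f‖ := by
        gcongr
        exact h.trans (ContinuousLinearMap.opNorm_mul_le ℂ ℂ)
    _ = ‖f‖ := one_mul _

open scoped Classical in
theorem norm_mulL2_le_norm_mulOp [Inhabited Γ] (f : Lp ℂ ∞ μ) : ‖mulL2 μ f‖ ≤ ‖mulOp Γ μ f‖ := by
  refine ContinuousLinearMap.opNorm_le_bound _ (norm_nonneg _) fun ξ => ?_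
  have h := (mulOp Γ μ f).le_opNorm (lp.single 2 default ξ)
  rw [lp.norm_single (by norm_num)] at h
  refine le_trans ?_ h
  refine le_trans (le_of_eq ?_) (lp.norm_apply_le_norm (by norm_num) _ default)
  rw [mulOp_apply, lp.single_apply_self]

/-- If `|f| > 1` on a set `A` of positive measure, multiplication by `f` strictly increases the norm
of the indicator of `A`. This passes from the operator norm of the unit ball in property (T) to the
essential supremum needed for step functions. -/
theorem ae_norm_le_one_of_norm_mulL2_le_one [IsFiniteMeasure μ] {f : Lp ℂ ∞ μ}
    (hf : ‖mulL2 μ f‖ ≤ 1) : ∀ᵐ x ∂μ, ‖f x‖ ≤ 1 := by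
  have hfm : StronglyMeasurable f := Lp.stronglyMeasurable f
  set A : Set X := {x | 1 < ‖f x‖} with hA_def
  have hA : MeasurableSet A := measurableSet_lt measurable_const hfm.measurable.norm
  set v : Lp ℂ 2 μ := indicatorConstLp 2 hA (measure_ne_top μ A) (1 : ℂ) with hv
  have h1 : ‖mulL2 μ f v‖ₑ ≤ ‖v‖ₑ := by
    have := (mulL2 μ f).le_of_opNorm_le hf v
    rw [one_mul] at this
    exact enorm_le_iff_norm_le.2 this
  rw [Lp.enorm_def, Lp.enorm_def] at h1
  have h2 : eLpNorm (mulL2 μ f v) 2 μ = eLpNorm (A.indicator f) 2 μ := by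
    refine eLpNorm_congr_ae ?_
    filter_upwards [coeFn_mulL2 μ f v,
      indicatorConstLp_coeFn (p := 2) (hs := hA) (hμs := measure_ne_top μ A) (c := (1 : ℂ))]
      with x h3 h4
    rw [h3, hv, h4]
    by_cases hx : x ∈ A <;> simp [hx]
  have h3 : eLpNorm v 2 μ = eLpNorm (A.indicator fun _ => (1 : ℂ)) 2 μ :=
    eLpNorm_congr_ae indicatorConstLp_coeFn
  rw [h2, h3, eLpNorm_indicator_eq_eLpNorm_restrict hA, eLpNorm_indicator_eq_eLpNorm_restrict hA,
    eLpNorm_eq_lintegral_rpow_enorm_toReal (by norm_num) (by norm_num),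
    eLpNorm_eq_lintegral_rpow_enorm_toReal (by norm_num) (by norm_num),
    ENNReal.rpow_le_rpow_iff (by norm_num)] at h1
  simp only [enorm_one, ENNReal.one_rpow, lintegral_one, Measure.restrict_apply_univ] at h1
  by_contra hne
  have hpos : μ A ≠ 0 := by
    intro h0
    exact hne (by rw [ae_iff]; simpa [hA_def] using h0)
  have h4 : ∫⁻ _ in A, (1 : ℝ≥0∞) ∂μ < ∫⁻ x in A, ‖f x‖ₑ ^ (2 : ℝ≥0∞).toReal ∂μ := by
    refine setLIntegral_strict_mono hA hpos ?_ ?_ ?_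
    · exact (hfm.measurable.enorm.pow_const _)
    · simp [measure_ne_top]
    · refine Eventually.of_forall fun x hx => ?_
      refine ENNReal.one_lt_rpow ?_ (by norm_num)
      rw [← ofReal_norm]
      exact ENNReal.one_lt_ofReal.2 hx
  rw [setLIntegral_one] at h4
  exact absurd h1 (not_le.2 h4)

end Multiplication

/-! ### Right translations and the trace vector. -/

section RightTranslation

variable {Γ : Type*} [Group Γ] {X : Type*} [MeasurableSpace X] (μ : Measure X)

/-- The right translation `(ρ_t ξ)(s) = ξ(s t)`, as an isometry. -/
def rightOp (t : Γ) : Space Γ μ →ₗᵢ[ℂ] Space Γ μ where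
  toFun ξ := ⟨fun s => ξ (s * t), memℓp_two_of_summable
    ((lp.hasSum_norm_sq ξ).summable.comp_injective (mul_left_injective t))⟩
  map_add' ξ η := rfl
  map_smul' c ξ := rfl
  norm_map' ξ := by
    rw [← sq_eq_sq₀ (norm_nonneg _) (norm_nonneg _), lp.norm_sq_eq_tsum, lp.norm_sq_eq_tsum]
    exact (Equiv.mulRight t).tsum_eq (fun s => ‖ξ s‖ ^ 2)

@[simp]
theorem rightOp_apply (t : Γ) (ξ : Space Γ μ) (s : Γ) : rightOp μ t ξ s = ξ (s * t) := rfl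

theorem rightOp_rightOp_inv (t : Γ) (ξ : Space Γ μ) : rightOp μ t (rightOp μ t⁻¹ ξ) = ξ := by
  ext1; funext s; simp

theorem rightOp_inv_rightOp (t : Γ) (ξ : Space Γ μ) : rightOp μ t⁻¹ (rightOp μ t ξ) = ξ := by
  ext1; funext s; simp

variable [IsProbabilityMeasure μ]

theorem traceVector_apply_one : traceVector Γ μ (1 : Γ) = Lp.const 2 μ (1 : ℂ) := by
  classical
  rw [traceVector, lp.single_apply_self]

theorem traceVector_apply_of_ne {s : Γ} (hs : s ≠ 1) : traceVector Γ μ s = 0 := by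
  classical
  rw [traceVector, lp.single_apply_ne _ _ _ hs]

theorem norm_traceVector : ‖traceVector Γ μ‖ = 1 := by
  classical
  rw [traceVector, lp.norm_single (by norm_num), Lp.norm_const' 2 μ (1 : ℂ) (by norm_num) (by norm_num)]
  simp

theorem norm_apply_traceVector_le (x : Space Γ μ →L[ℂ] Space Γ μ) :
    ‖x (traceVector Γ μ)‖ ≤ ‖x‖ := by
  have h := x.le_opNorm (traceVector Γ μ)
  rwa [norm_traceVector, mul_one] at h

end RightTranslation

/-! ### The Koopman representation, the covariance relation and the unitaries of the group. -/

section Action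

variable {Γ : Type*} [Group Γ] {X : Type*} [MeasurableSpace X] (μ : Measure X)
  [MulAction Γ X] [MeasurableConstSMul Γ X] [SMulInvariantMeasure Γ X μ]

theorem coeFn_koopman (g : Γ) (ξ : Lp ℂ 2 μ) : koopman μ g ξ =ᵐ[μ] fun x => ξ (g⁻¹ • x) :=
  Lp.coeFn_compMeasurePreserving ξ (measurePreserving_smul g⁻¹ μ)

theorem koopman_one (ξ : Lp ℂ 2 μ) : koopman μ (1 : Γ) ξ = ξ := by
  refine Lp.ext ?_
  filter_upwards [coeFn_koopman μ (1 : Γ) ξ] with x h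
  simpa using h

theorem koopman_mul (g h : Γ) (ξ : Lp ℂ 2 μ) :
    koopman μ (g * h) ξ = koopman μ g (koopman μ h ξ) := by
  refine Lp.ext ?_
  filter_upwards [coeFn_koopman μ (g * h) ξ, coeFn_koopman μ g (koopman μ h ξ),
    (measurePreserving_smul g⁻¹ μ).quasiMeasurePreserving.ae (coeFn_koopman μ h ξ)] with x h1 h2 h3
  rw [h1, h2, h3, mul_inv_rev, mul_smul]

/-- The translate `x ↦ f (g⁻¹ x)` of `f ∈ L^∞`. -/
def translate (g : Γ) (f : Lp ℂ ∞ μ) : Lp ℂ ∞ μ :=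
  Lp.compMeasurePreserving (fun x : X => g⁻¹ • x) (measurePreserving_smul g⁻¹ μ) f

theorem coeFn_translate (g : Γ) (f : Lp ℂ ∞ μ) : translate μ g f =ᵐ[μ] fun x => f (g⁻¹ • x) :=
  Lp.coeFn_compMeasurePreserving f (measurePreserving_smul g⁻¹ μ)

theorem koopman_mulL2 (g : Γ) (f : Lp ℂ ∞ μ) (ξ : Lp ℂ 2 μ) :
    koopman μ g (mulL2 μ f ξ) = mulL2 μ (translate μ g f) (koopman μ g ξ) := by
  refine Lp.ext ?_
  filter_upwards [coeFn_koopman μ g (mulL2 μ f ξ), coeFn_koopman μ g ξ, coeFn_translate μ g f,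
    coeFn_mulL2 μ (translate μ g f) (koopman μ g ξ),
    (measurePreserving_smul g⁻¹ μ).quasiMeasurePreserving.ae (coeFn_mulL2 μ f ξ)]
    with x h1 h2 h3 h4 h5
  rw [h1, h4, h5, h2, h3]

theorem translate_one (f : Lp ℂ ∞ μ) : translate μ (1 : Γ) f = f := by
  refine Lp.ext ?_
  filter_upwards [coeFn_translate μ (1 : Γ) f] with x h
  simpa using h

theorem translate_mul (g h : Γ) (f : Lp ℂ ∞ μ) :
    translate μ (g * h) f = translate μ g (translate μ h f) := by
  refine Lp.ext ?_
  filter_upwards [coeFn_translate μ (g * h) f, coeFn_translate μ g (translate μ h f),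
    (measurePreserving_smul g⁻¹ μ).quasiMeasurePreserving.ae (coeFn_translate μ h f)]
    with x h1 h2 h3
  rw [h1, h2, h3, mul_inv_rev, mul_smul]

@[simp]
theorem groupOp_apply (g : Γ) (ξ : Space Γ μ) (s : Γ) :
    groupOp μ g ξ s = koopman μ g (ξ (g⁻¹ * s)) := rfl

theorem groupOp_one : groupOp μ (1 : Γ) = 1 := by
  ext1 ξ; ext1; funext s
  rw [groupOp_apply, koopman_one]; simp

theorem groupOp_mul (g h : Γ) : groupOp μ (g * h) = groupOp μ g * groupOp μ h := by
  ext1 ξ; ext1; funext s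
  rw [mul_apply_eq_comp, groupOp_apply, groupOp_apply, groupOp_apply, koopman_mul, mul_inv_rev,
    mul_assoc]

theorem groupOp_inv_mul (g : Γ) : groupOp μ g⁻¹ * groupOp μ g = 1 := by
  rw [← groupOp_mul, inv_mul_cancel, groupOp_one]

theorem groupOp_mul_inv (g : Γ) : groupOp μ g * groupOp μ g⁻¹ = 1 := by
  rw [← groupOp_mul, mul_inv_cancel, groupOp_one]

theorem inner_groupOp_groupOp (g : Γ) (ξ η : Space Γ μ) :
    inner ℂ (groupOp μ g ξ) (groupOp μ g η) = inner ℂ ξ η := by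
  rw [lp.inner_eq_tsum, lp.inner_eq_tsum]
  simp only [groupOp_apply, LinearIsometry.inner_map_map]
  exact (Equiv.mulLeft g⁻¹).tsum_eq (fun s => inner ℂ (ξ s) (η s))

theorem norm_groupOp_apply (g : Γ) (ξ : Space Γ μ) : ‖groupOp μ g ξ‖ = ‖ξ‖ := by
  rw [@norm_eq_sqrt_re_inner ℂ, inner_groupOp_groupOp, ← norm_eq_sqrt_re_inner]

theorem star_groupOp (g : Γ) : star (groupOp μ g) = groupOp μ g⁻¹ := by
  rw [ContinuousLinearMap.star_eq_adjoint]
  refine ((ContinuousLinearMap.eq_adjoint_iff _ _).2 fun ξ η => ?_).symm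
  rw [← inner_groupOp_groupOp μ g, ← mul_apply_eq_comp, groupOp_mul_inv]; rfl

theorem groupOp_mul_mulOp (g : Γ) (f : Lp ℂ ∞ μ) :
    groupOp μ g * mulOp Γ μ f = mulOp Γ μ (translate μ g f) * groupOp μ g := by
  ext1 ξ; ext1; funext s
  exact koopman_mulL2 μ g f (ξ (g⁻¹ * s))

theorem groupOp_apply_mulOp (g : Γ) (f : Lp ℂ ∞ μ) (ξ : Space Γ μ) :
    groupOp μ g (mulOp Γ μ f ξ) = mulOp Γ μ (translate μ g f) (groupOp μ g ξ) :=
  congr($(groupOp_mul_mulOp μ g f) ξ)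

theorem groupOp_apply_groupOp (g h : Γ) (ξ : Space Γ μ) :
    groupOp μ g (groupOp μ h ξ) = groupOp μ (g * h) ξ := by
  rw [groupOp_mul]; rfl

/-- The operator `(m'_f ξ)(s) = σ_s(f) ξ(s)`. -/
def twistedMulOp (f : Lp ℂ ∞ μ) : Space Γ μ →L[ℂ] Space Γ μ :=
  lp.mapCLM 2 (fun s : Γ => mulL2 μ (translate μ s f))
    (norm_nonneg ((ContinuousLinearMap.mul ℂ ℂ).holderL μ ∞ 2 2) |> fun h =>
      mul_nonneg h (norm_nonneg f))
    (fun s => (((ContinuousLinearMap.mul ℂ ℂ).holderL μ ∞ 2 2).le_opNorm _).trans_eq (by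
      rw [translate, Lp.norm_compMeasurePreserving]))

@[simp]
theorem twistedMulOp_apply (f : Lp ℂ ∞ μ) (ξ : Space Γ μ) (s : Γ) :
    twistedMulOp μ f ξ s = mulL2 μ (translate μ s f) (ξ s) := rfl

/-! ### The commutant -/

/-- `S` commutes with the generators of the group measure space algebra. -/
structure CommutesWithGenerators (S : Space Γ μ →L[ℂ] Space Γ μ) : Prop where
  map_mulOp : ∀ f ξ, S (mulOp Γ μ f ξ) = mulOp Γ μ f (S ξ)
  map_groupOp : ∀ g ξ, S (groupOp μ g ξ) = groupOp μ g (S ξ)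

theorem commutesWithGenerators_iff (S : Space Γ μ →L[ℂ] Space Γ μ) :
    CommutesWithGenerators μ S ↔
      S ∈ StarSubalgebra.centralizer ℂ
        (linftySet Γ μ ∪ Set.range (groupOp (Γ := Γ) μ)) := by
  rw [StarSubalgebra.mem_centralizer_iff]
  constructor
  · rintro ⟨h1, h2⟩ x (⟨f, rfl⟩ | ⟨g, rfl⟩)
    · rw [star_mulOp]
      exact ⟨by ext1 ξ; exact (h1 f ξ).symm, by ext1 ξ; exact (h1 (star f) ξ).symm⟩
    · rw [star_groupOp]
      exact ⟨by ext1 ξ; exact (h2 g ξ).symm, by ext1 ξ; exact (h2 g⁻¹ ξ).symm⟩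
  · intro h
    exact ⟨fun f ξ => congr($((h _ (Or.inl ⟨f, rfl⟩)).1) ξ).symm,
      fun g ξ => congr($((h _ (Or.inr ⟨g, rfl⟩)).1) ξ).symm⟩

theorem CommutesWithGenerators.star {S : Space Γ μ →L[ℂ] Space Γ μ}
    (hS : CommutesWithGenerators μ S) : CommutesWithGenerators μ (star S) := by
  rw [commutesWithGenerators_iff] at hS ⊢
  exact star_mem hS

theorem mem_algebra_iff (x : Space Γ μ →L[ℂ] Space Γ μ) :
    x ∈ (algebra Γ μ).toStarSubalgebra ↔
      ∀ S, CommutesWithGenerators μ S → ∀ ξ, x (S ξ) = S (x ξ) := by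
  change x ∈ StarSubalgebra.centralizer ℂ (StarSubalgebra.centralizer ℂ
    (linftySet Γ μ ∪ Set.range (groupOp (Γ := Γ) μ)) :
      Set (Space Γ μ →L[ℂ] Space Γ μ)) ↔ _
  rw [StarSubalgebra.mem_centralizer_iff]
  constructor
  · intro h S hS ξ
    exact congr($((h S ((commutesWithGenerators_iff μ S).1 hS)).1) ξ).symm
  · intro h S hS
    have hS' := (commutesWithGenerators_iff μ S).2 hS
    exact ⟨by ext1 ξ; exact (h S hS' ξ).symm, by ext1 ξ; exact (h _ hS'.star ξ).symm⟩

theorem mulOp_mem_algebra (f : Lp ℂ ∞ μ) : mulOp Γ μ f ∈ (algebra Γ μ).toStarSubalgebra :=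
  (mem_algebra_iff μ _).2 fun _ hS ξ => (hS.map_mulOp f ξ).symm

theorem groupOp_mem_algebra (g : Γ) : groupOp μ g ∈ (algebra Γ μ).toStarSubalgebra :=
  (mem_algebra_iff μ _).2 fun _ hS ξ => (hS.map_groupOp g ξ).symm

/-- Right translations and twisted multiplications are the commutant elements standing for right
multiplication by `u_g` and `f`: by `groupOp_traceVector` and `twistedMulOp_traceVector` they give
the same vectors on `Ω`. This lets `x u_g Ω` be computed from `x Ω`. -/
theorem commutesWithGenerators_rightOp (t : Γ) :
    CommutesWithGenerators μ (rightOp μ t).toContinuousLinearMap where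
  map_mulOp f ξ := rfl
  map_groupOp g ξ := by
    ext1; funext s
    change koopman μ g (ξ (g⁻¹ * (s * t))) = koopman μ g (ξ (g⁻¹ * s * t))
    rw [mul_assoc]

/-- `L^∞(X)` is commutative, and `σ_g` carries the twist at `g⁻¹ s` to the twist at `s`. -/
theorem commutesWithGenerators_twistedMulOp (f : Lp ℂ ∞ μ) :
    CommutesWithGenerators μ (twistedMulOp (Γ := Γ) μ f) where
  map_mulOp h ξ := by
    ext1; funext s
    exact mulL2_comm _ _ _ _
  map_groupOp g ξ := by
    ext1; funext s
    rw [twistedMulOp_apply, groupOp_apply, groupOp_apply, twistedMulOp_apply, koopman_mulL2,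
      ← translate_mul, mul_inv_cancel_left]

variable {μ} in
theorem apply_rightOp (x : (algebra Γ μ).toStarSubalgebra) (t : Γ) (ξ : Space Γ μ) :
    (x : Space Γ μ →L[ℂ] Space Γ μ) (rightOp μ t ξ) =
      rightOp μ t ((x : Space Γ μ →L[ℂ] Space Γ μ) ξ) :=
  (mem_algebra_iff μ _).1 x.2 _ (commutesWithGenerators_rightOp μ t) ξ

variable {μ} in
theorem apply_twistedMulOp (x : (algebra Γ μ).toStarSubalgebra) (f : Lp ℂ ∞ μ) (ξ : Space Γ μ) :
    (x : Space Γ μ →L[ℂ] Space Γ μ) (twistedMulOp μ f ξ) =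
      twistedMulOp μ f ((x : Space Γ μ →L[ℂ] Space Γ μ) ξ) :=
  (mem_algebra_iff μ _).1 x.2 _ (commutesWithGenerators_twistedMulOp μ f) ξ

/-! ### The trace vector -/

variable [IsProbabilityMeasure μ]

theorem koopman_const (g : Γ) (c : ℂ) : koopman μ g (Lp.const 2 μ c) = Lp.const 2 μ c := by
  refine Lp.ext ?_
  filter_upwards [coeFn_koopman μ g (Lp.const 2 μ c), Lp.coeFn_const (p := 2) (μ := μ) c,
    (measurePreserving_smul g⁻¹ μ).quasiMeasurePreserving.ae
      (Lp.coeFn_const (p := 2) (μ := μ) c)] with x h1 h2 h3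
  rw [h1, h2, h3]; rfl

theorem groupOp_traceVector (g : Γ) :
    groupOp μ g (traceVector Γ μ) = rightOp μ g⁻¹ (traceVector Γ μ) := by
  ext1; funext s
  rw [groupOp_apply, rightOp_apply]
  by_cases hs : s = g
  · subst hs
    rw [inv_mul_cancel, mul_inv_cancel, traceVector_apply_one, koopman_const]
  · rw [traceVector_apply_of_ne, traceVector_apply_of_ne, map_zero]
    · rwa [ne_eq, mul_inv_eq_one]
    · rw [ne_eq, inv_mul_eq_one]; exact fun h => hs h.symm

theorem twistedMulOp_traceVector (f : Lp ℂ ∞ μ) :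
    twistedMulOp μ f (traceVector Γ μ) = mulOp Γ μ f (traceVector Γ μ) := by
  ext1; funext s
  rw [twistedMulOp_apply, mulOp_apply]
  by_cases hs : s = 1
  · subst hs; rw [translate_one]
  · rw [traceVector_apply_of_ne μ hs, map_zero, map_zero]

end Action

end GroupMeasureSpace

/-! ### Subgroups: conditional expectation and induction of operators -/

namespace GroupMeasureSpace

open scoped InnerProduct

section Subgroup

variable {Γ : Type*} [Group Γ] (Λ : Subgroup Γ) {X : Type*} [MeasurableSpace X] (μ : Measure X)

/-- The restriction `ℓ²(Γ, L²(X)) → ℓ²(Λ, L²(X))`. -/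
def restrict : Space Γ μ →L[ℂ] Space Λ μ :=
  LinearMap.mkContinuous
    { toFun := fun ξ => ⟨fun l => ξ l, memℓp_two_of_summable
        ((lp.hasSum_norm_sq ξ).summable.comp_injective Subtype.val_injective)⟩
      map_add' := fun _ _ => rfl
      map_smul' := fun _ _ => rfl } 1 fun ξ => by
    rw [one_mul]
    refine (pow_le_pow_iff_left₀ (norm_nonneg _) (norm_nonneg _) two_ne_zero).1 ?_
    rw [lp.norm_sq_eq_tsum, lp.norm_sq_eq_tsum]
    exact (lp.hasSum_norm_sq ξ).summable.tsum_subtype_le (fun s => ‖ξ s‖ ^ 2) (Λ : Set Γ)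
      fun _ => by positivity

@[simp]
theorem restrict_apply (ξ : Space Γ μ) (l : Λ) : restrict Λ μ ξ l = ξ (l : Γ) := rfl

theorem norm_restrict_apply_le (ξ : Space Γ μ) : ‖restrict Λ μ ξ‖ ≤ ‖ξ‖ := by
  refine ((restrict Λ μ).le_of_opNorm_le (LinearMap.mkContinuous_norm_le _ zero_le_one _) ξ).trans
    (one_mul _).le

open scoped Classical in
/-- Extension by zero of a function on `Λ` to `Γ`. -/
def extendFun (ζ : Space Λ μ) (s : Γ) : Lp ℂ 2 μ := if h : s ∈ Λ then ζ ⟨s, h⟩ else 0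

theorem extendFun_coe (ζ : Space Λ μ) (l : Λ) : extendFun Λ μ ζ l = ζ l := by
  rw [extendFun, dif_pos l.2]

theorem extendFun_of_notMem (ζ : Space Λ μ) {s : Γ} (hs : s ∉ Λ) : extendFun Λ μ ζ s = 0 := by
  rw [extendFun, dif_neg hs]

theorem hasSum_norm_sq_extendFun (ζ : Space Λ μ) :
    HasSum (fun s => ‖extendFun Λ μ ζ s‖ ^ 2) (‖ζ‖ ^ 2) := by
  refine (Function.Injective.hasSum_iff Subtype.val_injective (g := ((↑) : Λ → Γ)) ?_).1 ?_
  · intro s hs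
    rw [Subtype.range_coe_subtype] at hs
    rw [extendFun_of_notMem Λ μ ζ hs]; simp
  · have h := lp.hasSum_norm_sq ζ
    simpa [Function.comp_def, extendFun_coe] using h

/-- Extension by zero `ℓ²(Λ, L²(X)) → ℓ²(Γ, L²(X))`. -/
def extend : Space Λ μ →ₗᵢ[ℂ] Space Γ μ where
  toFun ζ := ⟨extendFun Λ μ ζ, memℓp_two_of_summable (hasSum_norm_sq_extendFun Λ μ ζ).summable⟩
  map_add' ζ η := by
    ext1; funext s
    change extendFun Λ μ (ζ + η) s = extendFun Λ μ ζ s + extendFun Λ μ η s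
    by_cases hs : s ∈ Λ
    · simp [extendFun, hs]
    · simp [extendFun, hs]
  map_smul' c ζ := by
    ext1; funext s
    change extendFun Λ μ (c • ζ) s = c • extendFun Λ μ ζ s
    by_cases hs : s ∈ Λ
    · simp [extendFun, hs]
    · simp [extendFun, hs]
  norm_map' ζ := by
    rw [← sq_eq_sq₀ (norm_nonneg _) (norm_nonneg _), lp.norm_sq_eq_tsum]
    exact (hasSum_norm_sq_extendFun Λ μ ζ).tsum_eq

@[simp]
theorem extend_coe (ζ : Space Λ μ) (l : Λ) : extend Λ μ ζ (l : Γ) = ζ l := extendFun_coe Λ μ ζ l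

theorem extend_of_notMem (ζ : Space Λ μ) {s : Γ} (hs : s ∉ Λ) : extend Λ μ ζ s = 0 :=
  extendFun_of_notMem Λ μ ζ hs

@[simp]
theorem restrict_extend (ζ : Space Λ μ) : restrict Λ μ (extend Λ μ ζ) = ζ := by
  ext1; funext l; simp

theorem inner_extend_left (ζ : Space Λ μ) (ξ : Space Γ μ) :
    inner ℂ (extend Λ μ ζ) ξ = inner ℂ ζ (restrict Λ μ ξ) := by
  refine (lp.hasSum_inner (𝕜 := ℂ) (extend Λ μ ζ) ξ).unique ?_
  refine (Function.Injective.hasSum_iff Subtype.val_injective (g := ((↑) : Λ → Γ)) ?_).1 ?_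
  · intro s hs
    rw [Subtype.range_coe_subtype] at hs
    rw [extend_of_notMem Λ μ ζ hs, inner_zero_left]
  · have h := lp.hasSum_inner (𝕜 := ℂ) ζ (restrict Λ μ ξ)
    simpa [Function.comp_def] using h

theorem adjoint_restrict : (restrict Λ μ)† = (extend Λ μ).toContinuousLinearMap :=
  ((ContinuousLinearMap.eq_adjoint_iff _ _).2 fun ζ ξ => inner_extend_left Λ μ ζ ξ).symm

theorem extend_mulOp (f : Lp ℂ ∞ μ) (ζ : Space Λ μ) :
    extend Λ μ (mulOp Λ μ f ζ) = mulOp Γ μ f (extend Λ μ ζ) := by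
  ext1; funext s
  by_cases hs : s ∈ Λ
  · lift s to Λ using hs
    simp
  · rw [mulOp_apply, extend_of_notMem Λ μ _ hs, extend_of_notMem Λ μ _ hs, map_zero]

theorem restrict_mulOp (f : Lp ℂ ∞ μ) (ξ : Space Γ μ) :
    restrict Λ μ (mulOp Γ μ f ξ) = mulOp Λ μ f (restrict Λ μ ξ) := rfl

theorem extend_traceVector [IsProbabilityMeasure μ] :
    extend Λ μ (traceVector Λ μ) = traceVector Γ μ := by
  ext1; funext s
  by_cases hs : s ∈ Λ
  · lift s to Λ using hs
    rw [extend_coe]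
    by_cases h1 : s = 1
    · subst h1
      rw [traceVector_apply_one, Subgroup.coe_one, traceVector_apply_one]
    · rw [traceVector_apply_of_ne μ h1, traceVector_apply_of_ne μ]
      simpa using h1
  · rw [extend_of_notMem Λ μ _ hs, traceVector_apply_of_ne]
    rintro rfl
    exact hs Λ.one_mem

theorem extend_mulOp_traceVector [IsProbabilityMeasure μ] (f : Lp ℂ ∞ μ) :
    extend Λ μ (mulOp Λ μ f (traceVector Λ μ)) = mulOp Γ μ f (traceVector Γ μ) := by
  rw [extend_mulOp, extend_traceVector]

/-- A section of `Γ → Γ ⧸ Λ` that takes the trivial coset to `1`. -/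
def cosetSection (q : Γ ⧸ Λ) : Γ :=
  letI := Classical.dec (q = ((1 : Γ) : Γ ⧸ Λ))
  if q = ((1 : Γ) : Γ ⧸ Λ) then 1 else q.out

@[simp]
theorem cosetSection_one : cosetSection Λ ((1 : Γ) : Γ ⧸ Λ) = 1 := by simp [cosetSection]

@[simp]
theorem mk_cosetSection (q : Γ ⧸ Λ) : ((cosetSection Λ q : Γ) : Γ ⧸ Λ) = q := by
  rw [cosetSection]
  split_ifs with h
  · exact h.symm
  · exact Quotient.out_eq' q

theorem inv_cosetSection_mul_mem (s : Γ) : (cosetSection Λ (s : Γ ⧸ Λ))⁻¹ * s ∈ Λ := by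
  rw [← QuotientGroup.eq, mk_cosetSection]

/-- The bijection `(q, l) ↦ r(q) l` of `(Γ ⧸ Λ) × Λ` with `Γ`. -/
def leftCosetEquiv : (Γ ⧸ Λ) × Λ ≃ Γ where
  toFun p := cosetSection Λ p.1 * p.2
  invFun s := (s, ⟨(cosetSection Λ s)⁻¹ * s, inv_cosetSection_mul_mem Λ s⟩)
  left_inv p := by
    have h : ((cosetSection Λ p.1 * p.2 : Γ) : Γ ⧸ Λ) = p.1 := by
      rw [QuotientGroup.mk_mul_of_mem _ p.2.2, mk_cosetSection]
    ext1
    · exact h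
    · ext1
      simp [h]
  right_inv s := by simp

/-- The bijection `(q, l) ↦ l r(q)⁻¹` of `(Γ ⧸ Λ) × Λ` with `Γ`. -/
def rightCosetEquiv : (Γ ⧸ Λ) × Λ ≃ Γ :=
  ((Equiv.refl _).prodCongr (Equiv.inv Λ)).trans ((leftCosetEquiv Λ).trans (Equiv.inv Γ))

theorem rightCosetEquiv_apply (q : Γ ⧸ Λ) (l : Λ) :
    rightCosetEquiv Λ (q, l) = l * (cosetSection Λ q)⁻¹ := by
  simp [rightCosetEquiv, leftCosetEquiv]

variable {Λ μ} in
theorem hasSum_norm_sq_of_equiv {Q : Type*} (e : Q × Λ ≃ Γ) {T : Q → Space Γ μ →L[ℂ] Space Λ μ}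
    (hT : ∀ q ξ l, ‖T q ξ l‖ = ‖ξ (e (q, l))‖) (ξ : Space Γ μ) :
    HasSum (fun q => ‖T q ξ‖ ^ 2) (‖ξ‖ ^ 2) := by
  have h : HasSum (fun p => ‖ξ (e p)‖ ^ 2) (‖ξ‖ ^ 2) :=
    (e.hasSum_iff (f := fun s => ‖ξ s‖ ^ 2)).2 (lp.hasSum_norm_sq ξ)
  refine h.prod_fiberwise fun q => ?_
  have h2 := lp.hasSum_norm_sq (T q ξ)
  simpa only [hT] using h2

/-- The coisometry `ξ ↦ (l ↦ ξ(l r(q)⁻¹))`. -/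
def rightSlice (q : Γ ⧸ Λ) : Space Γ μ →L[ℂ] Space Λ μ :=
  restrict Λ μ ∘L (rightOp μ (cosetSection Λ q)⁻¹).toContinuousLinearMap

theorem rightSlice_apply (q : Γ ⧸ Λ) (ξ : Space Γ μ) :
    rightSlice Λ μ q ξ = restrict Λ μ (rightOp μ (cosetSection Λ q)⁻¹ ξ) := rfl

theorem adjoint_rightOp (t : Γ) : (rightOp μ t).toContinuousLinearMap† =
    (rightOp μ t⁻¹).toContinuousLinearMap := by
  refine ((ContinuousLinearMap.eq_adjoint_iff _ _).2 fun ξ η => ?_).symm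
  change inner ℂ (rightOp μ t⁻¹ ξ) η = inner ℂ ξ (rightOp μ t η)
  rw [← (rightOp μ t).inner_map_map, rightOp_rightOp_inv]

theorem adjoint_rightSlice_apply (q : Γ ⧸ Λ) (ζ : Space Λ μ) :
    ((rightSlice Λ μ q)†) ζ = rightOp μ (cosetSection Λ q) (extend Λ μ ζ) := by
  rw [rightSlice, ContinuousLinearMap.adjoint_comp, adjoint_rightOp, inv_inv, adjoint_restrict]
  rfl

theorem isCoisometricDecomposition_rightSlice : IsCoisometricDecomposition (rightSlice Λ μ) where
  hasSum_norm_sq := hasSum_norm_sq_of_equiv (rightCosetEquiv Λ) fun q ξ l => by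
    rw [rightCosetEquiv_apply]; rfl
  apply_adjoint q ζ := by
    rw [adjoint_rightSlice_apply, rightSlice_apply, rightOp_inv_rightOp, restrict_extend]

variable [MulAction Γ X] [MeasurableConstSMul Γ X] [SMulInvariantMeasure Γ X μ]

theorem restrict_groupOp (l : Λ) (ξ : Space Γ μ) :
    restrict Λ μ (groupOp μ (l : Γ) ξ) = groupOp μ l (restrict Λ μ ξ) := rfl

theorem extend_groupOp (l : Λ) (ζ : Space Λ μ) :
    extend Λ μ (groupOp μ l ζ) = groupOp μ (l : Γ) (extend Λ μ ζ) := by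
  ext1; funext s
  rw [groupOp_apply]
  by_cases hs : s ∈ Λ
  · lift s to Λ using hs
    have h : extend Λ μ ζ ((l : Γ)⁻¹ * s) = ζ (l⁻¹ * s) := extend_coe Λ μ ζ (l⁻¹ * s)
    rw [extend_coe, h]; rfl
  · rw [extend_of_notMem Λ μ _ hs, extend_of_notMem, map_zero]
    rwa [Subgroup.mul_mem_cancel_left]
    exact Λ.inv_mem l.2

theorem restrict_groupOp_extend_of_notMem {g : Γ} (hg : g ∉ Λ) (ζ : Space Λ μ) :
    restrict Λ μ (groupOp μ g (extend Λ μ ζ)) = 0 := by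
  ext1; funext l
  rw [restrict_apply, groupOp_apply, extend_of_notMem, map_zero]; · rfl
  rwa [Subgroup.mul_mem_cancel_right _ l.2, Subgroup.inv_mem_iff]

/-- The coisometry `ξ ↦ (u_{r(q)}⁻¹ ξ)|_Λ`. -/
def leftSlice (q : Γ ⧸ Λ) : Space Γ μ →L[ℂ] Space Λ μ :=
  restrict Λ μ ∘L groupOp μ (cosetSection Λ q)⁻¹

theorem leftSlice_apply (q : Γ ⧸ Λ) (ξ : Space Γ μ) :
    leftSlice Λ μ q ξ = restrict Λ μ (groupOp μ (cosetSection Λ q)⁻¹ ξ) := rfl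

theorem adjoint_leftSlice_apply (q : Γ ⧸ Λ) (ζ : Space Λ μ) :
    ((leftSlice Λ μ q)†) ζ = groupOp μ (cosetSection Λ q) (extend Λ μ ζ) := by
  rw [leftSlice, ContinuousLinearMap.adjoint_comp, adjoint_restrict,
    ← ContinuousLinearMap.star_eq_adjoint, star_groupOp, inv_inv]
  rfl

theorem groupOp_inv_groupOp (g : Γ) (ξ : Space Γ μ) : groupOp μ g⁻¹ (groupOp μ g ξ) = ξ := by
  rw [← mul_apply_eq_comp, groupOp_inv_mul]; rfl

theorem isCoisometricDecomposition_leftSlice : IsCoisometricDecomposition (leftSlice Λ μ) where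
  hasSum_norm_sq := hasSum_norm_sq_of_equiv (leftCosetEquiv Λ) fun q ξ l => by
    rw [leftSlice_apply, restrict_apply, groupOp_apply, LinearIsometry.norm_map, inv_inv]; rfl
  apply_adjoint q ζ := by
    rw [adjoint_leftSlice_apply, leftSlice_apply, groupOp_inv_groupOp, restrict_extend]

variable {Λ μ} in
-- The compression of `u_g` to `ℓ²(Λ, L²(X))` is `u_g` if `g ∈ Λ` and `0` otherwise.
theorem CommutesWithGenerators.restrict_groupOp_extend {S : Space Λ μ →L[ℂ] Space Λ μ}
    (hS : CommutesWithGenerators μ S) (g : Γ) (ζ : Space Λ μ) :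
    S (restrict Λ μ (groupOp μ g (extend Λ μ ζ))) =
      restrict Λ μ (groupOp μ g (extend Λ μ (S ζ))) := by
  by_cases hg : g ∈ Λ
  · lift g to Λ using hg
    rw [restrict_groupOp, restrict_groupOp, restrict_extend,
      restrict_extend, hS.map_groupOp]
  · rw [restrict_groupOp_extend_of_notMem Λ μ hg, restrict_groupOp_extend_of_notMem Λ μ hg,
      map_zero]

variable {Λ μ} in
-- In the left coset decomposition the matrix entries of `u_g` and `f` are compressions of group
-- unitaries, multiplied by translates of `f` in the second case. `S` commutes with each of them, so
-- commutant elements for `Λ` extend to commutant elements for `Γ`.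
theorem CommutesWithGenerators.amplify {S : Space Λ μ →L[ℂ] Space Λ μ}
    (hS : CommutesWithGenerators μ S) :
    CommutesWithGenerators μ ((isCoisometricDecomposition_leftSlice Λ μ).amplify S) where
  map_mulOp f ξ := by
    refine congr($((isCoisometricDecomposition_leftSlice Λ μ).amplify_comp_comm
      (x := S) (S := mulOp Γ μ f) fun p q ζ => ?_) ξ)
    simp only [adjoint_leftSlice_apply, leftSlice_apply]
    simp only [groupOp_apply_mulOp, restrict_mulOp, hS.map_mulOp, groupOp_apply_groupOp,
      hS.restrict_groupOp_extend]
  map_groupOp g ξ := by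
    refine congr($((isCoisometricDecomposition_leftSlice Λ μ).amplify_comp_comm
      (x := S) (S := groupOp μ g) fun p q ζ => ?_) ξ)
    simp only [adjoint_leftSlice_apply, leftSlice_apply]
    simp only [groupOp_apply_groupOp]
    exact hS.restrict_groupOp_extend _ ζ

/-- By the double commutant description: `x` commutes with the amplification of each `S` in the
commutant for `Λ`, and the block of that amplification at the trivial coset is `S`. -/
theorem compress_mem_algebra {x : Space Γ μ →L[ℂ] Space Γ μ}
    (hx : x ∈ (algebra Γ μ).toStarSubalgebra) :
    restrict Λ μ ∘L x ∘L (extend Λ μ).toContinuousLinearMap ∈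
      (algebra Λ μ).toStarSubalgebra := by
  refine (mem_algebra_iff μ _).2 fun S hS ζ => ?_
  have hD := isCoisometricDecomposition_leftSlice Λ μ
  have h1 : ∀ ξ, leftSlice Λ μ ((1 : Γ) : Γ ⧸ Λ) ξ = restrict Λ μ ξ := fun ξ => by
    rw [leftSlice_apply, cosetSection_one, inv_one, groupOp_one]; rfl
  have h2 : ∀ ζ, ((leftSlice Λ μ ((1 : Γ) : Γ ⧸ Λ))†) ζ = extend Λ μ ζ := fun ζ => by
    rw [adjoint_leftSlice_apply, cosetSection_one, groupOp_one]; rfl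
  have h3 := hD.amplify_adjoint_apply S ((1 : Γ) : Γ ⧸ Λ) ζ
  rw [h2, h2] at h3
  have h4 := hD.apply_amplify S ((1 : Γ) : Γ ⧸ Λ) (x (extend Λ μ ζ))
  rw [h1, h1] at h4
  change restrict Λ μ (x (extend Λ μ (S ζ))) = S (restrict Λ μ (x (extend Λ μ ζ)))
  rw [← h3, ← h4, (mem_algebra_iff μ x).1 hx _ hS.amplify]

/-- The conditional expectation of `L^∞(X) ⋊ Γ` onto `L^∞(X) ⋊ Λ`. -/
def condExp : (algebra Γ μ).toStarSubalgebra →ₗ[ℂ] (algebra Λ μ).toStarSubalgebra where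
  toFun x := ⟨_, compress_mem_algebra Λ μ x.2⟩
  map_add' x y := by
    ext1; ext1 ζ
    simp
  map_smul' c x := by
    ext1; ext1 ζ
    simp

variable {Λ μ} in
theorem condExp_apply (x : (algebra Γ μ).toStarSubalgebra) (ζ : Space Λ μ) :
    (condExp Λ μ x : Space Λ μ →L[ℂ] Space Λ μ) ζ =
      restrict Λ μ ((x : Space Γ μ →L[ℂ] Space Γ μ) (extend Λ μ ζ)) := rfl

/-- Dual to `compress_mem_algebra`. The right slices are built from right translations, which
commute with the generators; so every matrix entry of a commutant element for `Γ` lies in the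
commutant for `Λ`, where it commutes with `x`. -/
theorem amplify_mem_algebra {x : Space Λ μ →L[ℂ] Space Λ μ}
    (hx : x ∈ (algebra Λ μ).toStarSubalgebra) :
    (isCoisometricDecomposition_rightSlice Λ μ).amplify x ∈ (algebra Γ μ).toStarSubalgebra := by
  refine (mem_algebra_iff μ _).2 fun S hS ξ => ?_
  refine congr($((isCoisometricDecomposition_rightSlice Λ μ).amplify_comp_comm
      (x := x) (S := S) fun p q ζ => ?_) ξ)
  have hS' : CommutesWithGenerators μ (rightSlice Λ μ p ∘L S ∘L (rightSlice Λ μ q)†) := by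
    constructor
    · intro f ζ
      simp only [ContinuousLinearMap.comp_apply, adjoint_rightSlice_apply, rightSlice_apply,
        extend_mulOp]
      have h1 := (commutesWithGenerators_rightOp μ (cosetSection Λ q)).map_mulOp f (extend Λ μ ζ)
      have h2 := (commutesWithGenerators_rightOp μ (cosetSection Λ p)⁻¹).map_mulOp f
        (S (rightOp μ (cosetSection Λ q) (extend Λ μ ζ)))
      simp only [LinearIsometry.coe_toContinuousLinearMap] at h1 h2
      rw [h1, hS.map_mulOp, h2, restrict_mulOp]
    · intro g ζ
      simp only [ContinuousLinearMap.comp_apply, adjoint_rightSlice_apply, rightSlice_apply,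
        extend_groupOp]
      have h1 := (commutesWithGenerators_rightOp μ (cosetSection Λ q)).map_groupOp g (extend Λ μ ζ)
      have h2 := (commutesWithGenerators_rightOp μ (cosetSection Λ p)⁻¹).map_groupOp g
        (S (rightOp μ (cosetSection Λ q) (extend Λ μ ζ)))
      simp only [LinearIsometry.coe_toContinuousLinearMap] at h1 h2
      rw [h1, hS.map_groupOp, h2, restrict_groupOp]
  exact (mem_algebra_iff μ x).1 hx _ hS' ζ

/-- The embedding of `L^∞(X) ⋊ Λ` into `L^∞(X) ⋊ Γ`. -/
def induce : (algebra Λ μ).toStarSubalgebra →ₗ[ℂ] (algebra Γ μ).toStarSubalgebra where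
  toFun x := ⟨_, amplify_mem_algebra Λ μ x.2⟩
  map_add' x y := by
    ext1
    exact map_add (isCoisometricDecomposition_rightSlice Λ μ).amplifyₗ
      (x : Space Λ μ →L[ℂ] Space Λ μ) y
  map_smul' c x := by
    ext1
    exact map_smul (isCoisometricDecomposition_rightSlice Λ μ).amplifyₗ c
      (x : Space Λ μ →L[ℂ] Space Λ μ)

variable {Λ μ}

theorem rightSlice_induce (x : (algebra Λ μ).toStarSubalgebra) (q : Γ ⧸ Λ) (ξ : Space Γ μ) :
    rightSlice Λ μ q ((induce Λ μ x : Space Γ μ →L[ℂ] Space Γ μ) ξ) =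
      (x : Space Λ μ →L[ℂ] Space Λ μ) (rightSlice Λ μ q ξ) :=
  (isCoisometricDecomposition_rightSlice Λ μ).apply_amplify _ _ _

theorem hasSum_inner_induce (x : (algebra Λ μ).toStarSubalgebra) (ξ η : Space Γ μ) :
    HasSum (fun q => inner ℂ (rightSlice Λ μ q ξ)
      ((x : Space Λ μ →L[ℂ] Space Λ μ) (rightSlice Λ μ q η)))
      (inner ℂ ξ ((induce Λ μ x : Space Γ μ →L[ℂ] Space Γ μ) η)) :=
  (isCoisometricDecomposition_rightSlice Λ μ).hasSum_inner_amplify _ _ _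

/-- This is the slice at the trivial coset, whose representative is chosen to be `1`. -/
theorem induce_extend (x : (algebra Λ μ).toStarSubalgebra) (ζ : Space Λ μ) :
    (induce Λ μ x : Space Γ μ →L[ℂ] Space Γ μ) (extend Λ μ ζ) =
      extend Λ μ ((x : Space Λ μ →L[ℂ] Space Λ μ) ζ) := by
  have h2 : ∀ ζ, ((rightSlice Λ μ ((1 : Γ) : Γ ⧸ Λ))†) ζ = extend Λ μ ζ := fun ζ => by
    rw [adjoint_rightSlice_apply, cosetSection_one]
    ext1; funext s; simp
  have h3 := (isCoisometricDecomposition_rightSlice Λ μ).amplify_adjoint_apply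
    (x : Space Λ μ →L[ℂ] Space Λ μ) ((1 : Γ) : Γ ⧸ Λ) ζ
  rw [h2, h2] at h3
  exact h3

theorem induce_traceVector [IsProbabilityMeasure μ] (x : (algebra Λ μ).toStarSubalgebra) :
    (induce Λ μ x : Space Γ μ →L[ℂ] Space Γ μ) (traceVector Γ μ) =
      extend Λ μ ((x : Space Λ μ →L[ℂ] Space Λ μ) (traceVector Λ μ)) := by
  rw [← extend_traceVector Λ μ, induce_extend]

theorem induce_one : induce Λ μ (1 : (algebra Λ μ).toStarSubalgebra) = 1 := by
  ext1
  exact (isCoisometricDecomposition_rightSlice Λ μ).amplify_one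

theorem condExp_one : condExp Λ μ (1 : (algebra Γ μ).toStarSubalgebra) = 1 := by
  ext1; ext1 ζ
  rw [condExp_apply]
  exact restrict_extend Λ μ ζ

variable (Γ μ) in
/-- The element `f` of `L^∞(X) ⋊ Γ`. -/
def mulElt (f : Lp ℂ ∞ μ) : (algebra Γ μ).toStarSubalgebra := ⟨mulOp Γ μ f, mulOp_mem_algebra μ f⟩

variable (μ) in
/-- The element `u_g` of `L^∞(X) ⋊ Γ`. -/
def groupElt (g : Γ) : (algebra Γ μ).toStarSubalgebra := ⟨groupOp μ g, groupOp_mem_algebra μ g⟩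

@[simp]
theorem coe_mulElt (f : Lp ℂ ∞ μ) : (mulElt Γ μ f : Space Γ μ →L[ℂ] Space Γ μ) = mulOp Γ μ f := rfl

theorem induce_mulElt (f : Lp ℂ ∞ μ) : induce Λ μ (mulElt Λ μ f) = mulElt Γ μ f := by
  ext1; ext1 ξ
  refine (isCoisometricDecomposition_rightSlice Λ μ).ext fun q => ?_
  rw [rightSlice_induce]
  rfl

theorem condExp_mulElt (f : Lp ℂ ∞ μ) : condExp Λ μ (mulElt Γ μ f) = mulElt Λ μ f := by
  ext1; ext1 ζ
  rw [condExp_apply, coe_mulElt, restrict_mulOp, restrict_extend]; rfl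

attribute [irreducible] condExp induce

end Subgroup

end GroupMeasureSpace

/-! ### Completely positive maps -/

theorem exists_nonneg_eq_iff {z : ℂ} : (∃ r : ℝ, 0 ≤ r ∧ z = (r : ℂ)) ↔ 0 ≤ z.re ∧ z.im = 0 := by
  constructor
  · rintro ⟨r, hr, rfl⟩
    simpa using hr
  · rintro ⟨h1, h2⟩
    exact ⟨z.re, h1, Complex.ext (by simp) (by simpa using h2)⟩

section CompletelyPositive

variable {H : Type*} [NormedAddCommGroup H] [InnerProductSpace ℂ H] [CompleteSpace H]
  {K : Type*} [NormedAddCommGroup K] [InnerProductSpace ℂ K] [CompleteSpace K]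
  {L : Type*} [NormedAddCommGroup L] [InnerProductSpace ℂ L] [CompleteSpace L]
  {M : VonNeumannAlgebra H} {N : VonNeumannAlgebra K} {P : VonNeumannAlgebra L}

/-- A matrix of operators indexed by a finite type is positive. -/
def IsPositiveKernel {ι : Type*} [Fintype ι] (x : ι → ι → H →L[ℂ] H) : Prop :=
  ∀ ξ : ι → H, ∃ r : ℝ, 0 ≤ r ∧ ∑ i, ∑ j, inner ℂ (ξ i) (x i j (ξ j)) = (r : ℂ)

omit [CompleteSpace H] in
theorem IsPositiveKernel.reindex {ι κ : Type*} [Fintype ι] [Fintype κ] (e : κ ≃ ι)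
    {x : ι → ι → H →L[ℂ] H} (hx : IsPositiveKernel x) :
    IsPositiveKernel fun i j => x (e i) (e j) := by
  intro ξ
  obtain ⟨r, hr, h⟩ := hx (ξ ∘ e.symm)
  refine ⟨r, hr, ?_⟩
  rw [← h, ← e.sum_comp]
  refine Finset.sum_congr rfl fun i _ => ?_
  rw [← e.sum_comp]
  simp

/-- Complete positivity of a map between two von Neumann algebras. -/
def IsCompletelyPositiveMap (φ : M.toStarSubalgebra →ₗ[ℂ] N.toStarSubalgebra) : Prop :=
  ∀ (n : ℕ) (x : Fin n → Fin n → M.toStarSubalgebra),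
    IsPositiveKernel (fun i j => (x i j : H →L[ℂ] H)) →
      IsPositiveKernel (fun i j => (φ (x i j) : K →L[ℂ] K))

theorem IsCompletelyPositiveMap.map_kernel {φ : M.toStarSubalgebra →ₗ[ℂ] N.toStarSubalgebra}
    (hφ : IsCompletelyPositiveMap φ) {ι : Type*} [Fintype ι] {x : ι → ι → M.toStarSubalgebra}
    (hx : IsPositiveKernel fun i j => (x i j : H →L[ℂ] H)) :
    IsPositiveKernel fun i j => (φ (x i j) : K →L[ℂ] K) := by
  have e := (Fintype.equivFin ι)
  have h := (hφ _ (fun i j => x (e.symm i) (e.symm j)) (hx.reindex e.symm)).reindex e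
  simpa using h

theorem IsCompletelyPositiveMap.comp {ψ : N.toStarSubalgebra →ₗ[ℂ] P.toStarSubalgebra}
    {φ : M.toStarSubalgebra →ₗ[ℂ] N.toStarSubalgebra} (hψ : IsCompletelyPositiveMap ψ)
    (hφ : IsCompletelyPositiveMap φ) : IsCompletelyPositiveMap (ψ ∘ₗ φ) :=
  fun n x hx => hψ n _ (hφ n x hx)

/-- Normality of a map between two von Neumann algebras: weak operator continuity on bounded
sets. -/
def IsNormalMap (φ : M.toStarSubalgebra →ₗ[ℂ] N.toStarSubalgebra) : Prop :=
  ∀ (l : Filter M.toStarSubalgebra) (x : M.toStarSubalgebra) (C : ℝ),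
    (∀ᶠ y : M.toStarSubalgebra in l, ‖(y : H →L[ℂ] H)‖ ≤ C) →
    (∀ ξ η : H, Tendsto (fun y : M.toStarSubalgebra => inner ℂ η ((y : H →L[ℂ] H) ξ)) l
      (𝓝 (inner ℂ η ((x : H →L[ℂ] H) ξ)))) →
    ∀ ξ η : K, Tendsto (fun y : M.toStarSubalgebra => inner ℂ η ((φ y : K →L[ℂ] K) ξ)) l
      (𝓝 (inner ℂ η ((φ x : K →L[ℂ] K) ξ)))

/-- Normality is tested on bounded sets only, hence the norm bound on `φ`, which keeps the
pushed-forward filter bounded. -/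
theorem IsNormalMap.comp {ψ : N.toStarSubalgebra →ₗ[ℂ] P.toStarSubalgebra}
    {φ : M.toStarSubalgebra →ₗ[ℂ] N.toStarSubalgebra} (hψ : IsNormalMap ψ)
    (hφ : IsNormalMap φ) (hb : ∀ y, ‖(φ y : K →L[ℂ] K)‖ ≤ ‖(y : H →L[ℂ] H)‖) :
    IsNormalMap (ψ ∘ₗ φ) := by
  intro l x C hC hx ξ η
  exact tendsto_map'_iff.1 (hψ (l.map φ) (φ x) C
    (eventually_map.2 (hC.mono fun y hy => (hb y).trans hy))
    (fun ξ η => tendsto_map'_iff.2 (hφ l x C hC hx ξ η)) ξ η)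

/-! ### Matrix compressions of a completely positive map. -/

section Compression

variable {C : Type*} [Fintype C] (a b : C → M.toStarSubalgebra)
  (θ : M.toStarSubalgebra →ₗ[ℂ] M.toStarSubalgebra)

/-- The map `x ↦ ∑ c d, b_c θ(a_c* x a_d) b_d*`. -/
def matrixCompression : M.toStarSubalgebra →ₗ[ℂ] M.toStarSubalgebra where
  toFun x := ∑ c, ∑ d, b c * θ (star (a c) * x * a d) * star (b d)
  map_add' x y := by
    simp only [mul_add, add_mul, map_add, Finset.sum_add_distrib]
  map_smul' r x := by
    simp only [mul_smul_comm, smul_mul_assoc, map_smul, Finset.smul_sum, RingHom.id_apply]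

theorem matrixCompression_apply (x : M.toStarSubalgebra) :
    matrixCompression a b θ x = ∑ c, ∑ d, b c * θ (star (a c) * x * a d) * star (b d) := rfl

theorem inner_star_mul_mul (a x b : M.toStarSubalgebra) (ξ η : H) :
    inner ℂ ξ (((star a * x * b : M.toStarSubalgebra) : H →L[ℂ] H) η) =
      inner ℂ ((a : H →L[ℂ] H) ξ) ((x : H →L[ℂ] H) ((b : H →L[ℂ] H) η)) := by
  change inner ℂ ξ (star (a : H →L[ℂ] H) ((x : H →L[ℂ] H) ((b : H →L[ℂ] H) η))) = _
  rw [ContinuousLinearMap.star_eq_adjoint, ContinuousLinearMap.adjoint_inner_right]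

theorem inner_matrixCompression (x : M.toStarSubalgebra) (ξ η : H) :
    inner ℂ ξ ((matrixCompression a b θ x : H →L[ℂ] H) η) =
      ∑ c, ∑ d, inner ℂ ((star (b c) : M.toStarSubalgebra).1 ξ)
        ((θ (star (a c) * x * a d) : H →L[ℂ] H) ((star (b d) : M.toStarSubalgebra).1 η)) := by
  rw [matrixCompression_apply]
  simp only [AddSubmonoidClass.coe_finsetSum, sum_apply, inner_sum]
  refine Finset.sum_congr rfl fun c _ => Finset.sum_congr rfl fun d _ => ?_
  rw [← inner_star_mul_mul, star_star]

/-- Enlarge the index set by `C`: the matrix `(a_c* x_{ij} a_d)` is a congruence of `x`, hence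
positive. Apply `θ` to it, then test on the vectors `b_c* ξ_i`. -/
theorem IsCompletelyPositiveMap.matrixCompression {θ} (hθ : IsCompletelyPositiveMap θ) :
    IsCompletelyPositiveMap (matrixCompression a b θ) := by
  intro n x hx ξ
  have h1 : IsPositiveKernel fun (i j : Fin n × C) =>
      ((star (a i.2) * x i.1 j.1 * a j.2 : M.toStarSubalgebra) : H →L[ℂ] H) := by
    intro ζ
    obtain ⟨r, hr, h⟩ := hx fun i => ∑ c, (a c : H →L[ℂ] H) (ζ (i, c))
    refine ⟨r, hr, ?_⟩
    rw [← h, Fintype.sum_prod_type]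
    refine Finset.sum_congr rfl fun i _ => ?_
    simp only [Fintype.sum_prod_type]
    rw [Finset.sum_comm]
    refine Finset.sum_congr rfl fun j _ => ?_
    simp only [inner_star_mul_mul, map_sum, inner_sum, sum_inner]
    rw [Finset.sum_comm]
  obtain ⟨r, hr, h⟩ := hθ.map_kernel h1 fun i => (star (b i.2) : M.toStarSubalgebra).1 (ξ i.1)
  refine ⟨r, hr, ?_⟩
  rw [← h, Fintype.sum_prod_type]
  refine Finset.sum_congr rfl fun i _ => ?_
  simp only [Fintype.sum_prod_type]
  rw [Finset.sum_comm]
  refine Finset.sum_congr rfl fun j _ => ?_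
  rw [inner_matrixCompression]

theorem IsNormalMap.matrixCompression {θ} (hθ : IsNormalMap θ) :
    IsNormalMap (matrixCompression a b θ) := by
  intro l x C hC hx ξ η
  simp only [inner_matrixCompression]
  refine tendsto_finsetSum _ fun c _ => tendsto_finsetSum _ fun d _ => ?_
  refine tendsto_map'_iff.1 (hθ (l.map fun y => star (a c) * y * a d) _
    (‖(a c : H →L[ℂ] H)‖ * C * ‖(a d : H →L[ℂ] H)‖) (eventually_map.2 ?_) (fun ξ η => ?_) _ _)
  · filter_upwards [hC] with y hy
    change ‖star (a c : H →L[ℂ] H) * (y : H →L[ℂ] H) * (a d : H →L[ℂ] H)‖ ≤ _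
    refine (norm_mul_le _ _).trans ?_
    gcongr
    refine (norm_mul_le _ _).trans ?_
    rw [norm_star]
    gcongr
  · refine tendsto_map'_iff.2 ?_
    simp only [Function.comp_def, inner_star_mul_mul]
    exact hx _ _

end Compression

/-! ### Kadison–Schwarz and contractivity in operator norm and in `‖·‖₂`. -/

section Contractive

variable {φ : M.toStarSubalgebra →ₗ[ℂ] M.toStarSubalgebra}

omit [CompleteSpace H] in
theorem IsPositiveKernel.of_nonneg {x : H →L[ℂ] H}
    (hx : ∀ ζ, 0 ≤ (inner ℂ ζ (x ζ)).re ∧ (inner ℂ ζ (x ζ)).im = 0) :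
    IsPositiveKernel fun (_ _ : Unit) => x := fun ξ => by
  rw [exists_nonneg_eq_iff]
  simpa using hx (ξ ())

theorem IsCompletelyPositiveMap.inner_nonneg {φ : M.toStarSubalgebra →ₗ[ℂ] N.toStarSubalgebra}
    (hφ : IsCompletelyPositiveMap φ)
    {x : M.toStarSubalgebra} (hx : ∀ ζ, 0 ≤ (inner ℂ ζ ((x : H →L[ℂ] H) ζ)).re ∧
      (inner ℂ ζ ((x : H →L[ℂ] H) ζ)).im = 0) (ζ : K) :
    0 ≤ (inner ℂ ζ ((φ x : K →L[ℂ] K) ζ)).re ∧ (inner ℂ ζ ((φ x : K →L[ℂ] K) ζ)).im = 0 := by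
  have h := hφ.map_kernel (x := fun _ _ : Unit => x) (.of_nonneg hx) fun _ => ζ
  rw [exists_nonneg_eq_iff] at h
  simpa using h

theorem inner_star_mul_self (y : M.toStarSubalgebra) (ξ η : H) :
    inner ℂ ξ (((star y * y : M.toStarSubalgebra) : H →L[ℂ] H) η) =
      inner ℂ ((y : H →L[ℂ] H) ξ) ((y : H →L[ℂ] H) η) := by
  have h := inner_star_mul_mul y 1 y ξ η
  rwa [mul_one] at h

omit [CompleteSpace H] in
theorem inner_self_re_im (ξ : H) : (inner ℂ ξ ξ).re = ‖ξ‖ ^ 2 ∧ (inner ℂ ξ ξ).im = 0 := by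
  rw [inner_self_eq_norm_sq_to_K]
  norm_cast

omit [CompleteSpace H] in
theorem re_inner_le_of_le_one {x : H →L[ℂ] H} (hx : x ≤ 1) (ζ : H) :
    (inner ℂ ζ (x ζ)).re ≤ ‖ζ‖ ^ 2 := by
  have h := (ContinuousLinearMap.le_def _ _ |>.1 hx).re_inner_nonneg_right ζ
  rw [sub_apply, inner_sub_right, map_sub] at h
  have h2 := (inner_self_re_im ζ).1
  simp only [RCLike.re_to_complex, one_apply_eq_self] at h
  linarith

/-- The Kadison–Schwarz inequality. -/
theorem IsCompletelyPositiveMap.norm_apply_sq_le (hφ : IsCompletelyPositiveMap φ)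
    (h1 : (φ 1 : H →L[ℂ] H) ≤ 1) (y : M.toStarSubalgebra) (ζ : H) :
    ‖(φ y : H →L[ℂ] H) ζ‖ ^ 2 ≤ (inner ℂ ζ ((φ (star y * y) : H →L[ℂ] H) ζ)).re := by
  -- The matrix is `r* r` for the row `r = (1, y)`.
  have hpos : IsPositiveKernel fun (i j : Fin 2) =>
      ((!![1, y; star y, star y * y] i j : M.toStarSubalgebra) : H →L[ℂ] H) := by
    intro ξ
    refine ⟨‖ξ 0 + (y : H →L[ℂ] H) (ξ 1)‖ ^ 2, by positivity, ?_⟩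
    have h2 : inner ℂ (ξ 1) ((star (y : H →L[ℂ] H)) (ξ 0)) =
        inner ℂ ((y : H →L[ℂ] H) (ξ 1)) (ξ 0) := by
      rw [ContinuousLinearMap.star_eq_adjoint, ContinuousLinearMap.adjoint_inner_right]
    have h3 := inner_star_mul_self y (ξ 1) (ξ 1)
    rw [Fin.sum_univ_two, Fin.sum_univ_two, Fin.sum_univ_two]
    simp only [Matrix.of_apply, Matrix.cons_val', Matrix.cons_val_zero, Matrix.cons_val_one,
      Matrix.cons_val_fin_one]
    rw [h3]
    have h4 := inner_self_eq_norm_sq_to_K (𝕜 := ℂ) (ξ 0 + (y : H →L[ℂ] H) (ξ 1))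
    rw [inner_add_add_self] at h4
    push_cast
    rw [StarMemClass.coe_star, h2]
    rw [← add_assoc]
    exact h4
  have key := hφ.map_kernel hpos
  simp only [IsPositiveKernel, exists_nonneg_eq_iff, Fin.sum_univ_two, Matrix.of_apply,
    Matrix.cons_val', Matrix.cons_val_zero, Matrix.cons_val_one, Matrix.cons_val_fin_one] at key
  set a := (φ y : H →L[ℂ] H) ζ with ha
  have hone := re_inner_le_of_le_one h1 a
  -- The test vectors `(a, 0)` and `(0, ζ)` show that the diagonal terms are real; `(-a, ζ)` gives
  -- the inequality itself.
  have k0 := key ![a, 0]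
  have k1 := key ![0, ζ]
  have k2 := key ![-a, ζ]
  -- Since it is not assumed that `φ(y*) = φ(y)*`, the identity `Re ⟨ζ, φ(y*) a⟩ = ‖a‖²` is read off
  -- from the vanishing imaginary part at `(i a, ζ)`.
  have k3 := key ![Complex.I • a, ζ]
  simp only [Matrix.cons_val_zero, Matrix.cons_val_one, Matrix.cons_val_fin_one, map_zero,
    inner_zero_left, inner_zero_right, add_zero, zero_add, map_neg, inner_neg_left,
    inner_neg_right, map_smul, inner_smul_left, inner_smul_right, Complex.conj_I, ← ha,
    Complex.add_re, Complex.add_im, Complex.neg_re, Complex.neg_im, Complex.mul_re,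
    Complex.mul_im, Complex.I_re, Complex.I_im, neg_neg] at k0 k1 k2 k3
  have hs := inner_self_re_im a
  obtain ⟨k2r, k2i⟩ := k2
  obtain ⟨-, k3i⟩ := k3
  rw [hs.1] at k2r
  rw [hs.1, hs.2] at k3i
  rw [hs.2] at k2i
  nlinarith [k0.2, k1.2]

/-- Kadison–Schwarz, followed by positivity of `φ` on `‖y‖² - y* y` and `φ(1) ≤ 1`. -/
theorem IsCompletelyPositiveMap.norm_apply_le (hφ : IsCompletelyPositiveMap φ)
    (h1 : (φ 1 : H →L[ℂ] H) ≤ 1) (y : M.toStarSubalgebra) :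
    ‖(φ y : H →L[ℂ] H)‖ ≤ ‖(y : H →L[ℂ] H)‖ := by
  refine ContinuousLinearMap.opNorm_le_bound _ (norm_nonneg _) fun ζ => ?_
  refine (pow_le_pow_iff_left₀ (norm_nonneg _) (by positivity) two_ne_zero).1 ?_
  refine (hφ.norm_apply_sq_le h1 y ζ).trans ?_
  set c : ℝ := ‖(y : H →L[ℂ] H)‖ ^ 2 with hc
  have hpos := hφ.inner_nonneg (x := (c : ℂ) • 1 - star y * y) (fun ζ => by
    have h2 := inner_star_mul_self y ζ ζ
    have h3 : ‖(y : H →L[ℂ] H) ζ‖ ^ 2 ≤ c * ‖ζ‖ ^ 2 := by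
      rw [hc, ← mul_pow]
      gcongr
      exact (y : H →L[ℂ] H).le_opNorm ζ
    change 0 ≤ (inner ℂ ζ ((c : ℂ) • ζ - ((star y * y : M.toStarSubalgebra) : H →L[ℂ] H) ζ)).re ∧
      (inner ℂ ζ ((c : ℂ) • ζ - ((star y * y : M.toStarSubalgebra) : H →L[ℂ] H) ζ)).im = 0
    rw [inner_sub_right, h2, inner_smul_right]
    have h4 := inner_self_re_im ζ
    have h5 := inner_self_re_im ((y : H →L[ℂ] H) ζ)
    simp only [Complex.sub_re, Complex.sub_im, Complex.mul_re, Complex.mul_im, Complex.ofReal_re,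
      Complex.ofReal_im, h4, h5]
    constructor
    · linarith
    · ring) ζ
  rw [map_sub, map_smul] at hpos
  have h6 : inner ℂ ζ ((((c : ℂ) • φ 1 - φ (star y * y) : M.toStarSubalgebra) : H →L[ℂ] H) ζ) =
      (c : ℂ) * inner ℂ ζ ((φ 1 : H →L[ℂ] H) ζ) -
        inner ℂ ζ ((φ (star y * y) : H →L[ℂ] H) ζ) := by
    rw [← inner_smul_right, ← inner_sub_right]; rfl
  rw [h6, Complex.sub_re, Complex.re_ofReal_mul] at hpos
  have h7 := re_inner_le_of_le_one h1 ζ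
  have h8 : c * (inner ℂ ζ ((φ 1 : H →L[ℂ] H) ζ)).re ≤ c * ‖ζ‖ ^ 2 := by
    gcongr
  rw [mul_pow, ← hc]
  linarith [hpos.1]

omit [CompleteSpace H] in
theorem isPositive_iff_inner {x : H →L[ℂ] H} :
    x.IsPositive ↔ ∀ ζ, 0 ≤ (inner ℂ ζ (x ζ)).re ∧ (inner ℂ ζ (x ζ)).im = 0 := by
  have h1 : ∀ ζ, (inner ℂ ζ (x ζ)).re = (inner ℂ (x ζ) ζ).re := fun ζ => by
    rw [← inner_conj_symm, Complex.conj_re]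
  have h2 : ∀ ζ, (inner ℂ ζ (x ζ)).im = -(inner ℂ (x ζ) ζ).im := fun ζ => by
    rw [← inner_conj_symm, Complex.conj_im]
  rw [ContinuousLinearMap.isPositive_iff_complex]
  refine forall_congr' fun ζ => ?_
  rw [h1, h2, neg_eq_zero, and_comm]
  refine and_congr_right fun _ => ?_
  rw [Complex.ext_iff]
  simp [eq_comm]

theorem IsCompletelyPositiveMap.isPositive {φ : M.toStarSubalgebra →ₗ[ℂ] N.toStarSubalgebra}
    (hφ : IsCompletelyPositiveMap φ) {x : M.toStarSubalgebra}
    (hx : (x : H →L[ℂ] H).IsPositive) : (φ x : K →L[ℂ] K).IsPositive :=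
  isPositive_iff_inner.2 (hφ.inner_nonneg (isPositive_iff_inner.1 hx))

theorem IsCompletelyPositiveMap.le_one {φ : M.toStarSubalgebra →ₗ[ℂ] N.toStarSubalgebra}
    (hφ : IsCompletelyPositiveMap φ) (h1 : φ 1 = 1) {x : M.toStarSubalgebra}
    (hx : (x : H →L[ℂ] H) ≤ 1) : (φ x : K →L[ℂ] K) ≤ 1 := by
  rw [ContinuousLinearMap.le_def] at hx ⊢
  have h := hφ.isPositive (x := 1 - x) hx
  rw [map_sub, h1] at h
  exact h

omit [CompleteSpace H] in
-- Cauchy–Schwarz. It turns closeness into a small inner-product deficit, the reverse of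
-- `IsSubtracial.norm_sub_sq_le`.
theorem norm_sq_sub_re_inner_le {v w : H} (hv : ‖v‖ ≤ 1) :
    ‖v‖ ^ 2 - (inner ℂ v w).re ≤ ‖w - v‖ := by
  have h3 : ‖v‖ ^ 2 - (inner ℂ v w).re = (inner ℂ v (v - w)).re := by
    rw [inner_sub_right, Complex.sub_re, (inner_self_re_im v).1]
  have h4 : (inner ℂ v (v - w)).re ≤ ‖v‖ * ‖v - w‖ := re_inner_le_norm (𝕜 := ℂ) v (v - w)
  have h5 : ‖v‖ * ‖v - w‖ ≤ 1 * ‖v - w‖ := by gcongr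
  rw [h3, norm_sub_rev]
  linarith

/-- The maps against which the relative property (T) is tested. -/
structure IsSubtracial (Ω : H) (φ : M.toStarSubalgebra →ₗ[ℂ] M.toStarSubalgebra) : Prop where
  completelyPositive : IsCompletelyPositiveMap φ
  normal : IsNormalMap φ
  map_one_le : (φ 1 : H →L[ℂ] H) ≤ 1
  trace_le : ∀ x : M.toStarSubalgebra, (x : H →L[ℂ] H).IsPositive →
    (vectorState Ω (φ x)).re ≤ (vectorState Ω x).re

variable {Ω : H}

/-- Kadison–Schwarz at `Ω`, then `τ ∘ φ ≤ τ` on `y* y`. -/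
theorem IsSubtracial.norm_apply_le (hφ : IsSubtracial Ω φ) (y : M.toStarSubalgebra) :
    ‖(φ y : H →L[ℂ] H) Ω‖ ≤ ‖(y : H →L[ℂ] H) Ω‖ := by
  refine (pow_le_pow_iff_left₀ (norm_nonneg _) (by positivity) two_ne_zero).1 ?_
  refine (hφ.completelyPositive.norm_apply_sq_le hφ.map_one_le y Ω).trans ?_
  refine (hφ.trace_le (star y * y) ?_).trans ?_
  · exact ContinuousLinearMap.isPositive_adjoint_comp_self (y : H →L[ℂ] H)
  · rw [vectorState, inner_star_mul_self, (inner_self_re_im _).1]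

theorem IsSubtracial.norm_sub_sq_le (hφ : IsSubtracial Ω φ) (y : M.toStarSubalgebra) :
    ‖(φ y : H →L[ℂ] H) Ω - (y : H →L[ℂ] H) Ω‖ ^ 2 ≤
      2 * (‖(y : H →L[ℂ] H) Ω‖ ^ 2 -
        (inner ℂ ((y : H →L[ℂ] H) Ω) ((φ y : H →L[ℂ] H) Ω)).re) := by
  rw [@norm_sub_sq ℂ, ← inner_re_symm]
  have h := pow_le_pow_left₀ (norm_nonneg _) (hφ.norm_apply_le y) 2
  simp only [RCLike.re_to_complex]
  linarith

theorem hasRelativePropertyT_iff {B : Set (H →L[ℂ] H)} :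
    HasRelativePropertyT M B Ω ↔ ∀ ε : ℝ, 0 < ε →
      ∃ (F : Finset M.toStarSubalgebra) (δ : ℝ), 0 < δ ∧
        ∀ φ : M.toStarSubalgebra →ₗ[ℂ] M.toStarSubalgebra, IsSubtracial Ω φ →
          (∀ x ∈ F, ‖(φ x : H →L[ℂ] H) Ω - (x : H →L[ℂ] H) Ω‖ ≤ δ) →
          ∀ b : M.toStarSubalgebra, (b : H →L[ℂ] H) ∈ B → ‖(b : H →L[ℂ] H)‖ ≤ 1 →
            ‖(φ b : H →L[ℂ] H) Ω - (b : H →L[ℂ] H) Ω‖ ≤ ε := by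
  simp only [HasRelativePropertyT, traceNorm_eq_norm, sub_apply]
  refine forall₂_congr fun ε _ => exists₂_congr fun F δ => and_congr_right fun _ =>
    forall_congr' fun φ => ?_
  constructor
  · rintro h ⟨h1, h2, h3, h4⟩
    exact h h1 h2 h3 h4
  · intro h h1 h2 h3 h4
    exact h ⟨h1, h2, h3, h4⟩

end Contractive

end CompletelyPositive

/-! ### Conditional expectation and induction are normal and completely positive -/

namespace GroupMeasureSpace

section Transfer

variable {Γ : Type*} [Group Γ] {Λ : Subgroup Γ} {X : Type*} [MeasurableSpace X] {μ : Measure X}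
  [MulAction Γ X] [MeasurableConstSMul Γ X] [SMulInvariantMeasure Γ X μ]

theorem inner_condExp (x : (algebra Γ μ).toStarSubalgebra) (ζ η : Space Λ μ) :
    inner ℂ ζ ((condExp Λ μ x : Space Λ μ →L[ℂ] Space Λ μ) η) =
      inner ℂ (extend Λ μ ζ) ((x : Space Γ μ →L[ℂ] Space Γ μ) (extend Λ μ η)) := by
  rw [condExp_apply, inner_extend_left]

theorem isCompletelyPositiveMap_condExp : IsCompletelyPositiveMap (condExp Λ μ) := by
  intro n x hx ξ
  simp only [inner_condExp]
  exact hx fun i => extend Λ μ (ξ i)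

theorem isNormalMap_condExp : IsNormalMap (condExp Λ μ) := by
  intro l x C _ hx ξ η
  simp only [inner_condExp]
  exact hx _ _

theorem norm_condExp_le (x : (algebra Γ μ).toStarSubalgebra) :
    ‖(condExp Λ μ x : Space Λ μ →L[ℂ] Space Λ μ)‖ ≤ ‖(x : Space Γ μ →L[ℂ] Space Γ μ)‖ := by
  refine ContinuousLinearMap.opNorm_le_bound _ (norm_nonneg _) fun ζ => ?_
  rw [condExp_apply]
  refine (norm_restrict_apply_le Λ μ _).trans ?_
  refine (ContinuousLinearMap.le_opNorm _ _).trans_eq ?_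
  rw [LinearIsometry.norm_map]

/-- The quadratic form of the induced matrix is the sum over the cosets of the quadratic forms of
the original matrix at the right slices. -/
theorem isCompletelyPositiveMap_induce : IsCompletelyPositiveMap (induce Λ μ) := by
  intro n x hx ξ
  rw [exists_nonneg_eq_iff]
  have h : HasSum (fun q => ∑ i, ∑ j, inner ℂ (rightSlice Λ μ q (ξ i))
      ((x i j : Space Λ μ →L[ℂ] Space Λ μ) (rightSlice Λ μ q (ξ j))))
      (∑ i, ∑ j, inner ℂ (ξ i) ((induce Λ μ (x i j) : Space Γ μ →L[ℂ] Space Γ μ) (ξ j))) :=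
    hasSum_sum fun i _ => hasSum_sum fun j _ => hasSum_inner_induce _ _ _
  have hq := fun q => exists_nonneg_eq_iff.1 (hx fun i => rightSlice Λ μ q (ξ i))
  constructor
  · exact (Complex.hasSum_re h).nonneg fun q => (hq q).1
  · have him := Complex.hasSum_im h
    simp only [fun q => (hq q).2] at him
    exact him.unique hasSum_zero

theorem norm_induce_le (x : (algebra Λ μ).toStarSubalgebra) :
    ‖(induce Λ μ x : Space Γ μ →L[ℂ] Space Γ μ)‖ ≤ ‖(x : Space Λ μ →L[ℂ] Space Λ μ)‖ := by
  refine ContinuousLinearMap.opNorm_le_bound _ (norm_nonneg _) fun ξ => ?_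
  refine (pow_le_pow_iff_left₀ (norm_nonneg _) (by positivity) two_ne_zero).1 ?_
  have hD := isCoisometricDecomposition_rightSlice Λ μ
  rw [mul_pow]
  refine hasSum_le (fun q => ?_) (hD.hasSum_norm_sq _) ((hD.hasSum_norm_sq ξ).mul_left _)
  rw [rightSlice_induce, ← mul_pow]
  gcongr
  exact ContinuousLinearMap.le_opNorm _ _

/-- Dominated convergence over the cosets; the uniform bound on the operators provides the
domination. -/
theorem isNormalMap_induce : IsNormalMap (induce Λ μ) := by
  intro l x C hC hx ξ η
  simp only [← (hasSum_inner_induce _ _ _).tsum_eq]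
  have hD := isCoisometricDecomposition_rightSlice Λ μ
  refine tendsto_tsum_of_dominated_convergence
    (bound := fun q => |C| * (‖rightSlice Λ μ q η‖ ^ 2 + ‖rightSlice Λ μ q ξ‖ ^ 2))
    (((hD.hasSum_norm_sq η).summable.add (hD.hasSum_norm_sq ξ).summable).mul_left _)
    (fun q => hx _ _) ?_
  filter_upwards [hC] with y hy q
  refine (norm_inner_le_norm _ _).trans ?_
  have h := (y : Space Λ μ →L[ℂ] Space Λ μ).le_of_opNorm_le (hy.trans (le_abs_self C))
    (rightSlice Λ μ q ξ)
  calc _ ≤ ‖rightSlice Λ μ q η‖ * (|C| * ‖rightSlice Λ μ q ξ‖) := by gcongr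
    _ = |C| * (‖rightSlice Λ μ q η‖ * ‖rightSlice Λ μ q ξ‖) := by ring
    _ ≤ _ := by
      gcongr
      nlinarith [sq_nonneg (‖rightSlice Λ μ q η‖ - ‖rightSlice Λ μ q ξ‖),
        norm_nonneg (rightSlice Λ μ q η), norm_nonneg (rightSlice Λ μ q ξ)]

theorem norm_mulOp_subgroup_le (f : Lp ℂ ∞ μ) : ‖mulOp Λ μ f‖ ≤ ‖mulOp Γ μ f‖ := by
  have h := norm_condExp_le (Λ := Λ) (mulElt Γ μ f)
  rwa [condExp_mulElt] at h

theorem condExp_comp_induce_apply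
    (φ : (algebra Γ μ).toStarSubalgebra →ₗ[ℂ] (algebra Γ μ).toStarSubalgebra)
    (x : (algebra Λ μ).toStarSubalgebra) (ζ : Space Λ μ) :
    ((condExp Λ μ ∘ₗ φ ∘ₗ induce Λ μ) x : Space Λ μ →L[ℂ] Space Λ μ) ζ =
      restrict Λ μ ((φ (induce Λ μ x) : Space Γ μ →L[ℂ] Space Γ μ) (extend Λ μ ζ)) :=
  condExp_apply _ _

section Trace

variable [IsProbabilityMeasure μ]

theorem vectorState_condExp (x : (algebra Γ μ).toStarSubalgebra) :
    vectorState (traceVector Λ μ) (condExp Λ μ x : Space Λ μ →L[ℂ] Space Λ μ) =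
      vectorState (traceVector Γ μ) (x : Space Γ μ →L[ℂ] Space Γ μ) := by
  rw [vectorState, inner_condExp, extend_traceVector, vectorState]

theorem vectorState_induce (x : (algebra Λ μ).toStarSubalgebra) :
    vectorState (traceVector Γ μ) (induce Λ μ x : Space Γ μ →L[ℂ] Space Γ μ) =
      vectorState (traceVector Λ μ) (x : Space Λ μ →L[ℂ] Space Λ μ) := by
  rw [vectorState, induce_traceVector, ← extend_traceVector Λ μ, LinearIsometry.inner_map_map,
    vectorState]

/-- `E` and `ι` are normal, completely positive, unital and trace preserving. -/
theorem isSubtracial_condExp_comp_induce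
    {φ : (algebra Γ μ).toStarSubalgebra →ₗ[ℂ] (algebra Γ μ).toStarSubalgebra}
    (hφ : IsSubtracial (traceVector Γ μ) φ) :
    IsSubtracial (traceVector Λ μ) (condExp Λ μ ∘ₗ φ ∘ₗ induce Λ μ) where
  completelyPositive := isCompletelyPositiveMap_condExp.comp
    (hφ.completelyPositive.comp isCompletelyPositiveMap_induce)
  normal := isNormalMap_condExp.comp (hφ.normal.comp isNormalMap_induce norm_induce_le)
    fun y => (hφ.completelyPositive.norm_apply_le hφ.map_one_le _).trans (norm_induce_le y)
  map_one_le := isCompletelyPositiveMap_condExp.le_one condExp_one (by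
    rw [LinearMap.comp_apply, induce_one]
    exact hφ.map_one_le)
  trace_le x hx := by
    rw [LinearMap.comp_apply, LinearMap.comp_apply, vectorState_condExp, ← vectorState_induce]
    exact hφ.trace_le _ (isCompletelyPositiveMap_induce.isPositive hx)

theorem norm_condExp_comp_induce_sub_le
    (φ : (algebra Γ μ).toStarSubalgebra →ₗ[ℂ] (algebra Γ μ).toStarSubalgebra)
    (x : (algebra Λ μ).toStarSubalgebra) :
    ‖((condExp Λ μ ∘ₗ φ ∘ₗ induce Λ μ) x : Space Λ μ →L[ℂ] Space Λ μ) (traceVector Λ μ) -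
      (x : Space Λ μ →L[ℂ] Space Λ μ) (traceVector Λ μ)‖ ≤
    ‖(φ (induce Λ μ x) : Space Γ μ →L[ℂ] Space Γ μ) (traceVector Γ μ) -
      (induce Λ μ x : Space Γ μ →L[ℂ] Space Γ μ) (traceVector Γ μ)‖ := by
  refine le_trans (le_of_eq (congrArg norm ?_)) (norm_restrict_apply_le Λ μ _)
  rw [map_sub]
  refine congrArg₂ _ ?_ ?_
  · rw [condExp_comp_induce_apply, extend_traceVector]
  · rw [induce_traceVector, restrict_extend]

theorem inner_condExp_comp_induce_mulElt
    (φ : (algebra Γ μ).toStarSubalgebra →ₗ[ℂ] (algebra Γ μ).toStarSubalgebra) (f : Lp ℂ ∞ μ) :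
    inner ℂ (mulOp Λ μ f (traceVector Λ μ))
      (((condExp Λ μ ∘ₗ φ ∘ₗ induce Λ μ) (mulElt Λ μ f) : Space Λ μ →L[ℂ] Space Λ μ)
        (traceVector Λ μ)) =
    inner ℂ (mulOp Γ μ f (traceVector Γ μ))
      ((φ (mulElt Γ μ f) : Space Γ μ →L[ℂ] Space Γ μ) (traceVector Γ μ)) := by
  refine (congrArg _ (condExp_comp_induce_apply φ (mulElt Λ μ f) (traceVector Λ μ))).trans ?_
  rw [← inner_extend_left, extend_mulOp_traceVector, extend_traceVector, induce_mulElt]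

/-- The deficit `‖f‖₂² - Re τ(f* φ(f))` depends only on the component of `φ(f) Ω` in `ℓ²(Λ, L²(X))`,
so it is the same for `φ` and its compression. It bounds `‖φ(f) - f‖₂²` from above and is bounded by
the distance of the compression from the identity at `f`. -/
theorem norm_apply_mulElt_sub_sq_le
    {φ : (algebra Γ μ).toStarSubalgebra →ₗ[ℂ] (algebra Γ μ).toStarSubalgebra}
    (hφ : IsSubtracial (traceVector Γ μ) φ) {f : Lp ℂ ∞ μ} (hf : ‖mulOp Λ μ f‖ ≤ 1) :
    ‖(φ (mulElt Γ μ f) : Space Γ μ →L[ℂ] Space Γ μ) (traceVector Γ μ) -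
      mulOp Γ μ f (traceVector Γ μ)‖ ^ 2 ≤
    2 * ‖((condExp Λ μ ∘ₗ φ ∘ₗ induce Λ μ) (mulElt Λ μ f) : Space Λ μ →L[ℂ] Space Λ μ)
      (traceVector Λ μ) - mulOp Λ μ f (traceVector Λ μ)‖ := by
  refine (hφ.norm_sub_sq_le (mulElt Γ μ f)).trans ?_
  refine mul_le_mul_of_nonneg_left ?_ zero_le_two
  refine le_trans (le_of_eq ?_)
    (norm_sq_sub_re_inner_le ((norm_apply_traceVector_le μ (mulOp Λ μ f)).trans hf))
  refine congrArg₂ (fun a b : ℝ => a ^ 2 - b) ?_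
    (congrArg Complex.re (inner_condExp_comp_induce_mulElt φ f).symm)
  exact (congrArg norm (extend_mulOp_traceVector Λ μ f).symm).trans (LinearIsometry.norm_map _ _)

end Trace

end Transfer

end GroupMeasureSpace

open GroupMeasureSpace in
/-- The relative property (T) passes from a subgroup to the group. -/
theorem HasPropertyTRelativeToSpace.of_subgroup {Γ : Type*} [Group Γ] (Λ : Subgroup Γ)
    {X : Type*} [MeasurableSpace X] (μ : Measure X) [IsProbabilityMeasure μ]
    [MulAction Γ X] [MeasurableConstSMul Γ X] [SMulInvariantMeasure Γ X μ]
    (h : HasPropertyTRelativeToSpace Λ μ) : HasPropertyTRelativeToSpace Γ μ := by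
  classical
  refine hasRelativePropertyT_iff.2 fun ε hε => ?_
  -- The value `ε ^ 2 / 2` matches `norm_apply_mulElt_sub_sq_le`, which bounds the squared norm by
  -- twice the norm of the compressed difference.
  obtain ⟨F, δ, hδ, hF⟩ := hasRelativePropertyT_iff.1 h (ε ^ 2 / 2) (by positivity)
  refine ⟨F.image (induce Λ μ), δ, hδ, fun φ hφ hclose b hb hb1 => ?_⟩
  obtain ⟨f, hf⟩ := hb
  obtain rfl : mulElt Γ μ f = b := Subtype.ext hf
  have hfΛ : ‖mulOp Λ μ f‖ ≤ 1 := (norm_mulOp_subgroup_le f).trans hb1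
  have key := hF _ (isSubtracial_condExp_comp_induce hφ) (fun x hx =>
    (norm_condExp_comp_induce_sub_le φ x).trans (hclose _ (Finset.mem_image_of_mem _ hx)))
    (mulElt Λ μ f) ⟨f, rfl⟩ hfΛ
  refine (pow_le_pow_iff_left₀ (norm_nonneg _) hε.le two_ne_zero).1 ?_
  refine (norm_apply_mulElt_sub_sq_le hφ hfΛ).trans ?_
  exact (mul_le_mul_of_nonneg_left key zero_le_two).trans_eq (by ring)

/-! ### Finite measurable partitions and step functions -/

namespace GroupMeasureSpace

open scoped ComplexConjugate

section StepFunctions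

variable {X : Type*} [MeasurableSpace X] (μ : Measure X) [IsProbabilityMeasure μ]
  {ι : Type*} {q : X → ι} (hq : ∀ k, MeasurableSet (q ⁻¹' {k}))

/-- The indicator function of the fiber of `q` over `k`. -/
def fiberInd (k : ι) : Lp ℂ ∞ μ := indicatorConstLp ∞ (hq k) (measure_ne_top μ _) (1 : ℂ)

open scoped Classical in
theorem coeFn_fiberInd (k : ι) : fiberInd μ hq k =ᵐ[μ] fun x => if q x = k then 1 else 0 := by
  refine (indicatorConstLp_coeFn (p := ∞) (hs := hq k) (hμs := measure_ne_top μ _)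
    (c := (1 : ℂ))).trans ?_
  refine Eventually.of_forall fun x => ?_
  simp [Set.indicator_apply]

theorem star_fiberInd (k : ι) : star (fiberInd μ hq k) = fiberInd μ hq k := by
  refine Lp.ext ?_
  filter_upwards [Lp.coeFn_star (fiberInd μ hq k), coeFn_fiberInd μ hq k] with x h1 h2
  rw [h1, Pi.star_apply, h2]
  split_ifs <;> simp

theorem mulL2_fiberInd_self (k : ι) (v : Lp ℂ 2 μ) :
    mulL2 μ (fiberInd μ hq k) (mulL2 μ (fiberInd μ hq k) v) = mulL2 μ (fiberInd μ hq k) v := by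
  refine Lp.ext ?_
  filter_upwards [coeFn_mulL2 μ (fiberInd μ hq k) (mulL2 μ (fiberInd μ hq k) v),
    coeFn_mulL2 μ (fiberInd μ hq k) v, coeFn_fiberInd μ hq k] with x h1 h2 h3
  rw [h1, h2, h3]
  split_ifs <;> simp

theorem mulL2_fiberInd_of_ne {k l : ι} (hkl : k ≠ l) (v : Lp ℂ 2 μ) :
    mulL2 μ (fiberInd μ hq k) (mulL2 μ (fiberInd μ hq l) v) = 0 := by
  refine Lp.ext ?_
  filter_upwards [coeFn_mulL2 μ (fiberInd μ hq k) (mulL2 μ (fiberInd μ hq l) v),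
    coeFn_mulL2 μ (fiberInd μ hq l) v, coeFn_fiberInd μ hq k, coeFn_fiberInd μ hq l,
    Lp.coeFn_zero ℂ 2 μ] with x h1 h2 h3 h4 h5
  rw [h1, h2, h3, h4, h5]
  by_cases h : q x = k
  · have : ¬ q x = l := fun h' => hkl (h.symm.trans h')
    simp [this]
  · simp [h]

variable [Fintype ι]

/-- The step function `∑ k, z k 1_{q = k}`. -/
def stepFun (z : ι → ℂ) : Lp ℂ ∞ μ := ∑ k, z k • fiberInd μ hq k

theorem coeFn_stepFun (z : ι → ℂ) : stepFun μ hq z =ᵐ[μ] fun x => z (q x) := by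
  classical
  have h1 : ∀ᵐ x ∂μ, ∀ k, (z k • fiberInd μ hq k : Lp ℂ ∞ μ) x = z k • fiberInd μ hq k x :=
    ae_all_iff.2 fun k => Lp.coeFn_smul _ _
  have h2 : ∀ᵐ x ∂μ, ∀ k, fiberInd μ hq k x = if q x = k then 1 else 0 :=
    ae_all_iff.2 fun k => coeFn_fiberInd μ hq k
  filter_upwards [Lp.coeFn_finsetSum Finset.univ fun k => z k • fiberInd μ hq k, h1, h2]
    with x h3 h4 h5
  rw [stepFun, h3, Finset.sum_apply]
  simp [h4, h5]

theorem norm_le_of_ae_norm_le {f : Lp ℂ ∞ μ} {C : ℝ} (hC : 0 ≤ C) (h : ∀ᵐ x ∂μ, ‖f x‖ ≤ C) :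
    ‖f‖ ≤ C := by
  have := Lp.norm_le_of_ae_bound hC h
  simpa using this

theorem norm_stepFun_le {z : ι → ℂ} (hz : ∀ k, ‖z k‖ ≤ 1) : ‖stepFun μ hq z‖ ≤ 1 := by
  refine norm_le_of_ae_norm_le μ zero_le_one ?_
  filter_upwards [coeFn_stepFun μ hq z] with x h
  rw [h]; exact hz _

theorem mulL2_stepFun_one (v : Lp ℂ 2 μ) : mulL2 μ (stepFun μ hq fun _ => 1) v = v := by
  refine Lp.ext ?_
  filter_upwards [coeFn_mulL2 μ (stepFun μ hq fun _ => 1) v, coeFn_stepFun μ hq fun _ => 1]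
    with x h1 h2
  rw [h1, h2, one_mul]

open scoped Classical in
theorem fiberInd_eq_stepFun {κ : Type*} (π : ι → κ)
    (hπ : ∀ k, MeasurableSet ((π ∘ q) ⁻¹' {k})) (k : κ) :
    fiberInd μ hπ k = stepFun μ hq fun j => if π j = k then 1 else 0 := by
  refine Lp.ext ?_
  filter_upwards [coeFn_fiberInd μ hπ k, coeFn_stepFun μ hq fun j => if π j = k then 1 else 0]
    with x h1 h2
  rw [h1, h2]; rfl

/-- Cover the closed unit disc by finitely many `η`-balls centred in the disc and round `f` to the
nearest centre; the rounded values stay in the disc. -/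
theorem exists_stepFun_norm_sub_le {f : Lp ℂ ∞ μ} (hf : ∀ᵐ x ∂μ, ‖f x‖ ≤ 1) {η : ℝ} (hη : 0 < η) :
    ∃ (ι : Type) (_ : Fintype ι) (q : X → ι) (hq : ∀ k, MeasurableSet (q ⁻¹' {k})) (z : ι → ℂ),
      (∀ k, ‖z k‖ ≤ 1) ∧ ‖f - stepFun μ hq z‖ ≤ η := by
  obtain ⟨t, htsub, htfin, htcov⟩ :=
    (isCompact_closedBall (0 : ℂ) 1).finite_cover_balls hη
  have htne : t.Nonempty := by
    by_contra hne
    rw [Set.not_nonempty_iff_eq_empty] at hne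
    have := htcov (Metric.mem_closedBall_self zero_le_one)
    simp [hne] at this
  -- `SimpleFunc.nearestPt` expects a sequence: enumerate the centres and take `N` so large that all
  -- of them occur up to index `N`.
  obtain ⟨e, he⟩ := htfin.countable.exists_eq_range htne
  choose! n hn using fun y (hy : y ∈ t) => (he ▸ hy : y ∈ Set.range e)
  obtain ⟨N, hN⟩ : ∃ N, ∀ y ∈ t, n y ≤ N := by
    obtain ⟨N, hN⟩ := (htfin.image n).bddAbove
    exact ⟨N, fun y hy => hN ⟨y, hy, rfl⟩⟩
  have hfm : Measurable f := (Lp.stronglyMeasurable f).measurable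
  set h : SimpleFunc X ℂ := (SimpleFunc.nearestPt e N).comp f hfm with hh
  have hmem : ∀ x, h x ∈ t := fun x => by
    rw [he]; exact ⟨_, rfl⟩
  have hqm : ∀ k : h.range,
      MeasurableSet ((fun x => (⟨h x, h.mem_range_self x⟩ : h.range)) ⁻¹' {k}) := fun k => by
    convert h.measurableSet_fiber k.1 using 1
    ext x
    simp [Subtype.ext_iff]
  refine ⟨h.range, inferInstance, fun x => ⟨h x, h.mem_range_self x⟩, hqm,
    Subtype.val, fun k => ?_, ?_⟩
  · obtain ⟨x, hx⟩ := SimpleFunc.mem_range.1 k.2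
    rw [← hx]
    exact mem_closedBall_zero_iff.1 (htsub (hmem x))
  · refine norm_le_of_ae_norm_le μ hη.le ?_
    filter_upwards [hf, Lp.coeFn_sub f (stepFun μ hqm Subtype.val),
      coeFn_stepFun μ hqm Subtype.val] with x h1 h2 h3
    rw [h2, Pi.sub_apply, h3]
    obtain ⟨y, hy, hxy⟩ := Set.mem_iUnion₂.1 (htcov (mem_closedBall_zero_iff.2 h1))
    have h4 := SimpleFunc.edist_nearestPt_le e (f x) (hN y hy)
    rw [hn y hy, edist_dist, edist_dist, ENNReal.ofReal_le_ofReal_iff dist_nonneg] at h4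
    rw [← dist_eq_norm, dist_comm]
    exact h4.trans (by rw [dist_comm]; exact (Metric.mem_ball.1 hxy).le)

end StepFunctions

/-! ### Two elementary inequalities -/

/-- Split off the diagonal: `∑ |z_k|² (τ_k - ν_kk) ≤ 1 - ∑ ν_kk`, and the off-diagonal terms cost at
most their total mass, which is again at most `1 - ∑ ν_kk`. -/
theorem sum_norm_sq_sub_le {ι : Type*} [Fintype ι] {ν : ι → ι → ℝ} {τ : ι → ℝ} {z : ι → ℂ}
    (hν : ∀ k l, 0 ≤ ν k l) (hντ : ∀ k, ∑ l, ν k l ≤ τ k) (hτ : ∑ k, τ k = 1)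
    (hz : ∀ k, ‖z k‖ ≤ 1) :
    ∑ k, ‖z k‖ ^ 2 * τ k - ∑ k, ∑ l, (z k * conj (z l)).re * ν k l ≤
      2 * (1 - ∑ k, ν k k) := by
  classical
  -- The left side is `‖z k‖² ν k k` on the diagonal and `-ν k l` off it.
  have h1 : ∀ k l, (if l = k then (1 + ‖z k‖ ^ 2) * ν k l else 0) - ν k l ≤
      (z k * conj (z l)).re * ν k l := by
    intro k l
    split_ifs with h
    · subst h
      rw [Complex.mul_conj, Complex.ofReal_re, Complex.normSq_eq_norm_sq]
      linarith
    · have h2 : |(z k * conj (z l)).re| ≤ 1 := by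
        refine (Complex.abs_re_le_norm _).trans ?_
        rw [norm_mul, RCLike.norm_conj]
        exact mul_le_one₀ (hz k) (norm_nonneg _) (hz l)
      nlinarith [(abs_le.1 h2).1, hν k l]
  have h2 : ∑ k, ∑ l, ((if l = k then (1 + ‖z k‖ ^ 2) * ν k l else 0) - ν k l) ≤
      ∑ k, ∑ l, (z k * conj (z l)).re * ν k l :=
    Finset.sum_le_sum fun k _ => Finset.sum_le_sum fun l _ => h1 k l
  simp only [Finset.sum_sub_distrib, Finset.sum_ite_eq', Finset.mem_univ, if_true] at h2
  have h3 : ∑ k, ∑ l, ν k l ≤ 1 := (Finset.sum_le_sum fun k _ => hντ k).trans_eq hτ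
  have h4 : ∀ k, ν k k ≤ τ k := fun k =>
    (Finset.single_le_sum (fun l _ => hν k l) (Finset.mem_univ k)).trans (hντ k)
  have h5 : ∑ k, ‖z k‖ ^ 2 * (τ k - ν k k) ≤ ∑ k, (τ k - ν k k) :=
    Finset.sum_le_sum fun k _ =>
      mul_le_of_le_one_left (sub_nonneg.2 (h4 k)) (pow_le_one₀ (norm_nonneg _) (hz k))
  simp only [mul_sub, add_mul, one_mul, Finset.sum_sub_distrib, Finset.sum_add_distrib] at h2 h5
  linarith

/-- Flipping the sign at `k` permutes the sign vectors and negates the sum. -/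
theorem sum_signs_mul {ι : Type*} [Fintype ι] [DecidableEq ι] {k l : ι} (hkl : k ≠ l) :
    ∑ s : ι → ℤˣ, (((s k : ℤˣ) : ℤ) : ℂ) * (((s l : ℤˣ) : ℤ) : ℂ) = 0 := by
  set u : ι → ℤˣ := Function.update 1 k (-1) with hu
  have h := Equiv.sum_comp (Equiv.mulLeft u)
    (fun s : ι → ℤˣ => (((s k : ℤˣ) : ℤ) : ℂ) * (((s l : ℤˣ) : ℤ) : ℂ))
  simp only [Equiv.coe_mulLeft, Pi.mul_apply, hu, Function.update_self,
    Function.update_of_ne hkl.symm, Pi.one_apply, one_mul, neg_mul, Units.val_neg, Int.cast_neg,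
    Finset.sum_neg_distrib] at h
  exact self_eq_neg.1 h.symm

theorem sum_signs {ι : Type*} [Fintype ι] [DecidableEq ι] (a : ι → ι → ℂ) :
    ∑ s : ι → ℤˣ, ∑ k, ∑ l, (((s k : ℤˣ) : ℤ) : ℂ) * conj (((s l : ℤˣ) : ℤ) : ℂ) * a k l =
      Fintype.card (ι → ℤˣ) * ∑ k, a k k := by
  rw [Finset.sum_comm, Finset.mul_sum]
  refine Finset.sum_congr rfl fun k _ => ?_
  rw [Finset.sum_comm, Finset.sum_eq_single k]
  · have h : ∀ s : ι → ℤˣ, (((s k : ℤˣ) : ℤ) : ℂ) * (((s k : ℤˣ) : ℤ) : ℂ) = 1 := fun s => by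
      rcases Int.units_eq_one_or (s k) with h | h <;> simp [h]
    simp [h]
  · intro l _ hl
    simp only [map_intCast, ← Finset.sum_mul, sum_signs_mul hl.symm, zero_mul]
  · simp

end GroupMeasureSpace

/-! ### Concentration on the diagonal -/

namespace GroupMeasureSpace

open scoped ComplexConjugate

section Pairing

variable {G : Type*} [Group G] {X : Type*} [MeasurableSpace X] {μ : Measure X}
  [MulAction G X] [MeasurableConstSMul G X] [SMulInvariantMeasure G X μ]

theorem star_translate (g : G) (f : Lp ℂ ∞ μ) : star (translate μ g f) = translate μ g (star f) := by
  refine Lp.ext ?_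
  filter_upwards [Lp.coeFn_star (translate μ g f), coeFn_translate μ g f,
    coeFn_translate μ g (star f),
    (measurePreserving_smul g⁻¹ μ).quasiMeasurePreserving.ae (Lp.coeFn_star f)] with x h1 h2 h3 h4
  rw [h1, Pi.star_apply, h2, h3, h4]; rfl

theorem inner_twistedMulOp_left (f : Lp ℂ ∞ μ) (ξ η : Space G μ) :
    inner ℂ (twistedMulOp μ f ξ) η = inner ℂ ξ (twistedMulOp μ (star f) η) := by
  rw [lp.inner_eq_tsum, lp.inner_eq_tsum]
  refine tsum_congr fun s => ?_
  rw [twistedMulOp_apply, twistedMulOp_apply, inner_mulL2_left, star_translate]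

variable (G μ) in
/-- `mulElt` as a linear map. -/
def mulEltₗ : Lp ℂ ∞ μ →ₗ[ℂ] (algebra G μ).toStarSubalgebra where
  toFun := mulElt G μ
  map_add' f g := Subtype.ext (map_add (mulOpₗ μ G) f g)
  map_smul' c f := Subtype.ext (map_smul (mulOpₗ μ G) c f)

variable [IsProbabilityMeasure μ]

/-- The form `(f, g) ↦ τ(g* T(f))` on `L^∞(X)`. -/
def pairing (T : (algebra G μ).toStarSubalgebra →ₗ[ℂ] (algebra G μ).toStarSubalgebra)
    (f g : Lp ℂ ∞ μ) : ℂ :=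
  inner ℂ (mulOp G μ g (traceVector G μ))
    ((T (mulElt G μ f) : Space G μ →L[ℂ] Space G μ) (traceVector G μ))

variable (T : (algebra G μ).toStarSubalgebra →ₗ[ℂ] (algebra G μ).toStarSubalgebra)

/-- `f ↦ T(f) Ω`. -/
def applyTraceₗ : Lp ℂ ∞ μ →ₗ[ℂ] Space G μ where
  toFun f := (T (mulElt G μ f) : Space G μ →L[ℂ] Space G μ) (traceVector G μ)
  map_add' f g := by
    have h : T (mulElt G μ (f + g)) = T (mulElt G μ f) + T (mulElt G μ g) := by
      rw [← map_add]; exact congrArg T (map_add (mulEltₗ G μ) f g)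
    rw [h]; rfl
  map_smul' c f := by
    have h : T (mulElt G μ (c • f)) = c • T (mulElt G μ f) := by
      rw [← map_smul]; exact congrArg T (map_smul (mulEltₗ G μ) c f)
    rw [h]; rfl

variable (G μ) in
/-- The identity map of the group measure space algebra. -/
def idMap : (algebra G μ).toStarSubalgebra →ₗ[ℂ] (algebra G μ).toStarSubalgebra := LinearMap.id

theorem pairing_eq (f g : Lp ℂ ∞ μ) :
    pairing T f g = inner ℂ (applyTraceₗ (idMap G μ) g) (applyTraceₗ T f) := rfl

variable {ι : Type*} [Fintype ι] {q : X → ι} (hq : ∀ k, MeasurableSet (q ⁻¹' {k}))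

theorem pairing_stepFun (z w : ι → ℂ) :
    pairing T (stepFun μ hq z) (stepFun μ hq w) =
      ∑ k, ∑ l, z k * conj (w l) * pairing T (fiberInd μ hq k) (fiberInd μ hq l) := by
  simp only [pairing_eq, stepFun, map_sum, map_smul, inner_sum, sum_inner, inner_smul_left,
    inner_smul_right, Finset.mul_sum]
  exact Finset.sum_congr rfl fun k _ => Finset.sum_congr rfl fun l _ => by ring

/-- The mass that the form of `T` gives to the union of the squares `A_k × A_k` of a partition
`(A_k)`. -/
def diagonalMass : ℝ := ∑ k, (pairing T (fiberInd μ hq k) (fiberInd μ hq k)).re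

omit [Fintype ι] in
theorem pairing_id_of_ne {k l : ι} (hkl : k ≠ l) :
    pairing (idMap G μ) (fiberInd μ hq k) (fiberInd μ hq l) = 0 := by
  rw [pairing, inner_mulOp_left μ G, star_fiberInd]
  have h : mulOp G μ (fiberInd μ hq l) (mulOp G μ (fiberInd μ hq k) (traceVector G μ)) = 0 := by
    ext1; funext s
    exact mulL2_fiberInd_of_ne μ hq hkl.symm _
  change inner ℂ _ (mulOp G μ (fiberInd μ hq l) (mulOp G μ (fiberInd μ hq k) (traceVector G μ))) = _
  rw [h, inner_zero_right]

theorem norm_sq_stepFun (z : ι → ℂ) :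
    ‖mulOp G μ (stepFun μ hq z) (traceVector G μ)‖ ^ 2 =
      ∑ k, ‖z k‖ ^ 2 * (pairing (idMap G μ) (fiberInd μ hq k) (fiberInd μ hq k)).re := by
  have h : pairing (idMap G μ) (stepFun μ hq z) (stepFun μ hq z) =
      inner ℂ (mulOp G μ (stepFun μ hq z) (traceVector G μ))
        (mulOp G μ (stepFun μ hq z) (traceVector G μ)) := rfl
  rw [← (inner_self_re_im _).1, ← h, pairing_stepFun, Complex.re_sum]
  refine Finset.sum_congr rfl fun k _ => ?_
  rw [Finset.sum_eq_single k]
  · rw [Complex.mul_conj, Complex.re_ofReal_mul, Complex.normSq_eq_norm_sq]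
  · intro l _ hl
    rw [pairing_id_of_ne hq hl.symm, mul_zero]
  · simp

omit [Group G] [MulAction G X] [MeasurableConstSMul G X] [SMulInvariantMeasure G X μ] in
theorem mulOp_stepFun_one (ξ : Space G μ) : mulOp G μ (stepFun μ hq fun _ => 1) ξ = ξ := by
  ext1; funext s
  exact mulL2_stepFun_one μ hq _

theorem sum_pairing_id :
    ∑ k, (pairing (idMap G μ) (fiberInd μ hq k) (fiberInd μ hq k)).re = 1 := by
  have h := norm_sq_stepFun (G := G) (μ := μ) hq fun _ => (1 : ℂ)
  rw [mulOp_stepFun_one, norm_traceVector] at h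
  simpa using h.symm

variable {T}

omit [Group G] [MulAction G X] [MeasurableConstSMul G X] [SMulInvariantMeasure G X μ]
  [Fintype ι] in
theorem inner_mulOp_fiberInd_nonneg (k : ι) (ζ : Space G μ) :
    0 ≤ (inner ℂ ζ (mulOp G μ (fiberInd μ hq k) ζ)).re ∧
      (inner ℂ ζ (mulOp G μ (fiberInd μ hq k) ζ)).im = 0 := by
  have h : mulOp G μ (fiberInd μ hq k) ζ =
      mulOp G μ (fiberInd μ hq k) (mulOp G μ (fiberInd μ hq k) ζ) := by
    ext1; funext s
    exact (mulL2_fiberInd_self μ hq k _).symm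
  have h2 : inner ℂ ζ (mulOp G μ (fiberInd μ hq k) ζ) =
      inner ℂ (mulOp G μ (fiberInd μ hq k) ζ) (mulOp G μ (fiberInd μ hq k) ζ) := by
    rw [inner_mulOp_left μ G, star_fiberInd, ← h]
  rw [h2, (inner_self_re_im _).1, (inner_self_re_im _).2]
  exact ⟨by positivity, rfl⟩

omit [Fintype ι] in
-- For the indicator `p` of a fiber, `p Ω = p' p' Ω` with `p'` the twisted multiplication by `p`, a
-- self-adjoint element of the commutant. So the form equals `⟨p' Ω, T(1_k) p' Ω⟩` with `T(1_k) ≥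
-- 0`.
theorem pairing_fiberInd_nonneg (hT : IsCompletelyPositiveMap T) (k l : ι) :
    0 ≤ (pairing T (fiberInd μ hq k) (fiberInd μ hq l)).re ∧
      (pairing T (fiberInd μ hq k) (fiberInd μ hq l)).im = 0 := by
  set p := fiberInd μ hq l with hp
  set y := T (mulElt G μ (fiberInd μ hq k)) with hy
  have h1 : mulOp G μ p (traceVector G μ) =
      twistedMulOp μ p (twistedMulOp μ p (traceVector G μ)) := by
    rw [twistedMulOp_traceVector, (commutesWithGenerators_twistedMulOp μ p).map_mulOp,
      twistedMulOp_traceVector]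
    ext1; funext s
    exact (mulL2_fiberInd_self μ hq l _).symm
  have h2 : pairing T (fiberInd μ hq k) p = inner ℂ (twistedMulOp μ p (traceVector G μ))
      ((y : Space G μ →L[ℂ] Space G μ) (twistedMulOp μ p (traceVector G μ))) := by
    rw [pairing, h1, inner_twistedMulOp_left, hp, star_fiberInd]
    exact congrArg _ (apply_twistedMulOp y _ _).symm
  rw [h2]
  exact hT.inner_nonneg (x := mulElt G μ (fiberInd μ hq k)) (fun ζ => inner_mulOp_fiberInd_nonneg hq k ζ) _

/-- The indicators of the fibers sum to `1`, so the left side is `τ(T(1_k))`. -/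
theorem sum_pairing_le (hT : IsSubtracial (traceVector G μ) T) (k : ι) :
    ∑ l, (pairing T (fiberInd μ hq k) (fiberInd μ hq l)).re ≤
      (pairing (idMap G μ) (fiberInd μ hq k) (fiberInd μ hq k)).re := by
  have h1 : ∑ l, pairing T (fiberInd μ hq k) (fiberInd μ hq l) =
      vectorState (traceVector G μ) (T (mulElt G μ (fiberInd μ hq k)) :
        Space G μ →L[ℂ] Space G μ) := by
    simp only [pairing_eq, ← sum_inner, ← map_sum]
    have h2 : stepFun μ hq (fun _ => 1) = ∑ l, fiberInd μ hq l := by simp [stepFun]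
    rw [← h2]
    exact congrArg (fun v => inner ℂ v (applyTraceₗ T (fiberInd μ hq k)))
      (mulOp_stepFun_one hq (traceVector G μ))
  rw [← Complex.re_sum, h1]
  refine (hT.trace_le (mulElt G μ (fiberInd μ hq k)) (isPositive_iff_inner.2 fun ζ =>
    inner_mulOp_fiberInd_nonneg hq k ζ)).trans (le_of_eq ?_)
  rw [pairing, inner_mulOp_left μ G, star_fiberInd]
  refine congrArg (fun v => (inner ℂ (traceVector G μ) v).re) ?_
  ext1; funext s
  exact (mulL2_fiberInd_self μ hq k _).symm

/-- A map with almost full mass near the diagonal is close to the identity on step functions. -/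
theorem norm_stepFun_sub_sq_le (hT : IsSubtracial (traceVector G μ) T) {z : ι → ℂ}
    (hz : ∀ k, ‖z k‖ ≤ 1) :
    ‖applyTraceₗ T (stepFun μ hq z) - applyTraceₗ (idMap G μ) (stepFun μ hq z)‖ ^ 2 ≤
      4 * (1 - diagonalMass T hq) := by
  have h1 := hT.norm_sub_sq_le (mulElt G μ (stepFun μ hq z))
  have h2 : ‖mulOp G μ (stepFun μ hq z) (traceVector G μ)‖ ^ 2 -
      (pairing T (stepFun μ hq z) (stepFun μ hq z)).re ≤ 2 * (1 - diagonalMass T hq) := by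
    rw [norm_sq_stepFun, pairing_stepFun]
    refine le_trans (le_of_eq ?_) (sum_norm_sq_sub_le
      (fun k l => (pairing_fiberInd_nonneg hq hT.completelyPositive k l).1)
      (sum_pairing_le hq hT) (sum_pairing_id hq) hz)
    simp only [Complex.re_sum, Complex.mul_re _ (pairing T _ _),
      (pairing_fiberInd_nonneg hq hT.completelyPositive _ _).2, mul_zero, sub_zero]
  refine h1.trans ?_
  refine (mul_le_mul_of_nonneg_left h2 zero_le_two).trans_eq ?_
  ring

theorem norm_applyTrace_id_le (f : Lp ℂ ∞ μ) :
    ‖applyTraceₗ (idMap G μ) f‖ ≤ ‖f‖ :=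
  (norm_apply_traceVector_le μ (mulOp G μ f)).trans (norm_mulOp_le μ G f)

theorem norm_applyTrace_le (hT : IsSubtracial (traceVector G μ) T) (f : Lp ℂ ∞ μ) :
    ‖applyTraceₗ T f‖ ≤ ‖f‖ :=
  (hT.norm_apply_le (mulElt G μ f)).trans (norm_applyTrace_id_le f)

/-- A map with almost full mass near the diagonal is close to the identity on the unit ball of
`L^∞(X)`. -/
theorem norm_applyTrace_sub_le (hT : IsSubtracial (traceVector G μ) T) {ε : ℝ} (hε : 0 ≤ ε)
    (hmass : ∀ (ι : Type) (_ : Fintype ι) (q : X → ι) (hq : ∀ k, MeasurableSet (q ⁻¹' {k})),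
      1 - ε ^ 2 / 4 ≤ diagonalMass T hq) {f : Lp ℂ ∞ μ} (hf : ‖mulOp G μ f‖ ≤ 1) :
    ‖applyTraceₗ T f - applyTraceₗ (idMap G μ) f‖ ≤ ε := by
  let _ : Inhabited G := ⟨1⟩
  have hf1 := ae_norm_le_one_of_norm_mulL2_le_one μ
    ((norm_mulL2_le_norm_mulOp μ G f).trans hf)
  refine le_of_forall_pos_le_add fun η hη => ?_
  -- Both `T` and the identity are contractive from `L^∞` to `‖·‖₂`, so the approximation error
  -- counts twice.
  obtain ⟨ι, _, q, hq, z, hz, hfz⟩ := exists_stepFun_norm_sub_le μ hf1 (half_pos hη)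
  have h1 : ‖applyTraceₗ T (stepFun μ hq z) - applyTraceₗ (idMap G μ) (stepFun μ hq z)‖ ≤ ε := by
    refine (pow_le_pow_iff_left₀ (norm_nonneg _) hε two_ne_zero).1 ?_
    have := hmass ι inferInstance q hq
    refine (norm_stepFun_sub_sq_le hq hT hz).trans ?_
    linarith
  have h2 : applyTraceₗ T f - applyTraceₗ (idMap G μ) f =
      (applyTraceₗ T (stepFun μ hq z) - applyTraceₗ (idMap G μ) (stepFun μ hq z)) +
        (applyTraceₗ T (f - stepFun μ hq z) -
          applyTraceₗ (idMap G μ) (f - stepFun μ hq z)) := by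
    rw [map_sub, map_sub]; abel
  rw [h2]
  refine (norm_add_le _ _).trans (add_le_add h1 ((norm_sub_le _ _).trans ?_))
  have h3 := (norm_applyTrace_le hT (f - stepFun μ hq z)).trans hfz
  have h4 := (norm_applyTrace_id_le (G := G) (f - stepFun μ hq z)).trans hfz
  linarith

/-- A map that is close to the identity on the unit ball of `L^∞(X)` has almost full mass near
the diagonal. -/
theorem le_diagonalMass {ε : ℝ}
    (hT : ∀ f : Lp ℂ ∞ μ, ‖mulOp G μ f‖ ≤ 1 →
      ‖applyTraceₗ T f - applyTraceₗ (idMap G μ) f‖ ≤ ε) :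
    1 - ε ≤ diagonalMass T hq := by
  classical
  -- Random signs: each step function with values `±1` has `‖·‖₂ = 1` and deficit at most `ε`, and
  -- the average over all signs kills the off-diagonal terms of the form.
  set z : (ι → ℤˣ) → ι → ℂ := fun s k => (((s k : ℤˣ) : ℤ) : ℂ) with hz_def
  have hz : ∀ s k, ‖z s k‖ = 1 := fun s k => by
    rcases Int.units_eq_one_or (s k) with h | h <;> simp [hz_def, h]
  have h1 : ∀ s, 1 - ε ≤ (pairing T (stepFun μ hq (z s)) (stepFun μ hq (z s))).re := by
    intro s
    have hn : ‖mulOp G μ (stepFun μ hq (z s)) (traceVector G μ)‖ ^ 2 = 1 := by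
      rw [norm_sq_stepFun]
      simp only [hz, one_pow, one_mul]
      exact sum_pairing_id hq
    have hn1 : ‖applyTraceₗ (idMap G μ) (stepFun μ hq (z s))‖ ≤ 1 := by
      refine (pow_le_pow_iff_left₀ (norm_nonneg _) zero_le_one two_ne_zero).1 ?_
      rw [one_pow]
      exact hn.le
    have h2 := hT (stepFun μ hq (z s))
      ((norm_mulOp_le μ G _).trans (norm_stepFun_le μ hq fun k => (hz s k).le))
    have h3 := (norm_sq_sub_re_inner_le (w := applyTraceₗ T (stepFun μ hq (z s))) hn1).trans h2
    have h4 : ‖applyTraceₗ (idMap G μ) (stepFun μ hq (z s))‖ ^ 2 = 1 := hn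
    rw [h4, ← pairing_eq] at h3
    linarith
  have h2 := sum_signs fun k l => pairing T (fiberInd μ hq k) (fiberInd μ hq l)
  have h3 : ∑ s, (pairing T (stepFun μ hq (z s)) (stepFun μ hq (z s))).re =
      ((Fintype.card (ι → ℤˣ) : ℂ) *
        ∑ k, pairing T (fiberInd μ hq k) (fiberInd μ hq k)).re := by
    rw [← h2, ← Complex.re_sum]
    exact congrArg Complex.re (Finset.sum_congr rfl fun s _ => pairing_stepFun T hq (z s) (z s))
  have h4 : ((Fintype.card (ι → ℤˣ) : ℂ) * ∑ k, pairing T (fiberInd μ hq k) (fiberInd μ hq k)).re =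
      Fintype.card (ι → ℤˣ) * diagonalMass T hq := by
    rw [← Complex.ofReal_natCast, Complex.re_ofReal_mul, Complex.re_sum]; rfl
  have h5 := Finset.card_nsmul_le_sum Finset.univ _ (1 - ε) fun s _ => h1 s
  rw [h3, h4, Finset.card_univ, nsmul_eq_mul] at h5
  exact le_of_mul_le_mul_left h5 (by exact_mod_cast Fintype.card_pos)

/-- The mass near the diagonal decreases under refinement. -/
theorem diagonalMass_le_of_refinement (hT : IsCompletelyPositiveMap T) {κ : Type*} [Fintype κ]
    (π : ι → κ) (hπ : ∀ k, MeasurableSet ((π ∘ q) ⁻¹' {k})) :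
    diagonalMass T hq ≤ diagonalMass T hπ := by
  classical
  have h1 : ∀ k, (pairing T (fiberInd μ hπ k) (fiberInd μ hπ k)).re =
      ∑ i, ∑ j, if π i = k ∧ π j = k then
        (pairing T (fiberInd μ hq i) (fiberInd μ hq j)).re else 0 := fun k => by
    rw [fiberInd_eq_stepFun μ hq π hπ k, pairing_stepFun, Complex.re_sum]
    refine Finset.sum_congr rfl fun i _ => ?_
    rw [Complex.re_sum]
    refine Finset.sum_congr rfl fun j _ => ?_
    by_cases hi : π i = k <;> by_cases hj : π j = k <;> simp [hi, hj]
  rw [diagonalMass, diagonalMass]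
  simp only [h1]
  rw [Finset.sum_comm]
  refine Finset.sum_le_sum fun i _ => ?_
  rw [Finset.sum_comm]
  -- The coarse mass counts all pairs `(i, j)` with `π i = π j`; keep only `j = i`, the other terms
  -- being nonnegative.
  refine le_trans ?_ (Finset.single_le_sum (fun j _ => Finset.sum_nonneg fun k _ => ?_)
    (Finset.mem_univ i))
  · simp
  · split_ifs
    · exact (pairing_fiberInd_nonneg hq hT _ _).1
    · exact le_rfl

end Pairing

end GroupMeasureSpace

/-! ### Inducing a completely positive map from a subgroup -/

namespace GroupMeasureSpace

section Induction

variable {Γ : Type*} [Group Γ] {Λ : Subgroup Γ} {X : Type*} [MeasurableSpace X] {μ : Measure X}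
  [MulAction Γ X] [MeasurableConstSMul Γ X] [SMulInvariantMeasure Γ X μ]

theorem inv_cosetSection_mul_notMem {c d : Γ ⧸ Λ} (hcd : c ≠ d) :
    (cosetSection Λ c)⁻¹ * cosetSection Λ d ∉ Λ := by
  rw [← QuotientGroup.eq, mk_cosetSection, mk_cosetSection]
  exact hcd

theorem star_groupElt (g : Γ) : star (groupElt μ g) = groupElt μ g⁻¹ :=
  Subtype.ext (star_groupOp μ g)

/-- The coefficient `E(u_c* x u_d)` of `x`. -/
def coeff (x : (algebra Γ μ).toStarSubalgebra) (c d : Γ ⧸ Λ) : (algebra Λ μ).toStarSubalgebra :=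
  condExp Λ μ (star (groupElt μ (cosetSection Λ c)) * x * groupElt μ (cosetSection Λ d))

theorem coeff_apply (x : (algebra Γ μ).toStarSubalgebra) (c d : Γ ⧸ Λ) (ζ : Space Λ μ) :
    (coeff x c d : Space Λ μ →L[ℂ] Space Λ μ) ζ = restrict Λ μ (groupOp μ (cosetSection Λ c)⁻¹
      ((x : Space Γ μ →L[ℂ] Space Γ μ) (groupOp μ (cosetSection Λ d) (extend Λ μ ζ)))) := by
  rw [coeff, condExp_apply, star_groupElt]
  rfl

theorem inner_coeff_self (x : (algebra Γ μ).toStarSubalgebra) (c : Γ ⧸ Λ) (ζ η : Space Λ μ) :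
    inner ℂ ζ ((coeff x c c : Space Λ μ →L[ℂ] Space Λ μ) η) =
      inner ℂ (groupOp μ (cosetSection Λ c) (extend Λ μ ζ))
        ((x : Space Γ μ →L[ℂ] Space Γ μ) (groupOp μ (cosetSection Λ c) (extend Λ μ η))) := by
  rw [coeff, inner_condExp, inner_star_mul_mul]
  rfl

theorem coeff_one_of_ne {c d : Γ ⧸ Λ} (hcd : c ≠ d) :
    coeff (1 : (algebra Γ μ).toStarSubalgebra) c d = 0 := by
  ext1; ext1 ζ
  rw [coeff_apply]
  change restrict Λ μ (groupOp μ _ (groupOp μ _ (extend Λ μ ζ))) = 0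
  rw [groupOp_apply_groupOp,
    restrict_groupOp_extend_of_notMem Λ μ (inv_cosetSection_mul_notMem hcd)]

theorem coeff_one_self (c : Γ ⧸ Λ) : coeff (1 : (algebra Γ μ).toStarSubalgebra) c c = 1 := by
  ext1; ext1 ζ
  rw [coeff_apply]
  change restrict Λ μ (groupOp μ _ (groupOp μ _ (extend Λ μ ζ))) = ζ
  rw [groupOp_apply_groupOp, inv_mul_cancel, groupOp_one]
  exact restrict_extend Λ μ ζ

/-- `u_c* f u_d` is a function times a group unitary outside `Λ`, which `E` annihilates. -/
theorem coeff_mulElt_of_ne (f : Lp ℂ ∞ μ) {c d : Γ ⧸ Λ} (hcd : c ≠ d) :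
    coeff (mulElt Γ μ f) c d = 0 := by
  ext1; ext1 ζ
  rw [coeff_apply, coe_mulElt, groupOp_apply_mulOp, groupOp_apply_groupOp, restrict_mulOp,
    restrict_groupOp_extend_of_notMem Λ μ (inv_cosetSection_mul_notMem hcd), map_zero]
  rfl

theorem coeff_mulElt_self (f : Lp ℂ ∞ μ) (c : Γ ⧸ Λ) :
    coeff (mulElt Γ μ f) c c = mulElt Λ μ (translate μ (cosetSection Λ c)⁻¹ f) := by
  ext1; ext1 ζ
  rw [coeff_apply, coe_mulElt, groupOp_apply_mulOp, groupOp_apply_groupOp, restrict_mulOp,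
    inv_mul_cancel, groupOp_one]
  exact congrArg _ (restrict_extend Λ μ ζ)

variable (S : Finset (Γ ⧸ Λ)) (w : Γ ⧸ Λ → ℝ)
  (φ : (algebra Λ μ).toStarSubalgebra →ₗ[ℂ] (algebra Λ μ).toStarSubalgebra)

/-- The map `x ↦ ∑ c d, w_c w_d u_c φ(E(u_c* x u_d)) u_d*`, summed over `c, d ∈ S`. -/
def inducedMap : (algebra Γ μ).toStarSubalgebra →ₗ[ℂ] (algebra Γ μ).toStarSubalgebra :=
  matrixCompression (fun c : S => groupElt μ (cosetSection Λ c))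
    (fun c : S => (w c : ℂ) • groupElt μ (cosetSection Λ c)) (induce Λ μ ∘ₗ φ ∘ₗ condExp Λ μ)

theorem star_smul_groupElt_apply (r : ℝ) (g : Γ) (ξ : Space Γ μ) :
    ((star ((r : ℂ) • groupElt μ g) : (algebra Γ μ).toStarSubalgebra) :
      Space Γ μ →L[ℂ] Space Γ μ) ξ = (r : ℂ) • groupOp μ g⁻¹ ξ := by
  rw [star_smul, star_groupElt, RCLike.star_def, Complex.conj_ofReal]
  rfl

theorem inner_inducedMap (x : (algebra Γ μ).toStarSubalgebra) (ξ η : Space Γ μ) :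
    inner ℂ ξ ((inducedMap S w φ x : Space Γ μ →L[ℂ] Space Γ μ) η) =
      ∑ c : S, ∑ d : S, ((w c * w d : ℝ) : ℂ) * inner ℂ (groupOp μ (cosetSection Λ c)⁻¹ ξ)
        ((induce Λ μ (φ (coeff x c d)) : Space Γ μ →L[ℂ] Space Γ μ)
          (groupOp μ (cosetSection Λ d)⁻¹ η)) := by
  rw [inducedMap, inner_matrixCompression]
  refine Finset.sum_congr rfl fun c _ => Finset.sum_congr rfl fun d _ => ?_
  refine (congrArg₂ (fun a b => inner ℂ a ((induce Λ μ (φ (coeff x c d)) :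
    Space Γ μ →L[ℂ] Space Γ μ) b)) (star_smul_groupElt_apply (w c) (cosetSection Λ c) ξ)
    (star_smul_groupElt_apply (w d) (cosetSection Λ d) η)).trans ?_
  simp only [map_smul, inner_smul_left, inner_smul_right, Complex.conj_ofReal]
  push_cast
  ring

theorem inner_inducedMap_of_diagonal {x : (algebra Γ μ).toStarSubalgebra}
    (hx : ∀ c d : Γ ⧸ Λ, c ≠ d → coeff x c d = 0) (ξ η : Space Γ μ) :
    inner ℂ ξ ((inducedMap S w φ x : Space Γ μ →L[ℂ] Space Γ μ) η) =
      ∑ c : S, ((w c ^ 2 : ℝ) : ℂ) * inner ℂ (groupOp μ (cosetSection Λ c)⁻¹ ξ)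
        ((induce Λ μ (φ (coeff x c c)) : Space Γ μ →L[ℂ] Space Γ μ)
          (groupOp μ (cosetSection Λ c)⁻¹ η)) := by
  rw [inner_inducedMap]
  refine Finset.sum_congr rfl fun c _ => ?_
  rw [Finset.sum_eq_single c]
  · rw [sq]
  · intro d _ hd
    have h0 : induce Λ μ (φ (coeff x (c : Γ ⧸ Λ) d)) = 0 :=
      (congrArg (fun y => induce Λ μ (φ y)) (hx _ _ fun h => hd (Subtype.ext h.symm))).trans
        ((congrArg (induce Λ μ) (LinearMap.map_zero φ)).trans (LinearMap.map_zero _))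
    refine (congrArg (fun y : (algebra Γ μ).toStarSubalgebra => ((w c * w d : ℝ) : ℂ) *
      inner ℂ (groupOp μ (cosetSection Λ (c : Γ ⧸ Λ))⁻¹ ξ)
        ((y : Space Γ μ →L[ℂ] Space Γ μ) (groupOp μ (cosetSection Λ (d : Γ ⧸ Λ))⁻¹ η))) h0).trans ?_
    exact (congrArg _ (inner_zero_right _)).trans (mul_zero _)
  · exact fun h => absurd (Finset.mem_univ c) h

omit [MulAction Γ X] [MeasurableConstSMul Γ X] [SMulInvariantMeasure Γ X μ] in
theorem inner_rightOp_extend (c d : Γ ⧸ Λ) (ξ η : Space Λ μ) (hcd : c ≠ d) :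
    inner ℂ (rightOp μ (cosetSection Λ c) (extend Λ μ ξ))
      (rightOp μ (cosetSection Λ d) (extend Λ μ η)) = 0 := by
  rw [← adjoint_rightSlice_apply, ← adjoint_rightSlice_apply,
    ContinuousLinearMap.adjoint_inner_left,
    (isCoisometricDecomposition_rightSlice Λ μ).apply_adjoint_of_ne hcd, inner_zero_right]

/-- The function `s ↦ ∑ w_c w_d`, summed over the `c, d ∈ S` with `s d = c`. -/
def overlap (S : Finset (Γ ⧸ Λ)) (w : Γ ⧸ Λ → ℝ) (s : Γ) : ℝ :=
  letI := Classical.decEq (Γ ⧸ Λ)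
  ∑ c ∈ S, ∑ d ∈ S, if s • d = c then w c * w d else 0

variable (μ) in
/-- The isometry `ζ ↦ u_c ρ_d ζ` of `ℓ²(Λ, L²(X))` into `ℓ²(Γ, L²(X))`. -/
def shift (c d : Γ ⧸ Λ) : Space Λ μ →L[ℂ] Space Γ μ :=
  groupOp μ (cosetSection Λ c) ∘L (rightOp μ (cosetSection Λ d)).toContinuousLinearMap ∘L
    (extend Λ μ).toContinuousLinearMap

theorem shift_apply (c d : Γ ⧸ Λ) (ζ : Space Λ μ) : shift μ c d ζ =
    groupOp μ (cosetSection Λ c) (rightOp μ (cosetSection Λ d) (extend Λ μ ζ)) := rfl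

theorem norm_shift_apply (c d : Γ ⧸ Λ) (ζ : Space Λ μ) : ‖shift μ c d ζ‖ = ‖ζ‖ := by
  rw [shift_apply, norm_groupOp_apply, LinearIsometry.norm_map, LinearIsometry.norm_map]

theorem inner_shift (c d : Γ ⧸ Λ) (ξ : Space Γ μ) (ζ : Space Λ μ) :
    inner ℂ ξ (shift μ c d ζ) = inner ℂ (groupOp μ (cosetSection Λ c)⁻¹ ξ)
      (rightOp μ (cosetSection Λ d) (extend Λ μ ζ)) := by
  rw [shift_apply, ← inner_groupOp_groupOp μ (cosetSection Λ c)
    (groupOp μ (cosetSection Λ c)⁻¹ ξ), groupOp_apply_groupOp, mul_inv_cancel, groupOp_one]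
  rfl

/-! ### The induced map on the trace vector, its form on `L^∞(X)` and its Fourier coefficients. -/

section Trace

variable [IsProbabilityMeasure μ]

theorem groupOp_inv_traceVector (g : Γ) :
    groupOp μ g⁻¹ (traceVector Γ μ) = rightOp μ g (traceVector Γ μ) := by
  rw [groupOp_traceVector, inv_inv]

theorem induce_groupOp_inv_traceVector (y : (algebra Λ μ).toStarSubalgebra) (g : Γ) :
    (induce Λ μ y : Space Γ μ →L[ℂ] Space Γ μ) (groupOp μ g⁻¹ (traceVector Γ μ)) =
      rightOp μ g (extend Λ μ ((y : Space Λ μ →L[ℂ] Space Λ μ) (traceVector Λ μ))) := by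
  rw [groupOp_inv_traceVector, ← induce_traceVector]
  exact apply_rightOp _ _ _

/-- `u_c* Ω` is the right translate of `Ω` by the representative of `c`, and the right slices of
distinct cosets are orthogonal; only `c = d` survives. -/
theorem vectorState_inducedMap (x : (algebra Γ μ).toStarSubalgebra) :
    vectorState (traceVector Γ μ) (inducedMap S w φ x : Space Γ μ →L[ℂ] Space Γ μ) =
      ∑ c : S, ((w c ^ 2 : ℝ) : ℂ) * vectorState (traceVector Λ μ)
        (φ (coeff x c c) : Space Λ μ →L[ℂ] Space Λ μ) := by
  rw [vectorState, inner_inducedMap]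
  refine Finset.sum_congr rfl fun c _ => ?_
  have h : ∀ d : S, inner ℂ (groupOp μ (cosetSection Λ (c : Γ ⧸ Λ))⁻¹ (traceVector Γ μ))
        ((induce Λ μ (φ (coeff x c d)) : Space Γ μ →L[ℂ] Space Γ μ)
          (groupOp μ (cosetSection Λ (d : Γ ⧸ Λ))⁻¹ (traceVector Γ μ))) =
      inner ℂ (rightOp μ (cosetSection Λ (c : Γ ⧸ Λ)) (extend Λ μ (traceVector Λ μ)))
        (rightOp μ (cosetSection Λ (d : Γ ⧸ Λ)) (extend Λ μ
          ((φ (coeff x c d) : Space Λ μ →L[ℂ] Space Λ μ) (traceVector Λ μ)))) := fun d => by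
    refine congrArg₂ (fun a b => inner ℂ a b) ?_ (induce_groupOp_inv_traceVector _ _)
    rw [groupOp_inv_traceVector, extend_traceVector]
  rw [Finset.sum_eq_single c]
  · rw [sq]
    exact congrArg _ ((h c).trans
      ((LinearIsometry.inner_map_map _ _ _).trans (LinearIsometry.inner_map_map _ _ _)))
  · intro d _ hd
    exact (congrArg _ ((h d).trans
      (inner_rightOp_extend _ _ _ _ fun hcd => hd (Subtype.ext hcd.symm)))).trans (mul_zero _)
  · exact fun h => absurd (Finset.mem_univ c) h

theorem vectorState_coeff_self (x : (algebra Γ μ).toStarSubalgebra) (c : Γ ⧸ Λ) :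
    vectorState (traceVector Λ μ) (coeff x c c : Space Λ μ →L[ℂ] Space Λ μ) =
      vectorState (traceVector Γ μ) (x : Space Γ μ →L[ℂ] Space Γ μ) := by
  rw [vectorState, inner_coeff_self, extend_traceVector, groupOp_traceVector]
  refine (congrArg _ (apply_rightOp x _ _)).trans ?_
  exact LinearIsometry.inner_map_map _ _ _

/-- Complete positivity and normality come from the form of a matrix compression of `ι ∘ φ ∘ E`.
Only the diagonal coefficients of `1` are nonzero, so `Φ(1) = ∑ w_c² u_c ι(φ(1)) u_c* ≤ 1`; likewise
`τ(Φ(x)) = ∑ w_c² τ(φ(E(u_c* x u_c))) ≤ τ(x)` for `x ≥ 0`. -/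
theorem isSubtracial_inducedMap {φ} (hφ : IsSubtracial (traceVector Λ μ) φ)
    (hw : ∑ c ∈ S, w c ^ 2 = 1) :
    IsSubtracial (traceVector Γ μ) (inducedMap S w φ) := by
  have hw' : ∑ c : S, w c ^ 2 = 1 := (Finset.sum_coe_sort S fun c => w c ^ 2).trans hw
  have hcp : IsCompletelyPositiveMap (inducedMap S w φ) :=
    IsCompletelyPositiveMap.matrixCompression _ _ (isCompletelyPositiveMap_induce.comp
      (hφ.completelyPositive.comp isCompletelyPositiveMap_condExp))
  refine ⟨hcp, ?_, ?_, fun x hx => ?_⟩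
  · exact IsNormalMap.matrixCompression _ _ (isNormalMap_induce.comp
      (hφ.normal.comp isNormalMap_condExp norm_condExp_le) fun y =>
        (hφ.completelyPositive.norm_apply_le hφ.map_one_le _).trans (norm_condExp_le y))
  · have h1 : (induce Λ μ (φ 1) : Space Γ μ →L[ℂ] Space Γ μ) ≤ 1 :=
      isCompletelyPositiveMap_induce.le_one induce_one hφ.map_one_le
    rw [ContinuousLinearMap.le_def, isPositive_iff_inner]
    intro ζ
    have h2 := hcp.inner_nonneg (x := 1) (fun ζ => by
      change 0 ≤ (inner ℂ ζ ζ).re ∧ (inner ℂ ζ ζ).im = 0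
      rw [(inner_self_re_im ζ).1, (inner_self_re_im ζ).2]
      exact ⟨by positivity, rfl⟩) ζ
    have h3 : (inner ℂ ζ ((inducedMap S w φ 1 : Space Γ μ →L[ℂ] Space Γ μ) ζ)).re ≤ ‖ζ‖ ^ 2 := by
      rw [inner_inducedMap_of_diagonal S w φ (fun c d hcd => coeff_one_of_ne hcd), Complex.re_sum]
      simp only [Complex.re_ofReal_mul, coeff_one_self]
      refine (Finset.sum_le_sum fun (c : S) _ => mul_le_mul_of_nonneg_left
        (re_inner_le_of_le_one h1 (groupOp μ (cosetSection Λ (c : Γ ⧸ Λ))⁻¹ ζ))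
        (sq_nonneg (w c))).trans_eq ?_
      simp only [norm_groupOp_apply]
      rw [← Finset.sum_mul, hw', one_mul]
    change 0 ≤ (inner ℂ ζ (ζ - (inducedMap S w φ 1 : Space Γ μ →L[ℂ] Space Γ μ) ζ)).re ∧
      (inner ℂ ζ (ζ - (inducedMap S w φ 1 : Space Γ μ →L[ℂ] Space Γ μ) ζ)).im = 0
    rw [inner_sub_right, Complex.sub_re, Complex.sub_im, h2.2, (inner_self_re_im ζ).1,
      (inner_self_re_im ζ).2]
    exact ⟨sub_nonneg.2 h3, sub_zero _⟩
  · rw [vectorState_inducedMap, Complex.re_sum]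
    have h1 : ∀ c : S, (vectorState (traceVector Λ μ)
        (φ (coeff x c c) : Space Λ μ →L[ℂ] Space Λ μ)).re ≤
        (vectorState (traceVector Γ μ) (x : Space Γ μ →L[ℂ] Space Γ μ)).re := fun c => by
      refine (hφ.trace_le (coeff x c c) (isPositive_iff_inner.2 fun ζ => ?_)).trans
        (congrArg Complex.re (vectorState_coeff_self x _)).le
      rw [inner_coeff_self]
      exact isPositive_iff_inner.1 hx _
    simp only [Complex.re_ofReal_mul]
    refine (Finset.sum_le_sum fun (c : S) _ => mul_le_mul_of_nonneg_left
        (h1 c) (sq_nonneg (w c))).trans_eq ?_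
    rw [← Finset.sum_mul, hw', one_mul]

/-- Functions have only diagonal coefficients, and these are their translates: on `L^∞(X)` the form
of `Φ` is a convex combination of translates of the form of `φ` when `∑ w_c² = 1`. -/
theorem pairing_inducedMap (f g : Lp ℂ ∞ μ) :
    pairing (inducedMap S w φ) f g = ∑ c : S, ((w c ^ 2 : ℝ) : ℂ) *
      pairing φ (translate μ (cosetSection Λ (c : Γ ⧸ Λ))⁻¹ f)
        (translate μ (cosetSection Λ (c : Γ ⧸ Λ))⁻¹ g) := by
  rw [pairing, inner_inducedMap_of_diagonal S w φ (fun c d hcd => coeff_mulElt_of_ne f hcd)]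
  refine Finset.sum_congr rfl fun c _ => congrArg _ ?_
  rw [coeff_mulElt_self]
  refine (congrArg₂ (fun a b => inner ℂ a b) ?_ (induce_groupOp_inv_traceVector _ _)).trans
    ((LinearIsometry.inner_map_map _ _ _).trans (LinearIsometry.inner_map_map _ _ _))
  rw [groupOp_apply_mulOp, groupOp_inv_traceVector, extend_mulOp_traceVector]
  rfl

theorem translate_inv_fiberInd {ι : Type*} {q : X → ι} (hq : ∀ k, MeasurableSet (q ⁻¹' {k})) (g : Γ)
    (hg : ∀ k, MeasurableSet ((fun x => q (g • x)) ⁻¹' {k})) (k : ι) :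
    translate μ g⁻¹ (fiberInd μ hq k) = fiberInd μ hg k := by
  classical
  refine Lp.ext ?_
  filter_upwards [coeFn_translate μ g⁻¹ (fiberInd μ hq k), coeFn_fiberInd μ hg k,
    (measurePreserving_smul g⁻¹⁻¹ μ).quasiMeasurePreserving.ae (coeFn_fiberInd μ hq k)]
    with x h1 h2 h3
  rw [h1, h2, h3, inv_inv]

theorem diagonalMass_inducedMap {ι : Type*} [Fintype ι] {q : X → ι}
    (hq : ∀ k, MeasurableSet (q ⁻¹' {k}))
    (hg : ∀ (g : Γ) k, MeasurableSet ((fun x => q (g • x)) ⁻¹' {k})) :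
    diagonalMass (inducedMap S w φ) hq =
      ∑ c : S, w c ^ 2 * diagonalMass φ (hg (cosetSection Λ (c : Γ ⧸ Λ))) := by
  have h : ∀ k, (pairing (inducedMap S w φ) (fiberInd μ hq k) (fiberInd μ hq k)).re =
      ∑ c : S, w c ^ 2 * (pairing φ (fiberInd μ (hg (cosetSection Λ (c : Γ ⧸ Λ))) k)
        (fiberInd μ (hg (cosetSection Λ (c : Γ ⧸ Λ))) k)).re := fun k => by
    rw [pairing_inducedMap, Complex.re_sum]
    refine Finset.sum_congr rfl fun c _ => ?_
    rw [Complex.re_ofReal_mul, translate_inv_fiberInd hq _ (hg _)]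
  simp only [diagonalMass, h, Finset.mul_sum]
  exact Finset.sum_comm

theorem inducedMap_apply_traceVector (x : (algebra Γ μ).toStarSubalgebra) :
    (inducedMap S w φ x : Space Γ μ →L[ℂ] Space Γ μ) (traceVector Γ μ) =
      ∑ c : S, ∑ d : S, ((w c * w d : ℝ) : ℂ) • shift μ (c : Γ ⧸ Λ) d
          ((φ (coeff x c d) : Space Λ μ →L[ℂ] Space Λ μ) (traceVector Λ μ)) := by
  refine ext_inner_left ℂ fun ξ => ?_
  refine (inner_inducedMap S w φ x ξ _).trans ?_
  rw [inner_sum]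
  refine Finset.sum_congr rfl fun c _ => ?_
  rw [inner_sum]
  refine Finset.sum_congr rfl fun d _ => ?_
  refine Eq.trans (congrArg _ ?_) (inner_smul_right _ _ _).symm
  refine Eq.trans (congrArg _ ?_) (inner_shift _ _ _ _).symm
  exact induce_groupOp_inv_traceVector _ _

theorem coeff_apply_traceVector (x : (algebra Γ μ).toStarSubalgebra) (c d : Γ ⧸ Λ) :
    (coeff x c d : Space Λ μ →L[ℂ] Space Λ μ) (traceVector Λ μ) =
      restrict Λ μ (groupOp μ (cosetSection Λ c)⁻¹ (rightOp μ (cosetSection Λ d)⁻¹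
        ((x : Space Γ μ →L[ℂ] Space Γ μ) (traceVector Γ μ)))) := by
  rw [coeff_apply, extend_traceVector, groupOp_traceVector]
  refine congrArg _ (congrArg _ ?_)
  exact apply_rightOp x _ _

omit [IsProbabilityMeasure μ] [MulAction Γ X] [MeasurableConstSMul Γ X]
  [SMulInvariantMeasure Γ X μ] in
theorem inv_cosetSection_mul_mul_mem_iff {c d : Γ ⧸ Λ} {s : Γ} :
    (cosetSection Λ c)⁻¹ * s * cosetSection Λ d ∈ Λ ↔ s • d = c := by
  rw [mul_assoc, ← QuotientGroup.eq, mk_cosetSection, eq_comm]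
  nth_rw 2 [← mk_cosetSection Λ d]
  rfl

/-- `E(u_c* x u_d)` keeps the Fourier coefficients of `x` at those `s` with `s • d = c`, and the
shift puts them back in place. -/
theorem shift_coeff_apply_of_eq (x : (algebra Γ μ).toStarSubalgebra) {c d : Γ ⧸ Λ} {s : Γ}
    (h : s • d = c) :
    shift μ c d ((coeff x c d : Space Λ μ →L[ℂ] Space Λ μ) (traceVector Λ μ)) s =
      (x : Space Γ μ →L[ℂ] Space Γ μ) (traceVector Γ μ) s := by
  rw [shift_apply, groupOp_apply, rightOp_apply, coeff_apply_traceVector]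
  refine (congrArg (koopman μ (cosetSection Λ c))
    (extend_coe Λ μ _ ⟨_, inv_cosetSection_mul_mul_mem_iff.2 h⟩)).trans ?_
  rw [restrict_apply, groupOp_apply, rightOp_apply, ← koopman_mul, mul_inv_cancel, koopman_one]
  group

theorem shift_coeff_apply_of_ne (x : (algebra Γ μ).toStarSubalgebra) {c d : Γ ⧸ Λ} {s : Γ}
    (h : s • d ≠ c) :
    shift μ c d ((coeff x c d : Space Λ μ →L[ℂ] Space Λ μ) (traceVector Λ μ)) s = 0 := by
  rw [shift_apply, groupOp_apply, rightOp_apply, coeff_apply_traceVector,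
    extend_of_notMem Λ μ _ (fun hm => h (inv_cosetSection_mul_mul_mem_iff.1 hm)), map_zero]

theorem lp_sum_sum_smul_apply {C E : Type*} [Fintype C] [NormedAddCommGroup E] [NormedSpace ℂ E]
    {I : Type*} (a : C → C → ℝ) (v : C → C → lp (fun _ : I => E) 2) (s : I) :
    (∑ c, ∑ d, (a c d : ℂ) • v c d) s = ∑ c, ∑ d, (a c d : ℂ) • v c d s := by
  simp only [lp.coeFn_sum, Finset.sum_apply, lp.coeFn_smul, Pi.smul_apply]

omit [IsProbabilityMeasure μ] in
theorem coe_idMap_apply (y : (algebra Γ μ).toStarSubalgebra) (ξ : Space Γ μ) :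
    (idMap Γ μ y : Space Γ μ →L[ℂ] Space Γ μ) ξ = (y : Space Γ μ →L[ℂ] Space Γ μ) ξ := rfl

theorem sum_sum_smul_eq_overlap_smul {E : Type*} [AddCommGroup E] [Module ℂ E] {s : Γ}
    {u : S → S → E} {v : E} (h1 : ∀ c d : S, s • (d : Γ ⧸ Λ) = c → u c d = v)
    (h0 : ∀ c d : S, s • (d : Γ ⧸ Λ) ≠ c → u c d = 0) :
    ∑ c : S, ∑ d : S, ((w c * w d : ℝ) : ℂ) • u c d = (overlap S w s : ℂ) • v := by
  rw [overlap, ← Finset.sum_coe_sort S, Complex.ofReal_sum, Finset.sum_smul]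
  refine Finset.sum_congr rfl fun c _ => ?_
  rw [← Finset.sum_coe_sort S, Complex.ofReal_sum, Finset.sum_smul]
  refine Finset.sum_congr rfl fun d _ => ?_
  by_cases hcd : s • (d : Γ ⧸ Λ) = c
  · rw [if_pos hcd, h1 c d hcd]
  · rw [if_neg hcd, h0 c d hcd, smul_zero, Complex.ofReal_zero, zero_smul]

/-- The coefficient at `s` is reproduced once, with weight `w_c w_d`, for each pair with `s • d =
c`. So the map induced from the identity is the Fourier multiplier by `overlap S w`. -/
theorem inducedMap_id_apply_traceVector (x : (algebra Γ μ).toStarSubalgebra) (s : Γ) :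
    (inducedMap S w (idMap Λ μ) x : Space Γ μ →L[ℂ] Space Γ μ) (traceVector Γ μ) s =
      (overlap S w s : ℂ) • (x : Space Γ μ →L[ℂ] Space Γ μ) (traceVector Γ μ) s := by
  have h1 := inducedMap_apply_traceVector S w (idMap Λ μ) x
  simp only [coe_idMap_apply] at h1
  have h2 := congrArg (fun v : Space Γ μ => v s) h1
  have h3 := lp_sum_sum_smul_apply (fun c d : S => w c * w d) (fun c d : S => shift μ (c : Γ ⧸ Λ) d
    ((coeff x (c : Γ ⧸ Λ) d : Space Λ μ →L[ℂ] Space Λ μ) (traceVector Λ μ))) s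
  have h4 := sum_sum_smul_eq_overlap_smul (s := s) S w
    (fun c d hcd => shift_coeff_apply_of_eq x hcd) (fun c d hcd => shift_coeff_apply_of_ne x hcd)
  exact h2.trans (h3.trans h4)

/-- Triangle inequality: the shifts are isometric and the weights `w_c w_d` add up to `(∑ w_c)²`. -/
theorem norm_inducedMap_sub_le (hw : ∀ c, 0 ≤ w c) {x : (algebra Γ μ).toStarSubalgebra} {δ : ℝ}
    (hφ : ∀ c ∈ S, ∀ d ∈ S,
      ‖(φ (coeff x c d) : Space Λ μ →L[ℂ] Space Λ μ) (traceVector Λ μ) -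
        (coeff x c d : Space Λ μ →L[ℂ] Space Λ μ) (traceVector Λ μ)‖ ≤ δ) :
    ‖(inducedMap S w φ x : Space Γ μ →L[ℂ] Space Γ μ) (traceVector Γ μ) -
      (inducedMap S w (idMap Λ μ) x : Space Γ μ →L[ℂ] Space Γ μ) (traceVector Γ μ)‖ ≤
      (∑ c ∈ S, w c) ^ 2 * δ := by
  have h : (inducedMap S w φ x : Space Γ μ →L[ℂ] Space Γ μ) (traceVector Γ μ) -
      (inducedMap S w (idMap Λ μ) x : Space Γ μ →L[ℂ] Space Γ μ) (traceVector Γ μ) =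
      ∑ c : S, ∑ d : S, ((w c * w d : ℝ) : ℂ) • shift μ (c : Γ ⧸ Λ) d
        ((φ (coeff x c d) : Space Λ μ →L[ℂ] Space Λ μ) (traceVector Λ μ) -
        (coeff x (c : Γ ⧸ Λ) (d : Γ ⧸ Λ) : Space Λ μ →L[ℂ] Space Λ μ) (traceVector Λ μ)) := by
    refine (congrArg₂ (· - ·) (inducedMap_apply_traceVector S w φ x)
      (inducedMap_apply_traceVector S w (idMap Λ μ) x)).trans ?_
    refine (Finset.sum_sub_distrib _ _).symm.trans (Finset.sum_congr rfl fun c _ => ?_)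
    refine (Finset.sum_sub_distrib _ _).symm.trans (Finset.sum_congr rfl fun d _ => ?_)
    refine (smul_sub _ _ _).symm.trans (congrArg _ ?_)
    exact (ContinuousLinearMap.map_sub _ _ _).symm
  refine (congrArg norm h).trans_le ?_
  rw [sq, ← Finset.sum_coe_sort S, Finset.sum_mul_sum, Finset.sum_mul]
  refine (norm_sum_le _ _).trans (Finset.sum_le_sum fun c _ => ?_)
  rw [Finset.sum_mul]
  refine (norm_sum_le _ _).trans (Finset.sum_le_sum fun d _ => ?_)
  rw [norm_smul, Complex.norm_real, Real.norm_of_nonneg (mul_nonneg (hw _) (hw _)),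
    norm_shift_apply]
  exact mul_le_mul_of_nonneg_left (hφ c c.2 d d.2) (mul_nonneg (hw _) (hw _))

end Trace

end Induction

end GroupMeasureSpace

/-! ### Co-amenability -/

namespace GroupMeasureSpace

section Coamenable

theorem hasSum_comp_smul {G C : Type*} [Group G] [MulAction G C] {f : C → ℝ} {a : ℝ}
    (hf : HasSum f a) (g : G) : HasSum (fun x => f (g • x)) a :=
  (MulAction.toPerm g).hasSum_iff.2 hf

/-- Truncate `f` to a finite set of mass `m` near `1`, renormalise and take square roots. The
truncation and the renormalisation each cost `1 - m` in `ℓ¹`. -/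
theorem exists_finset_sq_near {C : Type*} {f : C → ℝ} (hf : ∀ x, 0 ≤ f x) (h1 : HasSum f 1) {ε : ℝ}
    (hε : 0 < ε) : ∃ (S : Finset C) (w : C → ℝ), (∀ x, 0 ≤ w x) ∧ (∀ x ∉ S, w x = 0) ∧
      ∑ x ∈ S, w x ^ 2 = 1 ∧ Summable (fun x => |f x - w x ^ 2|) ∧
      ∑' x, |f x - w x ^ 2| ≤ ε := by
  classical
  -- `ε / 2` pays for the total error `2 (1 - m)`, and `1 / 2` keeps `m` positive for the division.
  obtain ⟨S, hS⟩ := ((h1.eventually (lt_mem_nhds (show 1 - min (ε / 2) (1 / 2) < 1 by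
    have := lt_min (half_pos hε) one_half_pos
    linarith)))).exists
  set m := ∑ x ∈ S, f x with hm
  have hm0 : 0 < m := by linarith [min_le_right (ε / 2) (1 / 2)]
  have hm1 : m ≤ 1 := sum_le_hasSum S (fun x _ => hf x) h1
  have hw : ∀ x, (if x ∈ S then √(f x / m) else 0) ^ 2 = if x ∈ S then f x / m else 0 := fun x => by
    split_ifs
    · exact Real.sq_sqrt (div_nonneg (hf x) hm0.le)
    · exact zero_pow two_ne_zero
  have habs : ∀ x, |f x - if x ∈ S then f x / m else 0| =
      f x + if x ∈ S then f x / m - 2 * f x else 0 := fun x => by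
    split_ifs
    · rw [abs_of_nonpos (sub_nonpos.2 ((le_div_iff₀ hm0).2 (mul_le_of_le_one_right (hf x) hm1)))]
      ring
    · rw [sub_zero, add_zero, abs_of_nonneg (hf x)]
  have hsum : HasSum (fun x => |f x - if x ∈ S then f x / m else 0|) (1 + (1 - 2 * m)) := by
    simp only [habs]
    refine h1.add ?_
    have h := hasSum_sum_of_ne_finset_zero (L := .unconditional _) (s := S)
      (f := fun x => if x ∈ S then f x / m - 2 * f x else 0) fun x hx => if_neg hx
    rwa [Finset.sum_congr rfl fun x hx => if_pos hx, Finset.sum_sub_distrib, ← Finset.sum_div,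
      ← Finset.mul_sum, ← hm, div_self hm0.ne'] at h
  refine ⟨S, fun x => if x ∈ S then √(f x / m) else 0, fun x => ?_, fun x hx => if_neg hx, ?_, ?_, ?_⟩
  · dsimp only
    split_ifs
    exacts [Real.sqrt_nonneg _, le_rfl]
  · simp only [hw]
    rw [Finset.sum_congr rfl fun x hx => if_pos hx, ← Finset.sum_div, ← hm, div_self hm0.ne']
  · simp only [hw]
    exact hsum.summable
  · simp only [hw]
    rw [hsum.tsum_eq]
    linarith [min_le_left (ε / 2) (1 / 2)]

variable {Γ : Type*} [Group Γ] {Λ : Subgroup Γ} {S : Finset (Γ ⧸ Λ)} {w : Γ ⧸ Λ → ℝ}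

/-- Since `w` vanishes off `S`, the overlap is the full inner product of `w` with its translate. -/
theorem hasSum_overlap (hS : ∀ d ∉ S, w d = 0) (s : Γ) :
    HasSum (fun d => w (s • d) * w d) (overlap S w s) := by
  let _ := Classical.decEq (Γ ⧸ Λ)
  have h := hasSum_sum_of_ne_finset_zero (L := .unconditional _) (s := S)
      (f := fun d => w (s • d) * w d) fun x hx => by rw [hS x hx, mul_zero]
  convert h using 1
  rw [overlap, Finset.sum_comm]
  refine Finset.sum_congr rfl fun d _ => ?_
  rw [Finset.sum_ite_eq S (s • d) fun c => w c * w d]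
  split_ifs with hd
  · rfl
  · rw [hS _ hd, zero_mul]

theorem overlap_nonneg (hw : ∀ d, 0 ≤ w d) (s : Γ) : 0 ≤ overlap S w s :=
  Finset.sum_nonneg fun c _ => Finset.sum_nonneg fun d _ => by
    split_ifs
    exacts [mul_nonneg (hw c) (hw d), le_rfl]

theorem hasSum_sq_sub_smul (hS : ∀ d ∉ S, w d = 0) (h1 : ∑ d ∈ S, w d ^ 2 = 1) (s : Γ) :
    HasSum (fun d => (w (s • d) - w d) ^ 2) (2 * (1 - overlap S w s)) := by
  have h2 : HasSum (fun d => w d ^ 2) 1 := by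
    rw [← h1]
    exact hasSum_sum_of_ne_finset_zero fun x hx => by rw [hS x hx, zero_pow two_ne_zero]
  have h3 := hasSum_comp_smul h2 s
  have h4 := (h3.add h2).sub ((hasSum_overlap hS s).mul_left 2)
  have h5 : (1 + 1 - 2 * overlap S w s : ℝ) = 2 * (1 - overlap S w s) := by ring
  rw [h5] at h4
  refine h4.congr_fun fun d => ?_
  ring

theorem overlap_le_one (hS : ∀ d ∉ S, w d = 0) (h1 : ∑ d ∈ S, w d ^ 2 = 1) (s : Γ) :
    overlap S w s ≤ 1 := by
  linarith [(hasSum_sq_sub_smul hS h1 s).nonneg fun d => sq_nonneg _]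

/-- The scalar inequality `(a - b)² ≤ |a² - b²|` for `a, b ≥ 0` passes from `ℓ²` to `ℓ¹`; then go
from `w²` to `f`, to its translate and back. -/
theorem one_sub_overlap_le (hw : ∀ d, 0 ≤ w d) (hS : ∀ d ∉ S, w d = 0)
    (h1 : ∑ d ∈ S, w d ^ 2 = 1) {f : Γ ⧸ Λ → ℝ} (hf : Summable f)
    (hfw : Summable fun d => |f d - w d ^ 2|) (s : Γ) :
    2 * (1 - overlap S w s) ≤
      2 * ∑' d, |f d - w d ^ 2| + ∑' d, |f (s • d) - f d| := by
  have h2 : HasSum (fun d => |f (s • d) - w (s • d) ^ 2|) (∑' d, |f d - w d ^ 2|) :=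
    hasSum_comp_smul hfw.hasSum s
  have h3 : Summable fun d => |f (s • d) - f d| :=
    ((hasSum_comp_smul hf.hasSum s).summable.sub hf).abs
  rw [two_mul (∑' d, |f d - w d ^ 2|)]
  refine hasSum_le (fun d => ?_) (hasSum_sq_sub_smul hS h1 s) ((h2.add hfw.hasSum).add h3.hasSum)
  have h4 : (w (s • d) - w d) ^ 2 ≤ |w (s • d) ^ 2 - w d ^ 2| := by
    rw [sq_sub_sq, abs_mul, sq, ← abs_mul_abs_self]
    refine mul_le_mul_of_nonneg_right ?_ (abs_nonneg _)
    rw [abs_of_nonneg (add_nonneg (hw _) (hw _)), abs_le]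
    constructor <;> linarith [hw d, hw (s • d)]
  refine h4.trans ?_
  have h5 := abs_add_three (w (s • d) ^ 2 - f (s • d)) (f d - w d ^ 2) (f (s • d) - f d)
  rw [abs_sub_comm (w (s • d) ^ 2)] at h5
  refine le_trans (le_of_eq (congrArg _ ?_)) h5
  ring

theorem exists_tendsto_overlap (hΛ : Λ.IsCoamenable) :
    ∃ (S : ℕ → Finset (Γ ⧸ Λ)) (w : ℕ → Γ ⧸ Λ → ℝ), (∀ n d, 0 ≤ w n d) ∧
      (∀ n, ∑ d ∈ S n, w n d ^ 2 = 1) ∧ (∀ n s, overlap (S n) (w n) s ≤ 1) ∧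
      ∀ s, Tendsto (fun n => overlap (S n) (w n) s) atTop (𝓝 1) := by
  obtain ⟨f, hf, hf1, hft⟩ := hΛ
  choose S w hw hS h1 hsum hle using fun n : ℕ =>
    exists_finset_sq_near (hf n) (hf1 n) (ε := 1 / ((n : ℝ) + 1)) Nat.one_div_pos_of_nat
  refine ⟨S, w, hw, h1, fun n s => overlap_le_one (hS n) (h1 n) s, fun s => ?_⟩
  have hlim : Tendsto (fun n : ℕ => 1 - (1 / ((n : ℝ) + 1) +
      (∑' d, |f n (s • d) - f n d|) / 2)) atTop (𝓝 1) := by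
    -- Co-amenability is stated with `γ⁻¹ • x`, the overlap with `s • d`.
    have h := hft s⁻¹
    rw [inv_inv] at h
    simpa using (tendsto_one_div_add_atTop_nhds_zero_nat.add (h.div_const 2)).const_sub 1
  refine tendsto_of_tendsto_of_tendsto_of_le_of_le hlim tendsto_const_nhds (fun n => ?_)
    fun n => overlap_le_one (hS n) (h1 n) s
  have h := one_sub_overlap_le (hw n) (hS n) (h1 n) (hf1 n).summable (hsum n) s
  dsimp only
  linarith [hle n]

end Coamenable

end GroupMeasureSpace

/-! ### Property (T) passes to co-amenable subgroups -/

namespace GroupMeasureSpace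

/-- Dominated convergence for `∑ (1 - h_n(s))² ‖v(s)‖²`, dominated by `‖v(s)‖²`. -/
theorem tendsto_norm_sub_of_apply_eq_smul {I E : Type*} [NormedAddCommGroup E] [NormedSpace ℂ E]
    {u : ℕ → lp (fun _ : I => E) 2} {v : lp (fun _ : I => E) 2} {h : ℕ → I → ℝ}
    (h0 : ∀ n s, 0 ≤ h n s) (h1 : ∀ n s, h n s ≤ 1)
    (hlim : ∀ s, Tendsto (fun n => h n s) atTop (𝓝 1)) (hu : ∀ n s, u n s = (h n s : ℂ) • v s) :
    Tendsto (fun n => ‖u n - v‖) atTop (𝓝 0) := by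
  have hcoord : ∀ n s, ‖(u n - v) s‖ ^ 2 = (1 - h n s) ^ 2 * ‖v s‖ ^ 2 := fun n s => by
    have h2 : (u n - v) s = ((h n s - 1 : ℝ) : ℂ) • v s := by
      rw [lp.coeFn_sub, Pi.sub_apply, hu, Complex.ofReal_sub, sub_smul, Complex.ofReal_one, one_smul]
    rw [h2, norm_smul, mul_pow, Complex.norm_real, Real.norm_eq_abs, sq_abs]
    ring
  have hsq : Tendsto (fun n => ∑' s, (1 - h n s) ^ 2 * ‖v s‖ ^ 2) atTop (𝓝 (∑' _ : I, (0 : ℝ))) := by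
    refine tendsto_tsum_of_dominated_convergence (lp.hasSum_norm_sq v).summable (fun s => ?_)
      (Eventually.of_forall fun n s => ?_)
    · simpa using (((hlim s).const_sub 1).pow 2).mul_const (‖v s‖ ^ 2)
    · rw [Real.norm_of_nonneg (by positivity)]
      refine mul_le_of_le_one_left (sq_nonneg _) (pow_le_one₀ ?_ ?_) <;>
        linarith [h0 n s, h1 n s]
  rw [tsum_zero] at hsq
  have hsqrt := (Real.continuous_sqrt.tendsto 0).comp hsq
  rw [Real.sqrt_zero] at hsqrt
  refine hsqrt.congr fun n => ?_
  have h2 := lp.norm_sq_eq_tsum (u n - v)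
  simp only [hcoord] at h2
  rw [Function.comp_apply, ← h2, Real.sqrt_sq (norm_nonneg _)]

variable {Γ : Type*} [Group Γ] {Λ : Subgroup Γ} {X : Type*} [MeasurableSpace X] {μ : Measure X}
  [MulAction Γ X] [MeasurableConstSMul Γ X] [SMulInvariantMeasure Γ X μ] [IsProbabilityMeasure μ]

/-- If `Λ` is co-amenable, some of the maps induced from the identity of `L^∞(X) ⋊ Λ` are close to
the identity of `L^∞(X) ⋊ Γ` on a given finite set. -/
theorem exists_inducedMap_id_near (hΛ : Λ.IsCoamenable)
    (F : Finset (algebra Γ μ).toStarSubalgebra) {δ : ℝ} (hδ : 0 < δ) :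
    ∃ (S : Finset (Γ ⧸ Λ)) (w : Γ ⧸ Λ → ℝ), (∀ d, 0 ≤ w d) ∧ ∑ d ∈ S, w d ^ 2 = 1 ∧
      ∀ x ∈ F, ‖(inducedMap S w (idMap Λ μ) x : Space Γ μ →L[ℂ] Space Γ μ) (traceVector Γ μ) -
        (x : Space Γ μ →L[ℂ] Space Γ μ) (traceVector Γ μ)‖ ≤ δ := by
  obtain ⟨S, w, hw, h1, hle, hlim⟩ := exists_tendsto_overlap hΛ
  have h2 : ∀ x ∈ F, ∀ᶠ n in atTop,
      ‖(inducedMap (S n) (w n) (idMap Λ μ) x : Space Γ μ →L[ℂ] Space Γ μ) (traceVector Γ μ) -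
        (x : Space Γ μ →L[ℂ] Space Γ μ) (traceVector Γ μ)‖ ≤ δ := fun x _ =>
    (tendsto_norm_sub_of_apply_eq_smul (fun n s => overlap_nonneg (hw n) s) hle hlim
      fun n s => inducedMap_id_apply_traceVector (S n) (w n) x s).eventually_le_const hδ
  obtain ⟨n, hn⟩ := ((Finset.eventually_all F).2 h2).exists
  exact ⟨S n, w n, hw n, h1 n, hn⟩

/-- The bound for `Φ` is uniform over partitions, so it may be applied to one adapted to `S`. All
masses of `φ` in the resulting average are then at most the mass for `q`, and the weights `w_c²` sum
to `1`. -/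
theorem le_diagonalMass_of_inducedMap {S : Finset (Γ ⧸ Λ)} {w : Γ ⧸ Λ → ℝ}
    {φ : (algebra Λ μ).toStarSubalgebra →ₗ[ℂ] (algebra Λ μ).toStarSubalgebra}
    (hφ : IsCompletelyPositiveMap φ) (hw : ∑ d ∈ S, w d ^ 2 = 1) {ε : ℝ}
    (hε : ∀ f : Lp ℂ ∞ μ, ‖mulOp Γ μ f‖ ≤ 1 →
      ‖applyTraceₗ (inducedMap S w φ) f - applyTraceₗ (idMap Γ μ) f‖ ≤ ε)
    {ι : Type*} [Fintype ι] {q : X → ι} (hq : ∀ k, MeasurableSet (q ⁻¹' {k})) :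
    1 - ε ≤ diagonalMass φ hq := by
  -- The joint partition by all translates of `q`; translated by the representative of `c`, it has
  -- `q` as its `c`-th coordinate and so refines `q`.
  let Q : X → S → ι := fun x c => q ((cosetSection Λ (c : Γ ⧸ Λ))⁻¹ • x)
  have hQ : ∀ k, MeasurableSet (Q ⁻¹' {k}) := fun k => by
    have h : Q ⁻¹' {k} = ⋂ c : S, (fun x => (cosetSection Λ (c : Γ ⧸ Λ))⁻¹ • x) ⁻¹' (q ⁻¹' {k c}) := by
      ext x
      simp only [Q, Set.mem_preimage, Set.mem_singleton_iff, Set.mem_iInter, funext_iff]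
    rw [h]
    exact MeasurableSet.iInter fun c => measurable_const_smul _ (hq _)
  have hg : ∀ (g : Γ) k, MeasurableSet ((fun x => Q (g • x)) ⁻¹' {k}) := fun g k =>
    measurable_const_smul g (hQ k)
  classical
  refine (le_diagonalMass (T := inducedMap S w φ) hQ hε).trans ?_
  rw [diagonalMass_inducedMap S w φ hQ hg]
  have h : ∀ c : S, diagonalMass φ (hg (cosetSection Λ (c : Γ ⧸ Λ))) ≤ diagonalMass φ hq := fun c => by
    have hπ : (fun k : S → ι => k c) ∘ (fun x => Q (cosetSection Λ (c : Γ ⧸ Λ) • x)) = q := by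
      funext x
      simp only [Function.comp_apply, Q, inv_smul_smul]
    have h := diagonalMass_le_of_refinement (hg (cosetSection Λ (c : Γ ⧸ Λ))) hφ
      (fun k : S → ι => k c) (fun k => by rw [hπ]; exact hq k)
    refine h.trans_eq ?_
    congr 1
  refine (Finset.sum_le_sum fun (c : S) _ => mul_le_mul_of_nonneg_left (h c)
    (sq_nonneg (w c))).trans_eq ?_
  rw [← Finset.sum_mul, Finset.sum_coe_sort S fun c => w c ^ 2, hw, one_mul]

/-- Compare with the map induced from the identity. The `+ 1` keeps the denominator positive in all
cases. -/
theorem norm_inducedMap_sub_self_le {S : Finset (Γ ⧸ Λ)} {w : Γ ⧸ Λ → ℝ} (hw : ∀ d, 0 ≤ w d)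
    {φ : (algebra Λ μ).toStarSubalgebra →ₗ[ℂ] (algebra Λ μ).toStarSubalgebra}
    {x : (algebra Γ μ).toStarSubalgebra} {δ : ℝ} (hδ : 0 ≤ δ)
    (hx : ‖(inducedMap S w (idMap Λ μ) x : Space Γ μ →L[ℂ] Space Γ μ) (traceVector Γ μ) -
      (x : Space Γ μ →L[ℂ] Space Γ μ) (traceVector Γ μ)‖ ≤ δ)
    (hφ : ∀ c ∈ S, ∀ d ∈ S, ‖(φ (coeff x c d) : Space Λ μ →L[ℂ] Space Λ μ) (traceVector Λ μ) -
        (coeff x c d : Space Λ μ →L[ℂ] Space Λ μ) (traceVector Λ μ)‖ ≤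
          δ / ((∑ c ∈ S, w c) ^ 2 + 1)) :
    ‖(inducedMap S w φ x : Space Γ μ →L[ℂ] Space Γ μ) (traceVector Γ μ) -
      (x : Space Γ μ →L[ℂ] Space Γ μ) (traceVector Γ μ)‖ ≤ 2 * δ := by
  have h1 : (∑ c ∈ S, w c) ^ 2 * (δ / ((∑ c ∈ S, w c) ^ 2 + 1)) ≤ δ := by
    rw [mul_div_assoc', div_le_iff₀ (by positivity), mul_comm]
    exact mul_le_mul_of_nonneg_left (le_add_of_nonneg_right zero_le_one) hδ
  refine (norm_sub_le_norm_sub_add_norm_sub _ _ _).trans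
    ((add_le_add ((norm_inducedMap_sub_le S w φ hw hφ).trans h1) hx).trans_eq (two_mul δ).symm)

end GroupMeasureSpace

open GroupMeasureSpace in
/-- The relative property (T) passes to co-amenable subgroups. -/
theorem HasPropertyTRelativeToSpace.subgroup_of_isCoamenable {Γ : Type*} [Group Γ] {Λ : Subgroup Γ}
    (hΛ : Λ.IsCoamenable) {X : Type*} [MeasurableSpace X] (μ : Measure X) [IsProbabilityMeasure μ]
    [MulAction Γ X] [MeasurableConstSMul Γ X] [SMulInvariantMeasure Γ X μ]
    (h : HasPropertyTRelativeToSpace Γ μ) : HasPropertyTRelativeToSpace Λ μ := by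
  classical
  refine hasRelativePropertyT_iff.2 fun ε hε => ?_
  -- `ε ^ 2 / 4` is the mass defect allowed by `norm_applyTrace_sub_le`. Half of `δ` goes to the
  -- multiplier, half to replacing the identity by `φ`.
  obtain ⟨F, δ, hδ, hF⟩ := hasRelativePropertyT_iff.1 h (ε ^ 2 / 4) (by positivity)
  obtain ⟨S, w, hw, hw1, hS⟩ := exists_inducedMap_id_near hΛ F (half_pos hδ)
  -- `S` and `w` are fixed before `φ`, so the coefficients to be controlled form a finite set
  -- independent of `φ`.
  let F' : Finset (algebra Λ μ).toStarSubalgebra :=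
    F.biUnion fun x => S.biUnion fun c => S.image fun d => coeff x c d
  have hF' : ∀ x ∈ F, ∀ c ∈ S, ∀ d ∈ S, coeff x c d ∈ F' := fun x hx c hc d hd =>
    Finset.mem_biUnion.2 ⟨x, hx, Finset.mem_biUnion.2 ⟨c, hc, Finset.mem_image_of_mem _ hd⟩⟩
  clear_value F'
  refine ⟨F', δ / 2 / ((∑ c ∈ S, w c) ^ 2 + 1), by positivity, fun φ hφ hclose b hb hb1 => ?_⟩
  obtain ⟨f, hf⟩ := hb
  obtain rfl : mulElt Λ μ f = b := Subtype.ext hf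
  have hinduced := hF _ (isSubtracial_inducedMap S w hφ hw1) fun x hx =>
    (norm_inducedMap_sub_self_le hw (half_pos hδ).le (hS x hx) fun c hc d hd =>
      hclose _ (hF' x hx c hc d hd)).trans_eq (mul_div_cancel₀ δ two_ne_zero)
  refine norm_applyTrace_sub_le (f := f) hφ hε.le (fun ι _ q hq => ?_) hb1
  refine le_diagonalMass_of_inducedMap hφ.completelyPositive hw1 (fun g hg => ?_) hq
  exact hinduced (mulElt Γ μ g) ⟨g, rfl⟩ hg

end

theorem proposition1p5 {Γ : Type*} [Group Γ] [Countable Γ] (Λ : Subgroup Γ)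
    (hΛ : Λ.IsCoamenable) {X : Type*} [MeasurableSpace X] (μ : Measure X) [IsProbabilityMeasure μ]
    [MulAction Γ X] [MeasurableConstSMul Γ X] [SMulInvariantMeasure Γ X μ] :
    HasPropertyTRelativeToSpace Γ μ ↔ HasPropertyTRelativeToSpace Λ μ :=
  ⟨HasPropertyTRelativeToSpace.subgroup_of_isCoamenable hΛ μ,
    HasPropertyTRelativeToSpace.of_subgroup Λ μ⟩
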